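/- Let $E_1=\mathcal F^{-1}\frac{\xi_1^2}{|\xi|^2}\mathcal F$ be the Fourier multiplier operator on $L^2(\mathbb R^2)$ with symbol $\xi_1^2/|\xi|^2$. For $u\in H^1=H^1(\mathbb R^2;\mathbb C)$ and $1<p<3$ put $$E(u)=\int|\nabla u|^2\,dx-\frac{2}{p+1}\int|u|^{p+1}\,dx-\frac12\int E_1(|u|^2)|u|^2\,dx,$$ and let $$d_J=\inf_{u\in H^1\setminus\{0\}}\frac{\left(\int|u|^2dx\right)\left(\int|\nabla u|^2dx\right)}{\int E_1(|u|^2)|u|^2\,dx}.$$ Let $1<p<3$ and $0<m<2d_J$, and set $$d_m=\inf\Big\{E(u): u\in H^1,\ \int|u|^2dx=m\Big\}.$$ Then $-\infty<d_m<0$, and the infimum is attained at a positive function: there is a continuous $Q_m\in H^1$ with $Q_m(x)>0$ for all $x\in\mathbb R^2$, $\int Q_m^2\,dx=m$ and $E(Q_m)=d_m$. Moreover, for every such positive minimizer $Q_m$ there is a unique $\omega_m\in\mathbb R$ such that $u=Q_m$ is a weak solution of $$\Delta u-\omega u+|u|^{p-1}u+E_1(|u|^2)u=0,\qquad u\in H^1,$$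 with $\omega=\omega_m$, and $\omega_m>0$. -/

import Mathlib

open MeasureTheory
open scoped FourierTransform ENNReal

noncomputable section

namespace DaveyStewartson

/-- The plane `ℝ²` with its Euclidean norm and Lebesgue measure. -/
abbrev Plane : Type := EuclideanSpace ℝ (Fin 2)

/-- The classical partial derivative `∂ᵢ φ` of a real function on the plane. -/
def partialDeriv (i : Fin 2) (φ : Plane → ℝ) (x : Plane) : ℝ :=
  fderiv ℝ φ x (EuclideanSpace.single i 1)

/-- Real test functions, i.e. elements of `C_c^∞(ℝ²)`. -/
def IsTestFunction (φ : Plane → ℝ) : Prop :=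
  ContDiff ℝ (⊤ : ℕ∞) φ ∧ HasCompactSupport φ

/-- `g` is the weak partial derivative `∂ᵢ u`. -/
def HasWeakPartial (i : Fin 2) (u g : Plane → ℂ) : Prop :=
  ∀ φ : Plane → ℝ, IsTestFunction φ →
    ∫ x, u x * (partialDeriv i φ x : ℂ) = - ∫ x, g x * (φ x : ℂ)

/-- Membership in the complex Sobolev space `H¹(ℝ²)`: `u` and its weak partial derivatives
are in `L²`. -/
def MemH1 (u : Plane → ℂ) : Prop :=
  MemLp u 2 volume ∧ ∀ i : Fin 2, ∃ g : Plane → ℂ, MemLp g 2 volume ∧ HasWeakPartial i u g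

open Classical in
/-- The weak partial derivative `∂ᵢ u ∈ L²` (unique up to null sets) where it exists,
in particular for `u ∈ H¹`. -/
def weakPartial (i : Fin 2) (u : Plane → ℂ) : Plane → ℂ :=
  if h : ∃ g : Plane → ℂ, MemLp g 2 volume ∧ HasWeakPartial i u g then h.choose else 0

/-- The symbol `σ₁(ξ) = ξ₁² / |ξ|²`. It is homogeneous of degree `0`, so it defines the same
operator for every normalization of the Fourier transform. -/
def symbol (ξ : Plane) : ℂ := ((ξ 0 ^ 2 / ‖ξ‖ ^ 2 : ℝ) : ℂ)

lemma memLp_symbol : MemLp symbol ∞ (volume : Measure Plane) := by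
  refine memLp_top_of_bound (C := 1) ?_ (Filter.Eventually.of_forall fun ξ => ?_)
  · have : Measurable symbol := by unfold symbol; fun_prop
    exact this.aestronglyMeasurable
  · rw [symbol, Complex.norm_real, Real.norm_eq_abs, abs_of_nonneg (by positivity)]
    refine div_le_one_of_le₀ ?_ (by positivity)
    rw [EuclideanSpace.norm_sq_eq, Fin.sum_univ_two, Real.norm_eq_abs, Real.norm_eq_abs, sq_abs,
      sq_abs]
    nlinarith [sq_nonneg (ξ 1)]

/-- The operator `E₁ = 𝓕⁻¹ σ₁ 𝓕` on `L²(ℝ²)`. -/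
def E1L2 (f : Lp ℂ 2 (volume : Measure Plane)) : Lp ℂ 2 (volume : Measure Plane) :=
  𝓕⁻ ((memLp_symbol.toLp symbol) • (𝓕 f : Lp ℂ 2 (volume : Measure Plane)))

open Classical in
/-- `E₁ f` as a function, for `f ∈ L²`. -/
def E1 (f : Plane → ℂ) : Plane → ℂ :=
  if h : MemLp f 2 volume then (E1L2 (h.toLp f) : Plane → ℂ) else 0

/-- `|u|²` as a complex valued function; it is in `L²` for `u ∈ H¹`. -/
def absSq (u : Plane → ℂ) (x : Plane) : ℂ := ((‖u x‖ ^ 2 : ℝ) : ℂ)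

/-- `∫ |u|² dx`. -/
def mass (u : Plane → ℂ) : ℝ := ∫ x, ‖u x‖ ^ 2

/-- `∫ |∇u|² dx`. -/
def gradEnergy (u : Plane → ℂ) : ℝ := ∫ x, ∑ i : Fin 2, ‖weakPartial i u x‖ ^ 2

/-- `∫ E₁(|u|²) |u|² dx`; `E₁(|u|²)` is real valued almost everywhere. -/
def nonlocalEnergy (u : Plane → ℂ) : ℝ := ∫ x, (E1 (absSq u) x * absSq u x).re

/-- The energy `E(u) = ∫ |∇u|² - 2/(p+1) ∫ |u|^(p+1) - 1/2 ∫ E₁(|u|²)|u|²`. -/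
def energy (p : ℝ) (u : Plane → ℂ) : ℝ :=
  gradEnergy u - 2 / (p + 1) * (∫ x, ‖u x‖ ^ (p + 1)) - 1 / 2 * nonlocalEnergy u

/-- `J(u) = (∫ |u|²)(∫ |∇u|²) / ∫ E₁(|u|²)|u|²`. -/
def J (u : Plane → ℂ) : ℝ := mass u * gradEnergy u / nonlocalEnergy u

/-- `d_J`, the infimum of `J` over `H¹ \ {0}`. -/
def dJ : ℝ := sInf {r : ℝ | ∃ u : Plane → ℂ, MemH1 u ∧ ¬ u =ᵐ[volume] 0 ∧ r = J u}

/-- The constraint set `{u ∈ H¹ : ∫ |u|² = m}`. -/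
def constraintSet (m : ℝ) : Set (Plane → ℂ) := {u | MemH1 u ∧ mass u = m}

/-- `d_m`, the infimum of the energy over the constraint set, in the extended reals. -/
def dm (p m : ℝ) : EReal := ⨅ u ∈ constraintSet m, (energy p u : EReal)

/-- `Q` is a positive minimizer for `d_m`: it is in the constraint set, attains `d_m`, and is
positive at every point, where `Q` is the continuous representative of its class. -/
structure IsPositiveMinimizer (p m : ℝ) (Q : Plane → ℝ) : Prop where
  continuous : Continuous Q
  pos : ∀ x, 0 < Q x
  mem : (fun x => (Q x : ℂ)) ∈ constraintSet m
  energy_eq : (energy p (fun x => (Q x : ℂ)) : EReal) = dm p m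

/-- `u ∈ H¹` is a weak solution of `Δu - ωu + |u|^(p-1) u + E₁(|u|²) u = 0` on `ℝ²`. -/
def IsSolution (p ω : ℝ) (u : Plane → ℂ) : Prop :=
  MemH1 u ∧ ∀ φ : Plane → ℝ, IsTestFunction φ →
    ∫ x, (- (∑ i : Fin 2, weakPartial i u x * (partialDeriv i φ x : ℂ))
      - (ω : ℂ) * u x * (φ x : ℂ)
      + ((‖u x‖ ^ (p - 1) : ℝ) : ℂ) * u x * (φ x : ℂ)
      + E1 (absSq u) x * u x * (φ x : ℂ)) = 0

end DaveyStewartson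

end

noncomputable section

namespace DaveyStewartson

open scoped SchwartzMap ComplexConjugate
open Filter Topology

/-! Below the critical mass the energy is coercive. The definition of $d_J$ gives $\frac12\int
E_1(|u|^2)|u|^2\le\frac{m}{2d_J}\int|\nabla u|^2$ when the mass is at most $m$. Since $p<3$,
Ladyzhenskaya's inequality $\int|u|^4\le K\int|u|^2\int|\nabla u|^2$ lets the power term be absorbed
by the remaining part of the gradient (`exists_coercive`), so $d_m>-\infty$. Spreading a bump out at
fixed mass scales the gradient by $t^2$ and the power term by $t^{p-1}$, and the nonlocal term has a
favourable sign, so $d_m<0$ (`exists_energy_neg`).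

Existence is concentration compactness. Negative energy keeps $\int|u_n|^{p+1}$, hence
$\int|u_n|^4$, away from zero, and `exists_quartic_le_of_local_mass_le` then yields translates with
local mass bounded below. By Rellich's theorem the weak limit $u$ is nonzero, and mass and energy
split asymptotically between $u$ and $u_n-u$ (`tendsto_mass_sub`, `tendsto_energy_sub`). Amplitude
scaling gives $E(v)\ge\frac{\int|v|^2}{m}d_m$ whenever $\int|v|^2\le m$. Applied to the remainder it
yields $E(u)\le\frac{\mu}{m}d_m$ with $\mu=\int|u|^2$. If $\mu<m$, scaling $u$ up to mass $m$ would
go strictly below $d_m$, because the power term grows superlinearly. So $\mu=m$ and $u$ is a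
minimizer, and $|u|$ is one too.

Rescaling $Q+t\varphi$ to mass $m$ turns minimality into an unconstrained condition in $t$. Its
derivative at $0$ is the Euler–Lagrange equation with $\omega=(\int|Q|^{p+1}+\int
E_1(|Q|^2)|Q|^2-\int|\nabla Q|^2)/m$, positive because $E(Q)<0$. Two equations with different
$\omega$ would differ by a nonzero multiple of $\int Q\varphi$, which is positive for a suitable
$\varphi\ge0$.

Regularity uses only $L^2$ methods. $Q$ and its translates solve the same equation, and testing the
difference of two such equations with $\delta=Q(\cdot+h)-Q$ bounds $\nabla\delta$ by $\delta$ in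
$L^2$ (`gradEnergy_le_of_solvesEL`). Second differences are therefore $O(|h|^2)$ in $L^2$, so
$|\xi|^2\widehat Q\in L^2$ and, in dimension two, $\widehat Q\in L^1$. The same holds for $Q^2$, so
$E_1(Q^2)$ is bounded, say by $B$, although $E_1$ is a singular integral.

For positivity, $-\Delta Q+(\omega+B)Q\ge0$ in the weak sense. Hence
$e^{-s(\omega+B)}(e^{s\Delta}Q)(0)$ is nonincreasing in $s$. It equals $Q(0)$ at $s=0$ and is
positive at $s=1$. Translation invariance covers the other points (`SolvesEL.pos_zero`,
`SolvesEL.pos`). -/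

open Classical in
/-- The Plancherel transform of a square integrable function. -/
def FT (f : Plane → ℂ) : Plane → ℂ :=
  if h : MemLp f 2 volume then (𝓕 (h.toLp f) : Lp ℂ 2 (volume : Measure Plane)) else 0

/-! ### The Fourier transform on $L^2$, for functions rather than classes. -/

section Plancherel

variable {f g : Plane → ℂ}

lemma FT_eq (h : MemLp f 2 volume) :
    FT f = (𝓕 (h.toLp f) : Lp ℂ 2 (volume : Measure Plane)) := by
  rw [FT, dif_pos h]

lemma memLp_FT (f : Plane → ℂ) : MemLp (FT f) 2 volume := by
  by_cases h : MemLp f 2 volume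
  · rw [FT_eq h]; exact Lp.memLp _
  · rw [FT, dif_neg h]; exact MemLp.zero

lemma toLp_FT (h : MemLp f 2 volume) : (memLp_FT f).toLp (FT f) = 𝓕 (h.toLp f) := by
  apply Lp.ext
  filter_upwards [(memLp_FT f).coeFn_toLp] with x hx
  rw [hx, FT_eq h]

lemma FT_congr (h : f =ᵐ[volume] g) : FT f = FT g := by
  by_cases hf : MemLp f 2 volume
  · have hg := hf.ae_eq h
    rw [FT_eq hf, FT_eq hg, (MemLp.toLp_eq_toLp_iff hf hg).2 h]
  · have hg : ¬ MemLp g 2 volume := fun hg => hf (hg.ae_eq h.symm)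
    rw [FT, FT, dif_neg hf, dif_neg hg]

lemma FT_add (hf : MemLp f 2 volume) (hg : MemLp g 2 volume) :
    FT (fun x => f x + g x) =ᵐ[volume] fun ξ => FT f ξ + FT g ξ := by
  have hfg : MemLp (fun x => f x + g x) 2 volume := hf.add hg
  rw [FT_eq hfg, FT_eq hf, FT_eq hg]
  have : hfg.toLp _ = hf.toLp f + hg.toLp g := rfl
  rw [this, FourierTransform.fourier_add]
  exact Lp.coeFn_add _ _

lemma FT_const_mul (c : ℂ) (hf : MemLp f 2 volume) :
    FT (fun x => c * f x) =ᵐ[volume] fun ξ => c * FT f ξ := by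
  have hcf : MemLp (fun x => c * f x) 2 volume := hf.const_mul c
  rw [FT_eq hcf, FT_eq hf]
  have : hcf.toLp _ = c • hf.toLp f := rfl
  rw [this, FourierTransform.fourier_smul]
  exact Lp.coeFn_smul _ _

lemma FT_sub (hf : MemLp f 2 volume) (hg : MemLp g 2 volume) :
    FT (fun x => f x - g x) =ᵐ[volume] fun ξ => FT f ξ - FT g ξ := by
  have h := FT_add hf (hg.const_mul (-1))
  have h' := FT_const_mul (-1) hg
  have e : (fun x => f x - g x) = fun x => f x + -1 * g x := by ext; ring
  rw [e]
  filter_upwards [h, h'] with ξ h h'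
  rw [h, h']; ring

/-- Parseval's identity. -/
lemma integral_FT_mul_conj (hf : MemLp f 2 volume) (hg : MemLp g 2 volume) :
    ∫ ξ, FT f ξ * conj (FT g ξ) = ∫ x, f x * conj (g x) := by
  have h := Lp.inner_fourier_eq (hg.toLp g) (hf.toLp f)
  rw [L2.inner_def, L2.inner_def] at h
  rw [FT_eq hf, FT_eq hg]
  simp only [RCLike.inner_apply] at h
  rw [h]
  apply integral_congr_ae
  filter_upwards [hf.coeFn_toLp, hg.coeFn_toLp] with x h1 h2
  rw [h1, h2]

lemma integrable_norm_sq (hf : MemLp f 2 volume) : Integrable (fun x => ‖f x‖ ^ 2) :=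
  (memLp_two_iff_integrable_sq_norm hf.1).1 hf

lemma mass_eq_norm_sq (hf : MemLp f 2 volume) : mass f = ‖hf.toLp f‖ ^ 2 := by
  have h2 : inner ℂ (hf.toLp f) (hf.toLp f) = ((‖hf.toLp f‖ ^ 2 : ℝ) : ℂ) := by
    rw [inner_self_eq_norm_sq_to_K]; push_cast; rfl
  rw [L2.inner_def] at h2
  have h3 : ∫ x, inner ℂ ((hf.toLp f) x) ((hf.toLp f) x) = ((mass f : ℝ) : ℂ) := by
    rw [mass, ← integral_complex_ofReal]
    apply integral_congr_ae
    filter_upwards [hf.coeFn_toLp] with x h1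
    rw [h1, inner_self_eq_norm_sq_to_K]; push_cast; rfl
  rw [h3] at h2
  exact_mod_cast h2

lemma mass_FT (hf : MemLp f 2 volume) : mass (FT f) = mass f := by
  rw [mass_eq_norm_sq (memLp_FT f), mass_eq_norm_sq hf, toLp_FT hf, Lp.norm_fourier_eq]

/-- This is the agreement of the $L^2$ transform with the transform of tempered distributions. It
reduces questions about the $L^2$ transform to classical transforms of Schwartz functions. -/
lemma integral_mul_FT (hf : MemLp f 2 volume) (φ : 𝓢(Plane, ℂ)) :
    ∫ ξ, φ ξ * FT f ξ = ∫ x, 𝓕 (φ : Plane → ℂ) x * f x := by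
  have h := congrArg (fun T => T φ) (Lp.fourier_toTemperedDistribution_eq (hf.toLp f))
  simp only [TemperedDistribution.fourier_apply, Lp.toTemperedDistribution_apply,
    smul_eq_mul, SchwartzMap.fourier_coe] at h
  rw [FT_eq hf, ← h]
  apply integral_congr_ae
  filter_upwards [hf.coeFn_toLp] with x h1
  rw [h1]

lemma IsTestFunction.ofReal {φ : Plane → ℝ} (hφ : IsTestFunction φ) :
    ContDiff ℝ (⊤ : ℕ∞) (fun x => (φ x : ℂ)) ∧ HasCompactSupport (fun x => (φ x : ℂ)) :=
  ⟨Complex.ofRealCLM.contDiff.comp hφ.1, hφ.2.comp_left (g := fun t : ℝ => (t : ℂ)) rfl⟩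

/-- A test function as a complex Schwartz function. -/
def IsTestFunction.toSchwartz {φ : Plane → ℝ} (hφ : IsTestFunction φ) : 𝓢(Plane, ℂ) :=
  hφ.ofReal.2.toSchwartzMap hφ.ofReal.1

@[simp] lemma IsTestFunction.toSchwartz_apply {φ : Plane → ℝ} (hφ : IsTestFunction φ) (x : Plane) :
    hφ.toSchwartz x = (φ x : ℂ) := rfl

lemma ae_eq_of_test (hf : LocallyIntegrable f) (hg : LocallyIntegrable g)
    (h : ∀ φ : Plane → ℝ, IsTestFunction φ → ∫ x, (φ x : ℂ) * f x = ∫ x, (φ x : ℂ) * g x) :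
    f =ᵐ[volume] g := by
  refine ae_eq_of_integral_contDiff_smul_eq hf hg fun φ h1 h2 => ?_
  simpa using h φ ⟨h1, h2⟩

/-- By duality the transform is determined by its pairings with test functions. The explicit
transforms below are identified through this criterion. -/
lemma FT_unique (hf : MemLp f 2 volume) (hg : LocallyIntegrable g)
    (h : ∀ φ : Plane → ℝ, IsTestFunction φ →
      ∫ ξ, (φ ξ : ℂ) * g ξ = ∫ x, 𝓕 (fun y => (φ y : ℂ)) x * f x) :
    FT f =ᵐ[volume] g := by
  refine ae_eq_of_test ((memLp_FT f).locallyIntegrable (by norm_num)) hg fun φ hφ => ?_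
  rw [h φ hφ]
  exact integral_mul_FT hf hφ.toSchwartz

lemma integral_fourier_mul_flip (hf : Integrable f) (hg : Integrable g) :
    ∫ ξ, 𝓕 f ξ * g ξ = ∫ x, f x * 𝓕 g x := by
  have h := VectorFourier.integral_fourierIntegral_smul_eq_flip (μ := (volume : Measure Plane))
    (ν := (volume : Measure Plane)) (L := innerₗ Plane) (e := Real.fourierChar) (f := f) (g := g)
    Real.continuous_fourierChar (by exact continuous_inner) hf hg
  simp only [smul_eq_mul, flip_innerₗ] at h
  exact h

lemma continuous_fourier (hf : Integrable f) : Continuous (𝓕 f : Plane → ℂ) :=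
  VectorFourier.fourierIntegral_continuous Real.continuous_fourierChar
    (by exact continuous_inner) hf

lemma FT_eq_fourier (hf : MemLp f 2 volume) (h1 : Integrable f) : FT f =ᵐ[volume] 𝓕 f := by
  refine FT_unique hf (continuous_fourier h1).locallyIntegrable fun φ hφ => ?_
  have := integral_fourier_mul_flip hφ.toSchwartz.integrable h1
  exact this.symm

/-- The character is moved onto the test function, which stays smooth and compactly supported. Its
classical transform is thereby translated, and a change of variables finishes. -/
lemma FT_comp_add (hf : MemLp f 2 volume) (h : Plane) :
    FT (fun x => f (x + h)) =ᵐ[volume]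
      fun ξ => (Real.fourierChar (inner ℝ h ξ) : ℂ) * FT f ξ := by
  have hfh : MemLp (fun x => f (x + h)) 2 volume :=
    hf.comp_measurePreserving (measurePreserving_add_right volume h)
  have hc : Continuous fun ξ : Plane => (Real.fourierChar (inner ℝ h ξ) : ℂ) := by
    have := Real.continuous_fourierChar
    fun_prop
  refine FT_unique hfh ?_ fun φ hφ => ?_
  · refine LocallyIntegrable.mono ((memLp_FT f).locallyIntegrable (by norm_num))
      (hc.aestronglyMeasurable.mul (memLp_FT f).1) ?_
    filter_upwards with ξ
    rw [norm_mul, Circle.norm_coe, one_mul]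
  · have hsm : ContDiff ℝ (⊤ : ℕ∞) (fun ξ => (φ ξ : ℂ) * (Real.fourierChar (inner ℝ h ξ) : ℂ)) := by
      refine hφ.ofReal.1.mul ?_
      simp only [Real.fourierChar_apply]
      have : ContDiff ℝ (⊤ : ℕ∞) fun ξ : Plane => ((2 * Real.pi * inner ℝ h ξ : ℝ) : ℂ) :=
        Complex.ofRealCLM.contDiff.comp
          (contDiff_const.mul (contDiff_const.inner ℝ contDiff_id))
      exact (this.mul contDiff_const).cexp
    have hcs : HasCompactSupport (fun ξ => (φ ξ : ℂ) * (Real.fourierChar (inner ℝ h ξ) : ℂ)) :=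
      hφ.ofReal.2.mul_right
    have key := integral_mul_FT hf (hcs.toSchwartzMap hsm)
    have e : ∀ x, 𝓕 (fun ξ => (φ ξ : ℂ) * (Real.fourierChar (inner ℝ h ξ) : ℂ)) x
        = 𝓕 (fun ξ => (φ ξ : ℂ)) (x - h) := by
      intro x
      rw [Real.fourier_eq', Real.fourier_eq']
      congr 1; ext ξ
      rw [Real.fourierChar_apply, smul_eq_mul, smul_eq_mul, mul_comm (φ ξ : ℂ), ← mul_assoc,
        ← Complex.exp_add, inner_sub_right, real_inner_comm ξ h]
      congr 2; push_cast; ring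
    calc _ = ∫ ξ, (hcs.toSchwartzMap hsm) ξ * FT f ξ := by
          congr 1; ext ξ
          change _ = ((φ ξ : ℂ) * (Real.fourierChar (inner ℝ h ξ) : ℂ)) * _
          ring
      _ = ∫ x, 𝓕 (fun ξ => (φ ξ : ℂ)) (x - h) * f x := by
          rw [key]; congr 1; ext x; rw [← e]; rfl
      _ = _ := by
          rw [← integral_add_right_eq_self _ h]; simp

lemma FT_conj (hf : MemLp f 2 volume) :
    FT (fun x => conj (f x)) =ᵐ[volume] fun ξ => conj (FT f (-ξ)) := by
  have hn : MemLp (fun ξ => FT f (-ξ)) 2 volume :=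
    (memLp_FT f).comp_measurePreserving (Measure.measurePreserving_neg volume)
  have hfc : MemLp (fun x => conj (f x)) 2 volume := hf.star
  refine FT_unique hfc ?_ fun φ hφ => ?_
  · exact hn.star.locallyIntegrable (by norm_num)
  · have hφ' : IsTestFunction (fun x => φ (-x)) :=
      ⟨hφ.1.comp contDiff_neg, hφ.2.comp_homeomorph (Homeomorph.neg Plane)⟩
    have key := integral_mul_FT hf hφ'.toSchwartz
    have e : ∀ x, conj (𝓕 (fun ξ => (φ (-ξ) : ℂ)) x) = 𝓕 (fun ξ => (φ ξ : ℂ)) x := by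
      intro x
      rw [Real.fourier_eq', Real.fourier_eq', ← integral_conj, ← integral_neg_eq_self]
      congr 1; ext ξ
      simp only [smul_eq_mul, neg_neg, map_mul, ← Complex.exp_conj, inner_neg_left,
        Complex.conj_ofReal, Complex.conj_I]
      congr 2; push_cast; ring
    calc _ = ∫ ξ, (φ (-ξ) : ℂ) * conj (FT f ξ) := by
          rw [← integral_neg_eq_self]; simp
      _ = conj (∫ ξ, hφ'.toSchwartz ξ * FT f ξ) := by
          rw [← integral_conj]; simp
      _ = _ := by
          rw [key, ← integral_conj]; congr 1; ext x; rw [map_mul, ← e]; rfl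

lemma continuous_fourierInv (hf : Integrable f) : Continuous (𝓕⁻ f : Plane → ℂ) := by
  have : (𝓕⁻ f : Plane → ℂ) = fun x => 𝓕 f (-x) := by
    ext x; exact Real.fourierInv_eq_fourier_neg _ _
  rw [this]; exact (continuous_fourier hf).comp continuous_neg

/-- Fourier inversion for `L²` functions with integrable transform. -/
lemma ae_eq_fourierInv_FT (hf : MemLp f 2 volume) (h1 : Integrable (FT f)) :
    f =ᵐ[volume] 𝓕⁻ (FT f) := by
  have hc := continuous_fourierInv h1
  refine ae_eq_of_test (hf.locallyIntegrable (by norm_num)) hc.locallyIntegrable fun φ hφ => ?_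
  have key := integral_mul_FT hf (𝓕⁻ hφ.toSchwartz)
  have h2 : (𝓕 ((𝓕⁻ hφ.toSchwartz : 𝓢(Plane, ℂ)) : Plane → ℂ)) = fun x => (φ x : ℂ) := by
    rw [← SchwartzMap.fourier_coe, FourierTransform.fourier_fourierInv_eq]; rfl
  rw [h2] at key
  rw [← key]
  have h3 := integral_fourier_mul_flip (g := fun x => (φ (-x) : ℂ)) h1
    (hφ.toSchwartz.integrable.comp_neg)
  calc _ = ∫ x, FT f x * 𝓕 (fun x => (φ (-x) : ℂ)) x := by
        congr 1; ext x
        rw [mul_comm, SchwartzMap.fourierInv_coe, Real.fourierInv_eq_fourier_comp_neg]; rfl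
    _ = ∫ x, 𝓕 (FT f) x * (φ (-x) : ℂ) := h3.symm
    _ = _ := by
        rw [← integral_neg_eq_self]; congr 1; ext x
        rw [neg_neg, Real.fourierInv_eq_fourier_neg, mul_comm]

end Plancherel

/-! ### Calculus of weak derivatives and of $H^1$. -/

section WeakDerivatives

variable {i : Fin 2} {u v g g' : Plane → ℂ} {φ : Plane → ℝ}

lemma IsTestFunction.continuous (hφ : IsTestFunction φ) : Continuous φ := hφ.1.continuous

lemma IsTestFunction.differentiable (hφ : IsTestFunction φ) : Differentiable ℝ φ :=
  hφ.1.differentiable (by simp)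

lemma IsTestFunction.partialDeriv (hφ : IsTestFunction φ) (i : Fin 2) :
    IsTestFunction (partialDeriv i φ) := by
  refine ⟨?_, ?_⟩
  · have h : ContDiff ℝ (⊤ : ℕ∞) (fderiv ℝ φ) := hφ.1.fderiv_right (by simp)
    exact h.clm_apply contDiff_const
  · have h := hφ.2.fderiv (𝕜 := ℝ)
    exact h.comp_left (g := fun L : Plane →L[ℝ] ℝ => L (EuclideanSpace.single i 1)) rfl

lemma IsTestFunction.memLp (hφ : IsTestFunction φ) (q : ℝ≥0∞) :
    MemLp (fun x => (φ x : ℂ)) q volume := by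
  have h := hφ.toSchwartz.memLp q volume
  exact h

lemma integrable_mul_conj (hu : MemLp u 2 volume) (hv : MemLp v 2 volume) :
    Integrable (fun x => u x * conj (v x)) := hu.integrable_mul hv.star

lemma integrable_mul_test (hu : MemLp u 2 volume) (hφ : IsTestFunction φ) :
    Integrable (fun x => u x * (φ x : ℂ)) := hu.integrable_mul (hφ.memLp 2)

lemma HasWeakPartial.ae_unique (hg : MemLp g 2 volume) (hg' : MemLp g' 2 volume)
    (h : HasWeakPartial i u g) (h' : HasWeakPartial i u g') : g =ᵐ[volume] g' := by
  refine ae_eq_of_test (hg.locallyIntegrable (by norm_num))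
    (hg'.locallyIntegrable (by norm_num)) fun φ hφ => ?_
  have h1 := h φ hφ
  rw [h' φ hφ, neg_inj] at h1
  simpa only [mul_comm] using h1.symm

lemma memLp_weakPartial (i : Fin 2) (u : Plane → ℂ) : MemLp (weakPartial i u) 2 volume := by
  unfold weakPartial
  split_ifs with h
  · exact h.choose_spec.1
  · exact MemLp.zero

lemma MemH1.hasWeakPartial (hu : MemH1 u) (i : Fin 2) :
    HasWeakPartial i u (weakPartial i u) := by
  unfold weakPartial
  rw [dif_pos (hu.2 i)]
  exact (hu.2 i).choose_spec.2

/-- Frees `weakPartial` from its arbitrary choice: any explicit $L^2$ candidate computes it. -/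
lemma weakPartial_ae_eq (hg : MemLp g 2 volume) (h : HasWeakPartial i u g) :
    weakPartial i u =ᵐ[volume] g := by
  have hex : ∃ g : Plane → ℂ, MemLp g 2 volume ∧ HasWeakPartial i u g := ⟨g, hg, h⟩
  refine HasWeakPartial.ae_unique (memLp_weakPartial i u) hg ?_ h
  unfold weakPartial
  rw [dif_pos hex]
  exact hex.choose_spec.2

lemma HasWeakPartial.congr (h : HasWeakPartial i u g) (huv : u =ᵐ[volume] v) :
    HasWeakPartial i v g := fun φ hφ => by
  rw [← h φ hφ]
  apply integral_congr_ae
  filter_upwards [huv] with x hx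
  rw [hx]

lemma MemH1.congr (hu : MemH1 u) (huv : u =ᵐ[volume] v) : MemH1 v :=
  ⟨hu.1.ae_eq huv, fun i => ⟨weakPartial i u, memLp_weakPartial i u,
    (hu.hasWeakPartial i).congr huv⟩⟩

lemma HasWeakPartial.add (hu : MemLp u 2 volume) (hv : MemLp v 2 volume)
    (hg : MemLp g 2 volume) (hg' : MemLp g' 2 volume)
    (h : HasWeakPartial i u g) (h' : HasWeakPartial i v g') :
    HasWeakPartial i (fun x => u x + v x) (fun x => g x + g' x) := fun φ hφ => by
  simp only [add_mul]
  rw [integral_add (integrable_mul_test hu (hφ.partialDeriv i))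
    (integrable_mul_test hv (hφ.partialDeriv i)),
    integral_add (integrable_mul_test hg hφ) (integrable_mul_test hg' hφ), h φ hφ, h' φ hφ]
  ring

lemma HasWeakPartial.const_mul (c : ℂ) (h : HasWeakPartial i u g) :
    HasWeakPartial i (fun x => c * u x) (fun x => c * g x) := fun φ hφ => by
  simp only [mul_assoc]
  rw [integral_const_mul, integral_const_mul, h φ hφ]
  ring

lemma MemH1.add (hu : MemH1 u) (hv : MemH1 v) : MemH1 (fun x => u x + v x) :=
  ⟨hu.1.add hv.1, fun i => ⟨_, (memLp_weakPartial i u).add (memLp_weakPartial i v),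
    (hu.hasWeakPartial i).add hu.1 hv.1 (memLp_weakPartial i u) (memLp_weakPartial i v)
      (hv.hasWeakPartial i)⟩⟩

lemma MemH1.const_mul (c : ℂ) (hu : MemH1 u) : MemH1 (fun x => c * u x) :=
  ⟨hu.1.const_mul c, fun i => ⟨_, (memLp_weakPartial i u).const_mul c,
    (hu.hasWeakPartial i).const_mul c⟩⟩

lemma weakPartial_add (hu : MemH1 u) (hv : MemH1 v) (i : Fin 2) :
    weakPartial i (fun x => u x + v x) =ᵐ[volume]
      fun x => weakPartial i u x + weakPartial i v x :=
  weakPartial_ae_eq ((memLp_weakPartial i u).add (memLp_weakPartial i v))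
    ((hu.hasWeakPartial i).add hu.1 hv.1 (memLp_weakPartial i u) (memLp_weakPartial i v)
      (hv.hasWeakPartial i))

lemma weakPartial_const_mul (c : ℂ) (hu : MemH1 u) (i : Fin 2) :
    weakPartial i (fun x => c * u x) =ᵐ[volume] fun x => c * weakPartial i u x :=
  weakPartial_ae_eq ((memLp_weakPartial i u).const_mul c) ((hu.hasWeakPartial i).const_mul c)

lemma MemH1.sub (hu : MemH1 u) (hv : MemH1 v) : MemH1 (fun x => u x - v x) := by
  simpa [sub_eq_add_neg] using hu.add (hv.const_mul (-1))

lemma weakPartial_sub (hu : MemH1 u) (hv : MemH1 v) (i : Fin 2) :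
    weakPartial i (fun x => u x - v x) =ᵐ[volume]
      fun x => weakPartial i u x - weakPartial i v x := by
  have h := weakPartial_add hu (hv.const_mul (-1)) i
  have h' := weakPartial_const_mul (-1) hv i
  have e : (fun x => u x - v x) = fun x => u x + -1 * v x := by ext; ring
  rw [e]
  filter_upwards [h, h'] with ξ h h'
  rw [h, h']; ring

lemma weakPartial_congr (huv : u =ᵐ[volume] v) (hu : MemH1 u) (i : Fin 2) :
    weakPartial i v =ᵐ[volume] weakPartial i u :=
  weakPartial_ae_eq (memLp_weakPartial i u) ((hu.hasWeakPartial i).congr huv)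

lemma integrable_norm_sq_weakPartial (i : Fin 2) (u : Plane → ℂ) :
    Integrable (fun x => ‖weakPartial i u x‖ ^ 2) := integrable_norm_sq (memLp_weakPartial i u)

lemma gradEnergy_eq (u : Plane → ℂ) : gradEnergy u = ∑ i, mass (weakPartial i u) := by
  unfold gradEnergy mass
  rw [integral_finsetSum]
  exact fun i _ => integrable_norm_sq_weakPartial i u

lemma mass_nonneg (u : Plane → ℂ) : 0 ≤ mass u := integral_nonneg fun _ => by positivity

lemma gradEnergy_nonneg (u : Plane → ℂ) : 0 ≤ gradEnergy u :=
  integral_nonneg fun _ => by positivity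

lemma mass_congr (h : u =ᵐ[volume] v) : mass u = mass v :=
  integral_congr_ae (by filter_upwards [h] with x hx; rw [hx])

lemma mass_const_mul (c : ℂ) (u : Plane → ℂ) : mass (fun x => c * u x) = ‖c‖ ^ 2 * mass u := by
  simp only [mass, norm_mul, mul_pow, integral_const_mul]

end WeakDerivatives

/-! ### Dilated smooth cutoffs. -/

section Cutoff

/-- A smooth cutoff function equal to `1` on the closed unit ball. -/
def cutoffBump : ContDiffBump (0 : Plane) := ⟨1, 2, by norm_num, by norm_num⟩

/-- The dilated cutoff functions, equal to `1` on the ball of radius `n + 1`. -/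
def cutoff (n : ℕ) (x : Plane) : ℝ := cutoffBump (((n : ℝ) + 1)⁻¹ • x)

lemma cutoff_nonneg (n : ℕ) (x : Plane) : 0 ≤ cutoff n x := cutoffBump.nonneg

lemma cutoff_le_one (n : ℕ) (x : Plane) : cutoff n x ≤ 1 := cutoffBump.le_one

lemma isTestFunction_cutoff (n : ℕ) : IsTestFunction (cutoff n) := by
  have hn : ((n : ℝ) + 1)⁻¹ ≠ 0 := by positivity
  exact ⟨cutoffBump.contDiff.comp (contDiff_const_smul _),
    cutoffBump.hasCompactSupport.comp_homeomorph (Homeomorph.smulOfNeZero _ hn)⟩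

lemma cutoff_eq_one {n : ℕ} {x : Plane} (h : ‖x‖ ≤ n + 1) : cutoff n x = 1 := by
  apply cutoffBump.one_of_mem_closedBall
  have : cutoffBump.rIn = 1 := rfl
  rw [mem_closedBall_zero_iff, this, norm_smul, norm_inv, Real.norm_of_nonneg (by positivity)]
  rw [inv_mul_le_iff₀ (by positivity)]; simpa using h

lemma tendsto_cutoff (x : Plane) : Tendsto (fun n => cutoff n x) atTop (𝓝 1) := by
  refine tendsto_const_nhds.congr' ?_
  filter_upwards [eventually_ge_atTop ⌈‖x‖⌉₊] with n hn
  rw [cutoff_eq_one]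
  have := (Nat.le_ceil ‖x‖).trans (Nat.cast_le.2 hn)
  linarith

/-- The chain rule gains the dilation factor. Uniformity in $x$ is what makes commutator terms
vanish as the cutoffs exhaust the plane. -/
lemma exists_norm_fderiv_cutoff_le :
    ∃ C : ℝ, 0 ≤ C ∧ ∀ n x, ‖fderiv ℝ (cutoff n) x‖ ≤ C * ((n : ℝ) + 1)⁻¹ := by
  have hc : Continuous (fderiv ℝ (cutoffBump : Plane → ℝ)) :=
    (cutoffBump.contDiff (n := 1)).continuous_fderiv (by simp)
  obtain ⟨C, hC⟩ := hc.bounded_above_of_compact_support (cutoffBump.hasCompactSupport.fderiv ℝ)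
  refine ⟨C, (norm_nonneg _).trans (hC 0), fun n x => ?_⟩
  have h1 : HasFDerivAt (cutoff n)
      ((fderiv ℝ (cutoffBump : Plane → ℝ) (((n : ℝ) + 1)⁻¹ • x)).comp
        (((n : ℝ) + 1)⁻¹ • ContinuousLinearMap.id ℝ Plane)) x := by
    have h2 : HasFDerivAt (cutoffBump : Plane → ℝ)
        (fderiv ℝ (cutoffBump : Plane → ℝ) (((n : ℝ) + 1)⁻¹ • x)) (((n : ℝ) + 1)⁻¹ • x) :=
      ((cutoffBump.contDiff (n := 1)).differentiable (by simp) _).hasFDerivAt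
    exact h2.comp x ((hasFDerivAt_id x).const_smul (((n : ℝ) + 1)⁻¹))
  rw [h1.fderiv, ContinuousLinearMap.comp_smul, ContinuousLinearMap.comp_id, norm_smul, norm_inv,
    Real.norm_of_nonneg (by positivity), mul_comm]
  exact mul_le_mul_of_nonneg_right (hC _) (by positivity)

end Cutoff

/-! ### Weak derivatives on the Fourier side. -/

section FourierCharacterization

variable {i : Fin 2} {u v g g' : Plane → ℂ} {φ : Plane → ℝ}

/-- The definition only tests with real functions, so $\psi$ is split into real and imaginary parts.
-/
lemma HasWeakPartial.integral_mul_contDiff (hu : MemLp u 2 volume) (hg : MemLp g 2 volume)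
    (h : HasWeakPartial i u g) {ψ : Plane → ℂ} (hψ : ContDiff ℝ (⊤ : ℕ∞) ψ)
    (hψ' : HasCompactSupport ψ) :
    ∫ x, u x * fderiv ℝ ψ x (EuclideanSpace.single i 1) = - ∫ x, g x * ψ x := by
  have h1 : IsTestFunction (fun x => (ψ x).re) :=
    ⟨Complex.reCLM.contDiff.comp hψ, hψ'.comp_left (g := Complex.re) rfl⟩
  have h2 : IsTestFunction (fun x => (ψ x).im) :=
    ⟨Complex.imCLM.contDiff.comp hψ, hψ'.comp_left (g := Complex.im) rfl⟩
  have hd : Differentiable ℝ ψ := hψ.differentiable (by simp)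
  have d1 : ∀ x, DaveyStewartson.partialDeriv i (fun x => (ψ x).re) x
      = (fderiv ℝ ψ x (EuclideanSpace.single i 1)).re := fun x => by
    have := (Complex.reCLM.hasFDerivAt.comp x (hd x).hasFDerivAt).fderiv
    unfold DaveyStewartson.partialDeriv
    change fderiv ℝ (Complex.reCLM ∘ ψ) x _ = _
    rw [this]; rfl
  have d2 : ∀ x, DaveyStewartson.partialDeriv i (fun x => (ψ x).im) x
      = (fderiv ℝ ψ x (EuclideanSpace.single i 1)).im := fun x => by
    have := (Complex.imCLM.hasFDerivAt.comp x (hd x).hasFDerivAt).fderiv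
    unfold DaveyStewartson.partialDeriv
    change fderiv ℝ (Complex.imCLM ∘ ψ) x _ = _
    rw [this]; rfl
  have e1 : ∀ x, u x * fderiv ℝ ψ x (EuclideanSpace.single i 1) =
      u x * (DaveyStewartson.partialDeriv i (fun x => (ψ x).re) x : ℂ) +
      Complex.I * (u x * (DaveyStewartson.partialDeriv i (fun x => (ψ x).im) x : ℂ)) := fun x => by
    rw [d1, d2]
    conv_lhs => rw [← Complex.re_add_im (fderiv ℝ ψ x (EuclideanSpace.single i 1))]
    ring
  have e2 : ∀ x, g x * ψ x = g x * ((ψ x).re : ℂ) + Complex.I * (g x * ((ψ x).im : ℂ)) :=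
    fun x => by
    conv_lhs => rw [← Complex.re_add_im (ψ x)]
    ring
  simp only [e1, e2]
  rw [integral_add (integrable_mul_test hu (h1.partialDeriv i))
    ((integrable_mul_test hu (h2.partialDeriv i)).const_mul _),
    integral_add (integrable_mul_test hg h1) ((integrable_mul_test hg h2).const_mul _),
    integral_const_mul, integral_const_mul, h _ h1, h _ h2]
  ring

/-- Needed because the Fourier transform of a test function is Schwartz but in general not compactly
supported. One tests with cutoffs times $\psi$; the derivative of the cutoff contributes $O(1/n)$.
-/
lemma HasWeakPartial.integral_mul_schwartz (hu : MemLp u 2 volume) (hg : MemLp g 2 volume)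
    (h : HasWeakPartial i u g) (ψ : 𝓢(Plane, ℂ)) :
    ∫ x, u x * fderiv ℝ ψ x (EuclideanSpace.single i 1) = - ∫ x, g x * ψ x := by
  obtain ⟨C, hC0, hC⟩ := exists_norm_fderiv_cutoff_le
  set e : Plane := EuclideanSpace.single i 1 with he
  have hen : ‖e‖ = 1 := by simp [he]
  have hψd : MemLp (fun x => fderiv ℝ ψ x e) 2 volume := by
    have h := (LineDeriv.lineDerivOp e ψ).memLp 2 volume
    exact h
  have hψ2 : MemLp (ψ : Plane → ℂ) 2 volume := ψ.memLp 2
  have key : ∀ n, ∫ x, u x * ((cutoff n x : ℂ) * fderiv ℝ ψ x e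
      + (DaveyStewartson.partialDeriv i (cutoff n) x : ℂ) * ψ x)
      = - ∫ x, g x * ((cutoff n x : ℂ) * ψ x) := fun n => by
    have hc := (isTestFunction_cutoff n).ofReal
    rw [← h.integral_mul_contDiff hu hg (hc.1.mul (ψ.smooth _)) hc.2.mul_right]
    congr 1; ext x; congr 1
    have h1 : HasFDerivAt (fun x => (cutoff n x : ℂ))
        (Complex.ofRealCLM.comp (fderiv ℝ (cutoff n) x)) x :=
      Complex.ofRealCLM.hasFDerivAt.comp x
        ((isTestFunction_cutoff n).differentiable x).hasFDerivAt
    have h2 : HasFDerivAt (fun x => (cutoff n x : ℂ) * ψ x) _ x :=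
      h1.mul ψ.differentiableAt.hasFDerivAt
    rw [h2.fderiv]
    simp [DaveyStewartson.partialDeriv, ← he]
    ring
  have hpd : ∀ n x, |DaveyStewartson.partialDeriv i (cutoff n) x| ≤ C * ((n : ℝ) + 1)⁻¹ :=
    fun n x => by
    have := (fderiv ℝ (cutoff n) x).le_opNorm e
    rw [hen, mul_one] at this
    exact this.trans (hC n x)
  have L1 : Tendsto (fun n : ℕ => ∫ x, u x * ((cutoff n x : ℂ) * fderiv ℝ ψ x e
      + (DaveyStewartson.partialDeriv i (cutoff n) x : ℂ) * ψ x)) atTop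
      (𝓝 (∫ x, u x * fderiv ℝ ψ x e)) := by
    apply tendsto_integral_of_dominated_convergence
      (fun x => ‖u x * fderiv ℝ ψ x e‖ + C * ‖u x * ψ x‖)
    · intro n
      refine hu.1.mul (((isTestFunction_cutoff n).ofReal.1.continuous.aestronglyMeasurable.mul
        hψd.1).add (((isTestFunction_cutoff n).partialDeriv i).ofReal.1.continuous.aestronglyMeasurable.mul
        hψ2.1))
    · exact (hu.integrable_mul hψd).norm.add ((hu.integrable_mul hψ2).norm.const_mul C)
    · intro n
      filter_upwards with x
      have h1 : ‖(cutoff n x : ℂ)‖ ≤ 1 := by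
        rw [Complex.norm_real, Real.norm_of_nonneg (cutoff_nonneg n x)]; exact cutoff_le_one n x
      have h2 : ‖(DaveyStewartson.partialDeriv i (cutoff n) x : ℂ)‖ ≤ C := by
        rw [Complex.norm_real]
        refine (hpd n x).trans ?_
        exact mul_le_of_le_one_right hC0 (inv_le_one_of_one_le₀ (by linarith [n.cast_nonneg (α := ℝ)]))
      rw [norm_mul, norm_mul, norm_mul]
      calc _ ≤ ‖u x‖ * (1 * ‖fderiv ℝ ψ x e‖ + C * ‖ψ x‖) := by
            gcongr
            refine (norm_add_le _ _).trans ?_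
            rw [norm_mul, norm_mul]
            gcongr
        _ = _ := by ring
    · filter_upwards with x
      have h1 : Tendsto (fun n => (cutoff n x : ℂ)) atTop (𝓝 1) :=
        (Complex.continuous_ofReal.tendsto 1).comp (tendsto_cutoff x)
      have h2 : Tendsto (fun n => (DaveyStewartson.partialDeriv i (cutoff n) x : ℂ)) atTop (𝓝 0) := by
        have h3 : Tendsto (fun n : ℕ => C * ((n : ℝ) + 1)⁻¹) atTop (𝓝 (C * 0)) :=
          (tendsto_inv_atTop_zero.comp (tendsto_atTop_add_const_right _ 1
            tendsto_natCast_atTop_atTop)).const_mul C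
        rw [mul_zero] at h3
        refine squeeze_zero_norm (fun n => ?_) h3
        rw [Complex.norm_real]; exact hpd n x
      simpa using ((h1.mul_const _).add (h2.mul_const (ψ x))).const_mul (u x)
  have L2 : Tendsto (fun n : ℕ => - ∫ x, g x * ((cutoff n x : ℂ) * ψ x)) atTop
      (𝓝 (- ∫ x, g x * ψ x)) := by
    refine Tendsto.neg ?_
    apply tendsto_integral_of_dominated_convergence (fun x => ‖g x * ψ x‖)
    · intro n
      exact hg.1.mul ((isTestFunction_cutoff n).ofReal.1.continuous.aestronglyMeasurable.mul hψ2.1)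
    · exact (hg.integrable_mul hψ2).norm
    · intro n
      filter_upwards with x
      have h1 : ‖(cutoff n x : ℂ)‖ ≤ 1 := by
        rw [Complex.norm_real, Real.norm_of_nonneg (cutoff_nonneg n x)]; exact cutoff_le_one n x
      rw [norm_mul, norm_mul, norm_mul]
      gcongr
      exact mul_le_of_le_one_left (norm_nonneg _) h1
    · filter_upwards with x
      have h1 : Tendsto (fun n => (cutoff n x : ℂ)) atTop (𝓝 1) :=
        (Complex.continuous_ofReal.tendsto 1).comp (tendsto_cutoff x)
      simpa using (h1.mul_const (ψ x)).const_mul (g x)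
  simp only [key] at L1
  exact tendsto_nhds_unique L1 L2

lemma inner_single (x : Plane) (i : Fin 2) :
    inner ℝ x (EuclideanSpace.single i (1 : ℝ)) = x i := by
  simp [EuclideanSpace.inner_single_right]

lemma IsTestFunction.coord_mul (hφ : IsTestFunction φ) (i : Fin 2) :
    IsTestFunction (fun x => x i * φ x) := by
  refine ⟨ContDiff.mul ?_ hφ.1, hφ.2.mul_left⟩
  fun_prop

/-- Test the weak derivative with $\widehat\varphi$, whose derivative is the transform of $-2\pi
i\xi_i\varphi$. -/
lemma HasWeakPartial.FT_eq (hu : MemLp u 2 volume) (hg : MemLp g 2 volume)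
    (h : HasWeakPartial i u g) :
    FT g =ᵐ[volume] fun ξ => 2 * Real.pi * Complex.I * (ξ i : ℂ) * FT u ξ := by
  refine FT_unique hg ?_ fun φ hφ => ?_
  · exact ((memLp_FT u).locallyIntegrable (by norm_num)).continuous_smul
      (g := fun ξ : Plane => 2 * Real.pi * Complex.I * (ξ i : ℂ)) (by fun_prop)
  · have h1 := h.integral_mul_schwartz hu hg (𝓕 hφ.toSchwartz)
    have h2 := integral_mul_FT hu (hφ.coord_mul i).toSchwartz
    have h3 : ∀ x, fderiv ℝ (𝓕 hφ.toSchwartz : 𝓢(Plane, ℂ)) x (EuclideanSpace.single i 1)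
        = -(2 * Real.pi * Complex.I) * 𝓕 (fun ξ : Plane => ((ξ i * φ ξ : ℝ) : ℂ)) x := fun x => by
      have := congrArg (fun s : 𝓢(Plane, ℂ) => s x)
        (SchwartzMap.lineDerivOp_fourier_eq hφ.toSchwartz (EuclideanSpace.single i 1))
      simp only [SchwartzMap.lineDerivOp_apply_eq_fderiv] at this
      rw [this, FourierTransform.fourier_smul, smul_apply, smul_eq_mul,
        SchwartzMap.fourier_coe]
      congr 1
      refine congrArg (fun F : Plane → ℂ => 𝓕 F x) (funext fun ξ => ?_)
      have ht : (fun y : Plane => inner ℝ y (EuclideanSpace.single i (1 : ℝ))).HasTemperateGrowth := by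
        fun_prop
      rw [SchwartzMap.smulLeftCLM_apply_apply ht, inner_single]
      simp
    calc _ = (2 * Real.pi * Complex.I) * ∫ ξ, (hφ.coord_mul i).toSchwartz ξ * FT u ξ := by
          rw [← integral_const_mul]; congr 1; ext ξ; simp; ring
      _ = - ∫ x, u x * fderiv ℝ (𝓕 hφ.toSchwartz : 𝓢(Plane, ℂ)) x (EuclideanSpace.single i 1) := by
          rw [h2, ← integral_const_mul, ← integral_neg]; congr 1; ext x; rw [h3]
          change _ * (𝓕 (fun ξ : Plane => ((ξ i * φ ξ : ℝ) : ℂ)) x * _) = _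
          ring
      _ = _ := by
          rw [h1, neg_neg]; congr 1; ext x; rw [mul_comm]; rfl

lemma MemH1.FT_weakPartial (hu : MemH1 u) (i : Fin 2) :
    FT (weakPartial i u) =ᵐ[volume] fun ξ => 2 * Real.pi * Complex.I * (ξ i : ℂ) * FT u ξ :=
  (hu.hasWeakPartial i).FT_eq hu.1 (memLp_weakPartial i u)

lemma exists_FT_eq {a : Plane → ℂ} (ha : MemLp a 2 volume) :
    ∃ g : Plane → ℂ, MemLp g 2 volume ∧ FT g =ᵐ[volume] a := by
  refine ⟨(𝓕⁻ (ha.toLp a) : Lp ℂ 2 (volume : Measure Plane)), Lp.memLp _, ?_⟩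
  rw [DaveyStewartson.FT_eq (Lp.memLp _), Lp.toLp_coeFn, FourierTransform.fourier_fourierInv_eq]
  exact ha.coeFn_toLp

lemma hasWeakPartial_of_FT (hu : MemLp u 2 volume) (hg : MemLp g 2 volume)
    (h : FT g =ᵐ[volume] fun ξ => 2 * Real.pi * Complex.I * (ξ i : ℂ) * FT u ξ) :
    HasWeakPartial i u g := fun φ hφ => by
  have h1 := integral_mul_FT hg (𝓕⁻ hφ.toSchwartz)
  have h2 := integral_mul_FT hu (𝓕⁻ (LineDeriv.lineDerivOp (EuclideanSpace.single i (1 : ℝ)) hφ.toSchwartz))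
  rw [← SchwartzMap.fourier_coe, FourierTransform.fourier_fourierInv_eq] at h1 h2
  have h3 := SchwartzMap.fourierInv_lineDerivOp_eq hφ.toSchwartz (EuclideanSpace.single i (1 : ℝ))
  have ht : (fun y : Plane => inner ℝ y (EuclideanSpace.single i (1 : ℝ))).HasTemperateGrowth := by
    fun_prop
  have d : ∀ x, LineDeriv.lineDerivOp (EuclideanSpace.single i (1 : ℝ)) hφ.toSchwartz x =
      (partialDeriv i φ x : ℂ) := fun x => by
    rw [SchwartzMap.lineDerivOp_apply_eq_fderiv]
    have := (Complex.ofRealCLM.hasFDerivAt.comp x (hφ.differentiable x).hasFDerivAt).fderiv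
    change fderiv ℝ (Complex.ofRealCLM ∘ φ) x _ = _
    rw [this]; rfl
  calc _ = ∫ x, LineDeriv.lineDerivOp (EuclideanSpace.single i (1 : ℝ)) hφ.toSchwartz x * u x := by
        congr 1; ext x; rw [d, mul_comm]
    _ = - ∫ ξ, (𝓕⁻ hφ.toSchwartz) ξ * FT g ξ := by
        rw [← h2, h3, ← integral_neg]
        apply integral_congr_ae
        filter_upwards [h] with ξ hξ
        rw [hξ, smul_apply, SchwartzMap.smulLeftCLM_apply_apply ht, inner_single,
          smul_eq_mul, Complex.real_smul]
        ring
    _ = _ := by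
        rw [h1]; congr 2; ext x; rw [mul_comm]; rfl

/-- The candidate for $\partial_iu$ is the inverse transform of $2\pi i\xi_i\widehat u$, available
because the $L^2$ transform is onto. -/
lemma memH1_of_FT (hu : MemLp u 2 volume)
    (h : ∀ i : Fin 2, MemLp (fun ξ : Plane => (ξ i : ℂ) * FT u ξ) 2 volume) : MemH1 u := by
  refine ⟨hu, fun i => ?_⟩
  obtain ⟨g, hg, hg'⟩ := exists_FT_eq ((h i).const_mul (2 * Real.pi * Complex.I))
  refine ⟨g, hg, hasWeakPartial_of_FT hu hg ?_⟩
  filter_upwards [hg'] with ξ hξ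
  rw [hξ]; ring

lemma MemH1.memLp_coord_mul_FT (hu : MemH1 u) (i : Fin 2) :
    MemLp (fun ξ : Plane => (ξ i : ℂ) * FT u ξ) 2 volume := by
  have h := ((memLp_FT (weakPartial i u)).ae_eq (hu.FT_weakPartial i)).const_mul
    (2 * Real.pi * Complex.I)⁻¹
  refine h.ae_eq ?_
  filter_upwards with ξ
  have : (2 * Real.pi * Complex.I : ℂ) ≠ 0 := by simp
  field_simp

lemma MemH1.mass_weakPartial (hu : MemH1 u) (i : Fin 2) :
    mass (weakPartial i u) = (2 * Real.pi) ^ 2 * ∫ ξ, ξ i ^ 2 * ‖FT u ξ‖ ^ 2 := by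
  rw [← mass_FT (memLp_weakPartial i u), mass_congr (hu.FT_weakPartial i), mass,
    ← integral_const_mul]
  congr 1; ext ξ
  simp [mul_pow]
  ring

end FourierCharacterization

/-- Fatou's lemma for the Bochner integral of nonnegative functions. -/
lemma integrable_and_integral_le_of_tendsto {α : Type*} [MeasurableSpace α] {μ : Measure α}
    {F : ℕ → α → ℝ} {f : α → ℝ} {c : ℕ → ℝ} {C : ℝ} (hF : ∀ n, Integrable (F n) μ)
    (h0 : ∀ n x, 0 ≤ F n x) (hlim : ∀ᵐ x ∂μ, Tendsto (fun n => F n x) atTop (𝓝 (f x)))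
    (hc : ∀ n, ∫ x, F n x ∂μ ≤ c n) (hC : Tendsto c atTop (𝓝 C)) :
    Integrable f μ ∧ ∫ x, f x ∂μ ≤ C := by
  have hfm : AEStronglyMeasurable f μ :=
    aestronglyMeasurable_of_tendsto_ae atTop (fun n => (hF n).1) hlim
  have hf0 : 0 ≤ᵐ[μ] f := by
    filter_upwards [hlim] with x hx
    exact ge_of_tendsto' hx fun n => h0 n x
  have hC0 : 0 ≤ C := ge_of_tendsto' hC fun n => (integral_nonneg (h0 n)).trans (hc n)
  have key : ∫⁻ x, ENNReal.ofReal (f x) ∂μ ≤ ENNReal.ofReal C := by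
    calc ∫⁻ x, ENNReal.ofReal (f x) ∂μ
        = ∫⁻ x, liminf (fun n => ENNReal.ofReal (F n x)) atTop ∂μ := by
          apply lintegral_congr_ae
          filter_upwards [hlim] with x hx
          exact ((ENNReal.tendsto_ofReal hx).liminf_eq).symm
      _ ≤ liminf (fun n => ∫⁻ x, ENNReal.ofReal (F n x) ∂μ) atTop :=
          lintegral_liminf_le' fun n => (hF n).1.aemeasurable.ennreal_ofReal
      _ ≤ liminf (fun n => ENNReal.ofReal (c n)) atTop := by
          refine liminf_le_liminf (Eventually.of_forall fun n => ?_)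
          rw [← ofReal_integral_eq_lintegral_ofReal (hF n) (Eventually.of_forall (h0 n))]
          exact ENNReal.ofReal_le_ofReal (hc n)
      _ = ENNReal.ofReal C := (ENNReal.tendsto_ofReal hC).liminf_eq
  have hfi : Integrable f μ := by
    refine ⟨hfm, ?_⟩
    rw [hasFiniteIntegral_iff_ofReal hf0]
    exact key.trans_lt ENNReal.ofReal_lt_top
  refine ⟨hfi, ?_⟩
  rw [integral_eq_lintegral_of_nonneg_ae hf0 hfm]
  exact ENNReal.toReal_le_of_le_ofReal hC0 key

/-! ### Translation invariance of mass and gradient. -/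

section Translation

variable {i : Fin 2} {u v g : Plane → ℂ}

lemma MemLp.comp_add {q : ℝ≥0∞} (hu : MemLp u q volume) (h : Plane) :
    MemLp (fun x => u (x + h)) q volume :=
  hu.comp_measurePreserving (measurePreserving_add_right volume h)

lemma HasWeakPartial.comp_add (hg : HasWeakPartial i u g) (h : Plane) :
    HasWeakPartial i (fun x => u (x + h)) (fun x => g (x + h)) := fun φ hφ => by
  have hφ' : IsTestFunction (fun x => φ (x - h)) :=
    ⟨hφ.1.comp (contDiff_id.sub contDiff_const),
      hφ.2.comp_homeomorph (Homeomorph.subRight h)⟩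
  have := hg _ hφ'
  rw [← integral_add_right_eq_self _ h, ← integral_add_right_eq_self
    (fun x => g x * (φ (x - h) : ℂ)) h] at this
  simp only [add_sub_cancel_right] at this
  rw [← this]
  congr 1; ext x; congr 2
  unfold partialDeriv
  have : HasFDerivAt (fun x => φ (x - h)) (fderiv ℝ φ x) (x + h) := by
    have h1 : HasFDerivAt φ (fderiv ℝ φ x) ((x + h) - h) := by
      rw [add_sub_cancel_right]; exact (hφ.differentiable x).hasFDerivAt
    exact h1.comp (x + h) ((hasFDerivAt_id _).sub_const h)
  rw [this.fderiv]

lemma MemH1.comp_add (hu : MemH1 u) (h : Plane) : MemH1 (fun x => u (x + h)) :=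
  ⟨MemLp.comp_add hu.1 h, fun i => ⟨_, MemLp.comp_add (memLp_weakPartial i u) h,
    (hu.hasWeakPartial i).comp_add h⟩⟩

lemma weakPartial_comp_add (hu : MemH1 u) (h : Plane) (i : Fin 2) :
    weakPartial i (fun x => u (x + h)) =ᵐ[volume] fun x => weakPartial i u (x + h) :=
  weakPartial_ae_eq (MemLp.comp_add (memLp_weakPartial i u) h) ((hu.hasWeakPartial i).comp_add h)

lemma mass_comp_add (u : Plane → ℂ) (h : Plane) : mass (fun x => u (x + h)) = mass u :=
  integral_add_right_eq_self (fun x => ‖u x‖ ^ 2) h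

lemma gradEnergy_comp_add (hu : MemH1 u) (h : Plane) :
    gradEnergy (fun x => u (x + h)) = gradEnergy u := by
  rw [gradEnergy_eq, gradEnergy_eq]
  refine Finset.sum_congr rfl fun i _ => ?_
  rw [mass_congr (weakPartial_comp_add hu h i), mass_comp_add]

end Translation

/-! ### Difference quotients and their Fourier symbols. -/

section DifferenceQuotient

variable {i : Fin 2} {u v g f : Plane → ℂ}

/-- The symbol of the difference operator with step `t` in direction `i`. -/
def diffSymbol (i : Fin 2) (t : ℝ) (ξ : Plane) : ℂ := (Real.fourierChar (t * ξ i) : ℂ) - 1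

lemma continuous_diffSymbol (i : Fin 2) (t : ℝ) : Continuous (diffSymbol i t) := by
  have := Real.continuous_fourierChar
  unfold diffSymbol
  fun_prop

lemma norm_diffSymbol_le (i : Fin 2) (t : ℝ) (ξ : Plane) :
    ‖diffSymbol i t ξ‖ ≤ |t| * (2 * Real.pi * |ξ i|) := by
  unfold diffSymbol
  rw [Real.fourierChar_apply, mul_comm]
  refine (Real.norm_exp_I_mul_ofReal_sub_one_le).trans ?_
  rw [Real.norm_eq_abs, abs_mul, abs_mul, abs_mul, abs_of_pos Real.pi_pos, abs_two]
  exact le_of_eq (by ring)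

lemma tendsto_norm_diffSymbol_div (i : Fin 2) (ξ : Plane) :
    Tendsto (fun n : ℕ => ‖diffSymbol i ((n : ℝ) + 1)⁻¹ ξ‖ * ((n : ℝ) + 1)) atTop
      (𝓝 (2 * Real.pi * |ξ i|)) := by
  have h1 : HasDerivAt (fun t : ℝ => (Real.fourierChar (t * ξ i) : ℂ))
      (2 * Real.pi * Complex.I * Real.fourierChar (0 * ξ i) * (ξ i : ℂ)) 0 := by
    have h0 : HasDerivAt (fun t : ℝ => t * ξ i) (ξ i) 0 := by
      simpa using (hasDerivAt_id (0 : ℝ)).mul_const (ξ i)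
    have h := HasDerivAt.scomp (0 : ℝ) (Real.hasDerivAt_fourierChar (0 * ξ i)) h0
    rw [Complex.real_smul, mul_comm] at h
    exact h
  have h2 := h1.tendsto_slope_zero
  have h3 : Tendsto (fun n : ℕ => ((n : ℝ) + 1)⁻¹) atTop (𝓝[≠] 0) := by
    refine tendsto_nhdsWithin_iff.2 ⟨tendsto_inv_atTop_zero.comp (tendsto_atTop_add_const_right _ 1
            tendsto_natCast_atTop_atTop), Eventually.of_forall fun n => ?_⟩
    have : ((n : ℝ) + 1)⁻¹ ≠ 0 := by positivity
    exact this
  have h4 := (h2.comp h3).norm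
  have e : ‖2 * Real.pi * Complex.I * Real.fourierChar (0 * ξ i) * (ξ i : ℂ)‖
      = 2 * Real.pi * |ξ i| := by
    simp [abs_of_pos Real.pi_pos]
  rw [e] at h4
  refine h4.congr fun n => ?_
  simp only [Function.comp, zero_add, norm_smul, inv_inv, diffSymbol]
  rw [Real.norm_of_nonneg (by positivity), mul_comm]
  simp

lemma FT_translate_sub (hf : MemLp f 2 volume) (i : Fin 2) (t : ℝ) :
    FT (fun x => f (x + EuclideanSpace.single i t) - f x) =ᵐ[volume]
      fun ξ => diffSymbol i t ξ * FT f ξ := by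
  filter_upwards [FT_sub (MemLp.comp_add hf (EuclideanSpace.single i t)) hf,
    FT_comp_add hf (EuclideanSpace.single i t)] with ξ h1 h2
  rw [h1, h2, diffSymbol]
  have : inner ℝ (EuclideanSpace.single i t) ξ = t * ξ i := by
    simp [EuclideanSpace.inner_single_left]
  rw [this]; ring

lemma mass_translate_sub (hf : MemLp f 2 volume) (i : Fin 2) (t : ℝ) :
    mass (fun x => f (x + EuclideanSpace.single i t) - f x) =
      ∫ ξ, ‖diffSymbol i t ξ‖ ^ 2 * ‖FT f ξ‖ ^ 2 := by
  have hd : MemLp (fun x => f (x + EuclideanSpace.single i t) - f x) 2 volume :=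
    (MemLp.comp_add hf _).sub hf
  rw [← mass_FT hd, mass_congr (FT_translate_sub hf i t), mass]
  simp only [norm_mul, mul_pow]

lemma integrable_coord_sq_mul (hf : MemLp (fun ξ : Plane => (ξ i : ℂ) * FT f ξ) 2 volume) :
    Integrable (fun ξ : Plane => ξ i ^ 2 * ‖FT f ξ‖ ^ 2) := by
  have := integrable_norm_sq hf
  simpa [mul_pow] using this

/-- By Plancherel this is the pointwise bound $|e^{2\pi it\xi_i}-1|\le2\pi|t\xi_i|$ on symbols. -/
lemma mass_translate_sub_le (hu : MemH1 u) (i : Fin 2) (t : ℝ) :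
    mass (fun x => u (x + EuclideanSpace.single i t) - u x) ≤
      t ^ 2 * mass (weakPartial i u) := by
  rw [mass_translate_sub hu.1, hu.mass_weakPartial, ← integral_const_mul, ← integral_const_mul]
  refine integral_mono_of_nonneg (Eventually.of_forall fun ξ => by positivity)
    (((integrable_coord_sq_mul (hu.memLp_coord_mul_FT i)).const_mul _).const_mul _)
    (Eventually.of_forall fun ξ => ?_)
  have h := pow_le_pow_left₀ (norm_nonneg _) (norm_diffSymbol_le i t ξ) 2
  rw [mul_pow, mul_pow, sq_abs, sq_abs] at h
  calc _ ≤ (t ^ 2 * ((2 * Real.pi) ^ 2 * ξ i ^ 2)) * ‖FT u ξ‖ ^ 2 :=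
        mul_le_mul_of_nonneg_right h (by positivity)
    _ = _ := by ring

/-- A function whose `k`-th order difference quotients in direction `i` are bounded in `L²` has
`ξᵢᵏ f̂` in `L²`. -/
lemma integrable_of_diffSymbol_bound (f : Plane → ℂ) (i : Fin 2) (k : ℕ) {C : ℝ}
    (h : ∀ n : ℕ, ∫ ξ, (‖diffSymbol i ((n : ℝ) + 1)⁻¹ ξ‖ ^ k) ^ 2 * ‖FT f ξ‖ ^ 2
      ≤ C * ((((n : ℝ) + 1)⁻¹) ^ k) ^ 2) :
    Integrable (fun ξ : Plane => ((2 * Real.pi * |ξ i|) ^ k) ^ 2 * ‖FT f ξ‖ ^ 2) ∧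
      ∫ ξ, ((2 * Real.pi * |ξ i|) ^ k) ^ 2 * ‖FT f ξ‖ ^ 2 ≤ C := by
  -- Fatou's lemma with steps $1/(n+1)$: the rescaled symbols converge pointwise to $2\pi|\xi_i|$.
  refine integrable_and_integral_le_of_tendsto (c := fun _ => C)
    (F := fun n ξ => ((‖diffSymbol i ((n : ℝ) + 1)⁻¹ ξ‖ * ((n : ℝ) + 1)) ^ k) ^ 2 * ‖FT f ξ‖ ^ 2)
    (fun n => ?_) (fun n ξ => by positivity) (Eventually.of_forall fun ξ => ?_) (fun n => ?_)
    tendsto_const_nhds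
  · refine (integrable_norm_sq (memLp_FT f)).bdd_mul (c := ((2 * ((n : ℝ) + 1)) ^ k) ^ 2) ?_
      (Eventually.of_forall fun ξ => ?_)
    · have := continuous_diffSymbol i ((n : ℝ) + 1)⁻¹
      exact Continuous.aestronglyMeasurable (by fun_prop)
    · rw [Real.norm_of_nonneg (by positivity)]
      have : ‖diffSymbol i ((n : ℝ) + 1)⁻¹ ξ‖ ≤ 2 := by
        refine (norm_sub_le _ _).trans ?_
        rw [Circle.norm_coe, norm_one]; norm_num
      gcongr
  · exact ((((tendsto_norm_diffSymbol_div i ξ)).pow k).pow 2).mul_const _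
  · have h1 := h n
    have hn : (0 : ℝ) < (n : ℝ) + 1 := by positivity
    calc _ = ((((n : ℝ) + 1)) ^ k) ^ 2 *
          ∫ ξ, (‖diffSymbol i ((n : ℝ) + 1)⁻¹ ξ‖ ^ k) ^ 2 * ‖FT f ξ‖ ^ 2 := by
          rw [← integral_const_mul]; congr 1; ext ξ; rw [mul_pow, mul_pow]; ring
      _ ≤ ((((n : ℝ) + 1)) ^ k) ^ 2 * (C * ((((n : ℝ) + 1)⁻¹) ^ k) ^ 2) := by gcongr
      _ = C := by rw [inv_pow]; field_simp

/-- The modulus of an `H¹` function is in `H¹`, and does not have a larger gradient norm. -/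
lemma MemH1.norm (hu : MemH1 u) : MemH1 (fun x => (‖u x‖ : ℂ)) ∧
    gradEnergy (fun x => (‖u x‖ : ℂ)) ≤ gradEnergy u := by
  set w : Plane → ℂ := fun x => (‖u x‖ : ℂ) with hw
  have hw2 : MemLp w 2 volume := hu.1.norm.ofReal
  have key : ∀ i : Fin 2,
      Integrable (fun ξ : Plane => ((2 * Real.pi * |ξ i|) ^ 1) ^ 2 * ‖FT w ξ‖ ^ 2) ∧
      ∫ ξ, ((2 * Real.pi * |ξ i|) ^ 1) ^ 2 * ‖FT w ξ‖ ^ 2 ≤ mass (weakPartial i u) := by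
    intro i
    -- The reverse triangle inequality bounds differences of $|u|$ by those of $u$, so no chain rule
    -- for the modulus is required.
    refine integrable_of_diffSymbol_bound w i 1 fun n => ?_
    simp only [pow_one]
    rw [← mass_translate_sub hw2, mul_comm]
    refine le_trans ?_ (mass_translate_sub_le hu i _)
    refine integral_mono_of_nonneg (Eventually.of_forall fun ξ => by positivity)
      (integrable_norm_sq ((MemLp.comp_add hu.1 _).sub hu.1)) (Eventually.of_forall fun x => ?_)
    simp only [hw]
    rw [← Complex.ofReal_sub, Complex.norm_real]
    exact pow_le_pow_left₀ (norm_nonneg _) (abs_norm_sub_norm_le _ _) 2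
  have hwH : MemH1 w := by
    refine memH1_of_FT hw2 fun i => ?_
    refine (memLp_two_iff_integrable_sq_norm ?_).2 ?_
    · have : Continuous fun ξ : Plane => (ξ i : ℂ) := by fun_prop
      exact this.aestronglyMeasurable.mul (memLp_FT w).1
    · refine ((key i).1.const_mul ((2 * Real.pi) ^ 2)⁻¹).congr (Eventually.of_forall fun ξ => ?_)
      simp only [norm_mul, mul_pow, pow_one, sq_abs, Complex.norm_real, Real.norm_eq_abs]
      have := Real.pi_pos
      field_simp
  refine ⟨hwH, ?_⟩
  rw [gradEnergy_eq, gradEnergy_eq]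
  refine Finset.sum_le_sum fun i _ => ?_
  rw [hwH.mass_weakPartial, ← integral_const_mul]
  refine le_trans (le_of_eq ?_) (key i).2
  congr 1; ext ξ; rw [pow_one, mul_pow (2 * Real.pi) |ξ i|, sq_abs]; ring

end DifferenceQuotient

/-! ### Products of $H^1$ functions with test functions. -/

section Product

variable {i : Fin 2} {u g : Plane → ℂ} {χ : Plane → ℝ}

lemma MemLp.mul_test (hu : MemLp u 2 volume) (hχ : IsTestFunction χ) :
    MemLp (fun x => (χ x : ℂ) * u x) 2 volume :=
  hu.mul (p := ∞) (hχ.memLp ∞)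

lemma HasWeakPartial.mul_test (hu : MemLp u 2 volume) (hgm : MemLp g 2 volume)
    (hg : HasWeakPartial i u g) (hχ : IsTestFunction χ) :
    HasWeakPartial i (fun x => (χ x : ℂ) * u x)
      (fun x => (χ x : ℂ) * g x + (partialDeriv i χ x : ℂ) * u x) := fun φ hφ => by
  have hφ' : IsTestFunction (fun x => χ x * φ x) := ⟨hχ.1.mul hφ.1, hχ.2.mul_right⟩
  have d : ∀ x, partialDeriv i (fun x => χ x * φ x) x =
      χ x * partialDeriv i φ x + partialDeriv i χ x * φ x := fun x => by
    have : HasFDerivAt (fun x => χ x * φ x) _ x :=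
      (hχ.differentiable x).hasFDerivAt.mul (hφ.differentiable x).hasFDerivAt
    unfold partialDeriv
    rw [this.fderiv]
    simp; ring
  have h1 := hg _ hφ'
  simp only [d] at h1
  have i1 : Integrable (fun x => (χ x : ℂ) * u x * (partialDeriv i φ x : ℂ)) :=
    integrable_mul_test (MemLp.mul_test hu hχ) (hφ.partialDeriv i)
  have i2 : Integrable (fun x => (partialDeriv i χ x : ℂ) * u x * (φ x : ℂ)) :=
    integrable_mul_test (MemLp.mul_test hu (hχ.partialDeriv i)) hφ
  have i3 : Integrable (fun x => (χ x : ℂ) * g x * (φ x : ℂ)) :=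
    integrable_mul_test (MemLp.mul_test hgm hχ) hφ
  have e1 : ∫ x, u x * ((χ x * partialDeriv i φ x + partialDeriv i χ x * φ x : ℝ) : ℂ)
      = (∫ x, (χ x : ℂ) * u x * (partialDeriv i φ x : ℂ)) +
        ∫ x, (partialDeriv i χ x : ℂ) * u x * (φ x : ℂ) := by
    rw [← integral_add i1 i2]; congr 1; ext x; push_cast; ring
  have e2 : ∫ x, ((χ x : ℂ) * g x + (partialDeriv i χ x : ℂ) * u x) * (φ x : ℂ)
      = (∫ x, (χ x : ℂ) * g x * (φ x : ℂ)) + ∫ x, (partialDeriv i χ x : ℂ) * u x * (φ x : ℂ) := by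
    rw [← integral_add i3 i2]; congr 1; ext x; ring
  have e3 : ∫ x, g x * ((χ x * φ x : ℝ) : ℂ) = ∫ x, (χ x : ℂ) * g x * (φ x : ℂ) := by
    congr 1; ext x; push_cast; ring
  rw [e1, e3] at h1
  rw [e2, eq_sub_of_add_eq h1]; ring

lemma MemH1.mul_test (hu : MemH1 u) (hχ : IsTestFunction χ) :
    MemH1 (fun x => (χ x : ℂ) * u x) :=
  ⟨MemLp.mul_test hu.1 hχ, fun i => ⟨_, (MemLp.mul_test (memLp_weakPartial i u) hχ).add
    (MemLp.mul_test hu.1 (hχ.partialDeriv i)),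
    (hu.hasWeakPartial i).mul_test hu.1 (memLp_weakPartial i u) hχ⟩⟩

lemma weakPartial_mul_test (hu : MemH1 u) (hχ : IsTestFunction χ) (i : Fin 2) :
    weakPartial i (fun x => (χ x : ℂ) * u x) =ᵐ[volume]
      fun x => (χ x : ℂ) * weakPartial i u x + (partialDeriv i χ x : ℂ) * u x :=
  weakPartial_ae_eq ((MemLp.mul_test (memLp_weakPartial i u) hχ).add
    (MemLp.mul_test hu.1 (hχ.partialDeriv i)))
    ((hu.hasWeakPartial i).mul_test hu.1 (memLp_weakPartial i u) hχ)

end Product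

lemma integral_add_add {α : Type*} [MeasurableSpace α] {μ : Measure α} {f g h : α → ℝ}
    (hf : Integrable f μ) (hg : Integrable g μ) (hh : Integrable h μ) :
    ∫ x, (f x + g x + h x) ∂μ = ∫ x, f x ∂μ + ∫ x, g x ∂μ + ∫ x, h x ∂μ := by
  have hfg : Integrable (fun x => f x + g x) μ := hf.add hg
  rw [integral_add hfg hh, integral_add hf hg]

/-- The Cauchy–Schwarz inequality for integrals of real functions. -/
lemma sq_integral_mul_le {α : Type*} [MeasurableSpace α] {μ : Measure α} {f g : α → ℝ}
    (hf : MemLp f 2 μ) (hg : MemLp g 2 μ) :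
    (∫ x, f x * g x ∂μ) ^ 2 ≤ (∫ x, f x ^ 2 ∂μ) * ∫ x, g x ^ 2 ∂μ := by
  have hfg : Integrable (fun x => f x * g x) μ := hf.integrable_mul hg
  have hff : Integrable (fun x => f x ^ 2) μ := hf.integrable_sq
  have hgg : Integrable (fun x => g x ^ 2) μ := hg.integrable_sq
  have h : ∀ t : ℝ, 0 ≤ (∫ x, g x ^ 2 ∂μ) * (t * t) + (2 * ∫ x, f x * g x ∂μ) * t +
      ∫ x, f x ^ 2 ∂μ := fun t => by
    have : (∫ x, g x ^ 2 ∂μ) * (t * t) + (2 * ∫ x, f x * g x ∂μ) * t + ∫ x, f x ^ 2 ∂μ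
        = ∫ x, (f x + t * g x) ^ 2 ∂μ := by
      have e : ∀ x, (f x + t * g x) ^ 2 = (t * t) * g x ^ 2 + (2 * t) * (f x * g x) + f x ^ 2 :=
        fun x => by ring
      simp only [e]
      rw [integral_add_add (hgg.const_mul _) (hfg.const_mul _) hff, integral_const_mul,
        integral_const_mul]
      ring
    rw [this]
    exact integral_nonneg fun x => sq_nonneg _
  have := discrim_le_zero h
  unfold discrim at this
  nlinarith

/-! ### Ladyzhenskaya's inequality. -/

section Ladyzhenskaya

variable {u v w : Plane → ℂ}

/-- The $W^{1,1}\to L^2$ Sobolev inequality of the plane is applied to $v^2$. As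
$|\nabla(v^2)|\le2|v||\nabla v|$, Cauchy–Schwarz gives the product form. -/
lemma exists_ladyzhenskaya_contDiff : ∃ K : ℝ, 0 ≤ K ∧ ∀ v : Plane → ℂ, ContDiff ℝ 1 v →
    HasCompactSupport v →
    ∫ x, ‖v x‖ ^ 4 ≤ K * (∫ x, ‖v x‖ ^ 2) * ∫ x, ‖fderiv ℝ v x‖ ^ 2 := by
  have hfr : Module.finrank ℝ Plane = 2 := by simp
  have hp : Real.HolderConjugate (Module.finrank ℝ Plane) 2 := by
    rw [hfr]; constructor <;> norm_num
  set K := lintegralPowLePowLIntegralFDerivConst (volume : Measure Plane) 2 with hK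
  refine ⟨4 * K, by positivity, fun v hv hvs => ?_⟩
  have hv2 : ContDiff ℝ 1 (fun x => v x * v x) := hv.mul hv
  have hvs2 : HasCompactSupport (fun x => v x * v x) := hvs.mul_right
  have hc : Continuous v := hv.continuous
  have hdc : Continuous (fderiv ℝ v) := hv.continuous_fderiv (by simp)
  have hds : HasCompactSupport (fderiv ℝ v) := hvs.fderiv ℝ
  have key := lintegral_pow_le_pow_lintegral_fderiv (volume : Measure Plane) hv2 hvs2 hp
  have hD : ∀ x, ‖fderiv ℝ (fun x => v x * v x) x‖ ≤ 2 * (‖v x‖ * ‖fderiv ℝ v x‖) := fun x => by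
    have hd := (hv.differentiable (by simp) x).hasFDerivAt
    have : HasFDerivAt (fun x => v x * v x) _ x := hd.mul hd
    rw [this.fderiv]
    refine (norm_add_le _ _).trans ?_
    rw [norm_smul]; linarith
  have mv : MemLp (fun x => ‖v x‖) 2 volume := (hc.memLp_of_hasCompactSupport hvs).norm
  have md : MemLp (fun x => ‖fderiv ℝ v x‖) 2 volume := (hdc.memLp_of_hasCompactSupport hds).norm
  have ivd : Integrable (fun x => ‖v x‖ * ‖fderiv ℝ v x‖) := mv.integrable_mul md
  have i4 : Integrable (fun x => ‖v x‖ ^ 4) :=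
    (by fun_prop : Continuous fun x => ‖v x‖ ^ 4).integrable_of_hasCompactSupport
      (hvs.comp_left (g := fun z : ℂ => ‖z‖ ^ 4) (by simp))
  have e1 : ∫⁻ x, ‖v x * v x‖ₑ ^ (2 : ℝ) = ENNReal.ofReal (∫ x, ‖v x‖ ^ 4) := by
    rw [ofReal_integral_eq_lintegral_ofReal i4 (Eventually.of_forall fun x => by positivity)]
    congr 1; ext x
    rw [← ofReal_norm, norm_mul, ENNReal.ofReal_rpow_of_nonneg (by positivity) (by norm_num)]
    congr 1; norm_cast; ring
  have e2 : ∫⁻ x, ‖fderiv ℝ (fun x => v x * v x) x‖ₑ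
      ≤ ENNReal.ofReal (2 * ∫ x, ‖v x‖ * ‖fderiv ℝ v x‖) := by
    rw [← integral_const_mul, ofReal_integral_eq_lintegral_ofReal (ivd.const_mul 2)
      (Eventually.of_forall fun x => by positivity)]
    refine lintegral_mono fun x => ?_
    rw [← ofReal_norm]
    exact ENNReal.ofReal_le_ofReal (hD x)
  have hI0 : 0 ≤ ∫ x, ‖v x‖ * ‖fderiv ℝ v x‖ := integral_nonneg fun x => by positivity
  rw [e1] at key
  have key2 : ENNReal.ofReal (∫ x, ‖v x‖ ^ 4) ≤
      ENNReal.ofReal (K * (2 * ∫ x, ‖v x‖ * ‖fderiv ℝ v x‖) ^ 2) := by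
    refine key.trans ?_
    rw [ENNReal.ofReal_mul (by positivity), ENNReal.ofReal_coe_nnreal, ← Real.rpow_natCast,
      ← ENNReal.ofReal_rpow_of_nonneg (by positivity) (by norm_num)]
    rw [ENNReal.rpow_ofNat, Nat.cast_ofNat, ENNReal.rpow_ofNat]
    gcongr
  rw [ENNReal.ofReal_le_ofReal_iff (by positivity)] at key2
  have cs := sq_integral_mul_le mv md
  calc _ ≤ _ := key2
    _ = 4 * K * (∫ x, ‖v x‖ * ‖fderiv ℝ v x‖) ^ 2 := by ring
    _ ≤ 4 * K * ((∫ x, ‖v x‖ ^ 2) * ∫ x, ‖fderiv ℝ v x‖ ^ 2) := by gcongr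
    _ = _ := by ring

lemma tendsto_const_mul_inv_add_one (C : ℝ) :
    Tendsto (fun n : ℕ => C * ((n : ℝ) + 1)⁻¹) atTop (𝓝 0) := by
  have h3 : Tendsto (fun n : ℕ => C * ((n : ℝ) + 1)⁻¹) atTop (𝓝 (C * 0)) :=
    (tendsto_inv_atTop_zero.comp (tendsto_atTop_add_const_right _ 1
      tendsto_natCast_atTop_atTop)).const_mul C
  rwa [mul_zero] at h3

/-- Compact support is removed by cutoffs. The gradient of the cutoff adds errors of size
$\varepsilon_n\to0$, and Fatou's lemma passes to the limit with the same constant. -/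
lemma exists_ladyzhenskaya_C1 : ∃ K : ℝ, 0 ≤ K ∧ ∀ w : Plane → ℂ, ContDiff ℝ 1 w →
    MemLp w 2 volume → MemLp (fderiv ℝ w) 2 volume →
    Integrable (fun x => ‖w x‖ ^ 4) ∧
    ∫ x, ‖w x‖ ^ 4 ≤ K * mass w * ∫ x, ‖fderiv ℝ w x‖ ^ 2 := by
  obtain ⟨K, hK0, hK⟩ := exists_ladyzhenskaya_contDiff
  obtain ⟨C, hC0, hC⟩ := exists_norm_fderiv_cutoff_le
  refine ⟨K, hK0, fun w hw hw2 hd2 => ?_⟩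
  set ε : ℕ → ℝ := fun n => C * ((n : ℝ) + 1)⁻¹ with hε
  have hε0 : ∀ n, 0 ≤ ε n := fun n => by simp only [hε]; positivity
  set A := ∫ x, ‖fderiv ℝ w x‖ ^ 2
  set X := ∫ x, ‖fderiv ℝ w x‖ * ‖w x‖
  have iA : Integrable (fun x => ‖fderiv ℝ w x‖ ^ 2) := hd2.norm.integrable_sq
  have iX : Integrable (fun x => ‖fderiv ℝ w x‖ * ‖w x‖) := hd2.norm.integrable_mul hw2.norm
  have iB : Integrable (fun x => ‖w x‖ ^ 2) := integrable_norm_sq hw2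
  have hcut : ∀ n, ContDiff ℝ 1 (fun x => (cutoff n x : ℂ) * w x) := fun n =>
    ((isTestFunction_cutoff n).ofReal.1.of_le (by simp)).mul hw
  have hcs : ∀ n, HasCompactSupport (fun x => (cutoff n x : ℂ) * w x) := fun n =>
    (isTestFunction_cutoff n).ofReal.2.mul_right
  have hcn : ∀ n x, ‖(cutoff n x : ℂ)‖ ≤ 1 := fun n x => by
    rw [Complex.norm_real, Real.norm_of_nonneg (cutoff_nonneg n x)]; exact cutoff_le_one n x
  have hnw : ∀ n x, ‖(cutoff n x : ℂ) * w x‖ ≤ ‖w x‖ := fun n x => by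
    rw [norm_mul]; exact mul_le_of_le_one_left (norm_nonneg _) (hcn n x)
  have hD : ∀ n x, ‖fderiv ℝ (fun x => (cutoff n x : ℂ) * w x) x‖ ≤
      ‖fderiv ℝ w x‖ + ε n * ‖w x‖ := fun n x => by
    have h1 : HasFDerivAt (fun x => (cutoff n x : ℂ))
        (Complex.ofRealCLM.comp (fderiv ℝ (cutoff n) x)) x :=
      Complex.ofRealCLM.hasFDerivAt.comp x
        ((isTestFunction_cutoff n).differentiable x).hasFDerivAt
    have h2 : HasFDerivAt (fun x => (cutoff n x : ℂ) * w x) _ x :=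
      h1.mul (hw.differentiable (by simp) x).hasFDerivAt
    rw [h2.fderiv]
    refine (norm_add_le _ _).trans ?_
    rw [norm_smul, norm_smul, mul_comm ‖w x‖]
    have h3 : ‖Complex.ofRealCLM.comp (fderiv ℝ (cutoff n) x)‖ ≤ ε n := by
      refine (ContinuousLinearMap.opNorm_comp_le _ _).trans ?_
      rw [Complex.ofRealCLM_norm, one_mul]; exact hC n x
    gcongr
    exact mul_le_of_le_one_left (norm_nonneg _) (hcn n x)
  refine integrable_and_integral_le_of_tendsto
    (F := fun n x => ‖(cutoff n x : ℂ) * w x‖ ^ 4)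
    (c := fun n => K * mass w * (A + 2 * ε n * X + ε n ^ 2 * mass w))
    (fun n => ?_) (fun n x => by positivity) (Eventually.of_forall fun x => ?_) (fun n => ?_) ?_
  · exact (by have := (hcut n).continuous; fun_prop :
      Continuous fun x => ‖(cutoff n x : ℂ) * w x‖ ^ 4).integrable_of_hasCompactSupport
      ((hcs n).comp_left (g := fun z : ℂ => ‖z‖ ^ 4) (by simp))
  · have h1 : Tendsto (fun n => (cutoff n x : ℂ)) atTop (𝓝 1) :=
      (Complex.continuous_ofReal.tendsto 1).comp (tendsto_cutoff x)
    simpa using ((h1.mul_const (w x)).norm.pow 4)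
  · refine (hK _ (hcut n) (hcs n)).trans ?_
    have m1 : ∫ x, ‖(cutoff n x : ℂ) * w x‖ ^ 2 ≤ mass w :=
      integral_mono_of_nonneg (Eventually.of_forall fun x => by positivity) iB
        (Eventually.of_forall fun x => pow_le_pow_left₀ (norm_nonneg _) (hnw n x) 2)
    have m2 : ∫ x, ‖fderiv ℝ (fun x => (cutoff n x : ℂ) * w x) x‖ ^ 2 ≤
        A + 2 * ε n * X + ε n ^ 2 * mass w := by
      have e : A + 2 * ε n * X + ε n ^ 2 * mass w = ∫ x, (‖fderiv ℝ w x‖ ^ 2 +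
          2 * ε n * (‖fderiv ℝ w x‖ * ‖w x‖) + ε n ^ 2 * ‖w x‖ ^ 2) := by
        rw [integral_add_add iA (iX.const_mul _) (iB.const_mul _), integral_const_mul,
          integral_const_mul]
        rfl
      rw [e]
      refine integral_mono_of_nonneg (Eventually.of_forall fun x => by positivity)
        ((iA.add (iX.const_mul _)).add (iB.const_mul _)) (Eventually.of_forall fun x => ?_)
      refine (pow_le_pow_left₀ (norm_nonneg _) (hD n x) 2).trans (le_of_eq ?_)
      ring
    have := mass_nonneg w
    gcongr
  · have hlim : Tendsto ε atTop (𝓝 0) := tendsto_const_mul_inv_add_one C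
    have h1 := (((hlim.const_mul 2).mul_const X).const_add A).add ((hlim.pow 2).mul_const (mass w))
    simpa using h1.const_mul (K * mass w)

lemma weakPartial_ae_eq_fderiv (hw : ContDiff ℝ 1 w) (hH : MemH1 w) (i : Fin 2) :
    weakPartial i w =ᵐ[volume] fun x => fderiv ℝ w x (EuclideanSpace.single i 1) := by
  have hdc : Continuous fun x => fderiv ℝ w x (EuclideanSpace.single i 1) :=
    (hw.continuous_fderiv (by simp)).clm_apply continuous_const
  refine ae_eq_of_test ((memLp_weakPartial i w).locallyIntegrable (by norm_num))
    hdc.locallyIntegrable fun φ hφ => ?_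
  have h1 := hH.hasWeakPartial i φ hφ
  have hφc := hφ.ofReal
  have d : ∀ x, fderiv ℝ (fun x => (φ x : ℂ)) x (EuclideanSpace.single i 1) =
      (partialDeriv i φ x : ℂ) := fun x => by
    have := (Complex.ofRealCLM.hasFDerivAt.comp x (hφ.differentiable x).hasFDerivAt).fderiv
    change fderiv ℝ (Complex.ofRealCLM ∘ φ) x _ = _
    rw [this]; rfl
  have h2 := integral_mul_fderiv_eq_neg_fderiv_mul_of_integrable (𝕜 := ℂ) (μ := (volume : Measure Plane))
    (f := w) (g := fun x => (φ x : ℂ)) (v := EuclideanSpace.single i (1 : ℝ))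
    ((hdc.mul hφc.1.continuous).integrable_of_hasCompactSupport hφc.2.mul_left)
    (by
      simp only [d]
      exact (hw.continuous.mul (hφ.partialDeriv i).ofReal.1.continuous).integrable_of_hasCompactSupport
        (hφ.partialDeriv i).ofReal.2.mul_left)
    ((hw.continuous.mul hφc.1.continuous).integrable_of_hasCompactSupport hφc.2.mul_left)
    (fun x _ => hw.differentiable (by simp) x) (fun x _ => hφc.1.differentiable (by simp) x)
  simp only [d] at h2
  rw [h1, neg_inj] at h2
  simpa only [mul_comm] using h2

/-- The operator norm is at most the Hilbert–Schmidt norm. This converts the operator norm in the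
Sobolev inequality into the sum over partial derivatives in `gradEnergy`. -/
lemma norm_sq_clm_le (L : Plane →L[ℝ] ℂ) :
    ‖L‖ ^ 2 ≤ ∑ i, ‖L (EuclideanSpace.single i 1)‖ ^ 2 := by
  have h : ‖L‖ ≤ Real.sqrt (∑ i, ‖L (EuclideanSpace.single i 1)‖ ^ 2) := by
    refine L.opNorm_le_bound (Real.sqrt_nonneg _) fun y => ?_
    have e : y = ∑ i, y i • EuclideanSpace.single i (1 : ℝ) := by
      ext j; fin_cases j <;> simp
    have h1 : ‖L y‖ ≤ ∑ i, ‖L (EuclideanSpace.single i 1)‖ * |y i| := by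
      conv_lhs => rw [e, map_sum]
      refine (norm_sum_le _ _).trans (Finset.sum_le_sum fun i _ => ?_)
      rw [map_smul, norm_smul, mul_comm]; rfl
    refine h1.trans ((Real.sum_mul_le_sqrt_mul_sqrt _ _ _).trans (le_of_eq ?_))
    rw [EuclideanSpace.norm_eq]; rfl
  calc _ ≤ _ := pow_le_pow_left₀ (norm_nonneg _) h 2
    _ = _ := Real.sq_sqrt (by positivity)

lemma eLpNorm_eq_ofReal_sqrt_mass (hu : MemLp u 2 volume) :
    eLpNorm u 2 volume = ENNReal.ofReal (Real.sqrt (mass u)) := by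
  rw [mass_eq_norm_sq hu, Real.sqrt_sq (norm_nonneg _), Lp.norm_toLp,
    ENNReal.ofReal_toReal hu.2.ne]

lemma exists_subseq_tendsto_ae {f : ℕ → Plane → ℂ} (hf : ∀ n, MemLp (f n) 2 volume)
    (hu : MemLp u 2 volume) (h : Tendsto (fun n => mass (fun x => f n x - u x)) atTop (𝓝 0)) :
    ∃ ns : ℕ → ℕ, StrictMono ns ∧ ∀ᵐ x, Tendsto (fun k => f (ns k) x) atTop (𝓝 (u x)) := by
  have h1 : Tendsto (fun n => eLpNorm (f n - u) 2 volume) atTop (𝓝 0) := by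
    have h2 : Tendsto (fun n => ENNReal.ofReal (Real.sqrt (mass (fun x => f n x - u x)))) atTop
        (𝓝 (ENNReal.ofReal (Real.sqrt 0))) :=
      ENNReal.tendsto_ofReal ((Real.continuous_sqrt.tendsto 0).comp h)
    rw [Real.sqrt_zero, ENNReal.ofReal_zero] at h2
    refine h2.congr fun n => ?_
    exact (eLpNorm_eq_ofReal_sqrt_mass ((hf n).sub hu)).symm
  exact (tendstoInMeasure_of_tendsto_eLpNorm (by norm_num) (fun n => (hf n).1) hu.1
    h1).exists_seq_tendsto_ae

/-- Band-limited approximations of an `H¹` function are continuously differentiable. -/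
lemma MemH1.exists_contDiff_approx (hu : MemH1 u) : ∃ w : ℕ → Plane → ℂ,
    (∀ n, ContDiff ℝ 1 (w n)) ∧ (∀ n, MemH1 (w n)) ∧ (∀ n, mass (w n) ≤ mass u) ∧
    (∀ n, gradEnergy (w n) ≤ gradEnergy u) ∧
    Tendsto (fun n => mass (fun x => w n x - u x)) atTop (𝓝 0) := by
  -- Truncating the transform to these balls makes all its moments integrable, and it can only
  -- decrease the mass and the gradient energy.
  set B : ℕ → Set Plane := fun n => Metric.closedBall 0 n
  have hB : ∀ n, MeasurableSet (B n) := fun n => Metric.isClosed_closedBall.measurableSet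
  set a : ℕ → Plane → ℂ := fun n => (B n).indicator (FT u) with ha
  have ha2 : ∀ n, MemLp (a n) 2 volume := fun n => (memLp_FT u).indicator (hB n)
  have hale : ∀ n ξ, ‖a n ξ‖ ≤ ‖FT u ξ‖ := fun n ξ => norm_indicator_le_norm_self _ _
  choose g hg hga using fun n => exists_FT_eq (ha2 n)
  have hai : ∀ n, Integrable (a n) := fun n => by
    rw [ha, integrable_indicator_iff (hB n)]
    have : IsFiniteMeasure (volume.restrict (B n)) :=
      ⟨by rw [Measure.restrict_apply_univ]; exact measure_closedBall_lt_top⟩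
    exact ((memLp_FT u).restrict (B n)).integrable (by norm_num)
  have hpow : ∀ n (k : ℕ), Integrable (fun ξ : Plane => ‖ξ‖ ^ k * ‖FT (g n) ξ‖) := fun n k => by
    have h1 : Integrable (fun ξ : Plane => (n : ℝ) ^ k * ‖a n ξ‖) := (hai n).norm.const_mul _
    refine h1.mono' ((by fun_prop : Continuous fun ξ : Plane => ‖ξ‖ ^ k).aestronglyMeasurable.mul
      (memLp_FT _).1.norm) ?_
    filter_upwards [hga n] with ξ hξ
    rw [hξ, Real.norm_of_nonneg (by positivity)]
    by_cases hm : ξ ∈ B n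
    · have : ‖ξ‖ ≤ n := by simpa [B] using hm
      gcongr
    · simp [ha, hm]
  have hFi : ∀ n, Integrable (FT (g n)) := fun n => (hai n).congr (hga n).symm
  set w : ℕ → Plane → ℂ := fun n => 𝓕⁻ (FT (g n))
  have hwg : ∀ n, g n =ᵐ[volume] w n := fun n => ae_eq_fourierInv_FT (hg n) (hFi n)
  have hw2 : ∀ n, MemLp (w n) 2 volume := fun n => (hg n).ae_eq (hwg n)
  have hFw : ∀ n, FT (w n) =ᵐ[volume] a n := fun n => by
    rw [← FT_congr (hwg n)]; exact hga n
  have hwH : ∀ n, MemH1 (w n) := fun n => by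
    refine memH1_of_FT (hw2 n) fun i => ?_
    refine (hu.memLp_coord_mul_FT i).mono ?_ ?_
    · have : Continuous fun ξ : Plane => (ξ i : ℂ) := by fun_prop
      exact this.aestronglyMeasurable.mul (memLp_FT _).1
    · filter_upwards [hFw n] with ξ hξ
      rw [hξ, norm_mul, norm_mul]
      exact mul_le_mul_of_nonneg_left (hale n ξ) (norm_nonneg _)
  refine ⟨w, fun n => ?_, hwH, fun n => ?_, fun n => ?_, ?_⟩
  · have h1 : ContDiff ℝ ((1 : ℕ∞) : WithTop ℕ∞) (𝓕 (FT (g n))) :=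
      Real.contDiff_fourier fun k _ => hpow n k
    have h2 : w n = fun x => 𝓕 (FT (g n)) (-x) := by
      ext x; exact Real.fourierInv_eq_fourier_neg _ _
    rw [h2]
    exact h1.comp contDiff_neg
  · rw [← mass_FT (hw2 n), ← mass_FT hu.1, mass_congr (hFw n)]
    exact integral_mono_of_nonneg (Eventually.of_forall fun x => by positivity)
      (integrable_norm_sq (memLp_FT u))
      (Eventually.of_forall fun x => pow_le_pow_left₀ (norm_nonneg _) (hale n x) 2)
  · rw [gradEnergy_eq, gradEnergy_eq]
    refine Finset.sum_le_sum fun i _ => ?_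
    rw [(hwH n).mass_weakPartial, hu.mass_weakPartial]
    refine mul_le_mul_of_nonneg_left ?_ (by positivity)
    refine integral_mono_of_nonneg (Eventually.of_forall fun x => by positivity)
      (integrable_coord_sq_mul (hu.memLp_coord_mul_FT i)) ?_
    filter_upwards [hFw n] with ξ hξ
    rw [hξ]
    exact mul_le_mul_of_nonneg_left (pow_le_pow_left₀ (norm_nonneg _) (hale n ξ) 2) (sq_nonneg _)
  · have e : ∀ n, mass (fun x => w n x - u x) = ∫ ξ, ‖a n ξ - FT u ξ‖ ^ 2 := fun n => by
      have hd : MemLp (fun x => w n x - u x) 2 volume := (hw2 n).sub hu.1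
      rw [← mass_FT hd]
      refine integral_congr_ae ?_
      filter_upwards [FT_sub (hw2 n) hu.1, hFw n] with ξ h1 h2
      rw [h1, h2]
    simp only [e]
    have : (0 : ℝ) = ∫ _ : Plane, (0 : ℝ) := by simp
    rw [this]
    apply tendsto_integral_of_dominated_convergence (fun ξ => ‖FT u ξ‖ ^ 2)
    · exact fun n => (((ha2 n).1.sub (memLp_FT u).1).norm.pow 2)
    · exact integrable_norm_sq (memLp_FT u)
    · intro n
      filter_upwards with ξ
      rw [Real.norm_of_nonneg (by positivity)]
      by_cases hm : ξ ∈ B n <;> simp [ha, hm]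
    · filter_upwards with ξ
      refine tendsto_const_nhds.congr' ?_
      filter_upwards [eventually_ge_atTop ⌈‖ξ‖⌉₊] with n hn
      have hm : ξ ∈ B n := by
        simp only [B, mem_closedBall_zero_iff]
        exact (Nat.le_ceil ‖ξ‖).trans (Nat.cast_le.2 hn)
      simp [ha, hm]

/-- **Ladyzhenskaya's inequality** on the plane. -/
lemma exists_ladyzhenskaya : ∃ K : ℝ, 0 < K ∧ ∀ u : Plane → ℂ, MemH1 u →
    Integrable (fun x => ‖u x‖ ^ 4) ∧
    ∫ x, ‖u x‖ ^ 4 ≤ K * mass u * gradEnergy u := by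
  obtain ⟨K, hK0, hK⟩ := exists_ladyzhenskaya_C1
  -- The extra $1$ only makes the constant strictly positive, since it is divided by later.
  refine ⟨K + 1, by positivity, fun u hu => ?_⟩
  obtain ⟨w, hw, hwH, hm, hgr, hlim⟩ := hu.exists_contDiff_approx
  obtain ⟨ns, -, hns⟩ := exists_subseq_tendsto_ae (fun n => (hwH n).1) hu.1 hlim
  have hle : ∀ n, ∀ᵐ x, ‖fderiv ℝ (w n) x‖ ^ 2 ≤ ∑ i, ‖weakPartial i (w n) x‖ ^ 2 := fun n => by
    filter_upwards [weakPartial_ae_eq_fderiv (hw n) (hwH n) 0,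
      weakPartial_ae_eq_fderiv (hw n) (hwH n) 1] with x h0 h1
    refine (norm_sq_clm_le _).trans (le_of_eq ?_)
    rw [Fin.sum_univ_two, Fin.sum_univ_two, h0, h1]
  have hi : ∀ n, Integrable fun x => ∑ i, ‖weakPartial i (w n) x‖ ^ 2 := fun n =>
    integrable_finsetSum _ fun i _ => integrable_norm_sq_weakPartial i (w n)
  have hdc : ∀ n, Continuous (fderiv ℝ (w n)) := fun n => (hw n).continuous_fderiv (by simp)
  have hdL : ∀ n, MemLp (fderiv ℝ (w n)) 2 volume := fun n => by
    refine (memLp_two_iff_integrable_sq_norm (hdc n).aestronglyMeasurable).2 ?_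
    refine (hi n).mono' ((hdc n).norm.pow 2).aestronglyMeasurable ?_
    filter_upwards [hle n] with x hx
    rwa [Real.norm_of_nonneg (by positivity)]
  refine integrable_and_integral_le_of_tendsto (F := fun k x => ‖w (ns k) x‖ ^ 4)
    (c := fun _ => (K + 1) * mass u * gradEnergy u)
    (fun k => (hK _ (hw _) (hwH _).1 (hdL _)).1) (fun k x => by positivity) ?_ (fun k => ?_)
    tendsto_const_nhds
  · filter_upwards [hns] with x hx
    exact hx.norm.pow 4
  · refine (hK _ (hw _) (hwH _).1 (hdL _)).2.trans ?_
    have h1 : ∫ x, ‖fderiv ℝ (w (ns k)) x‖ ^ 2 ≤ gradEnergy u :=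
      (integral_mono_of_nonneg (Eventually.of_forall fun x => by positivity) (hi _)
        (hle _)).trans (hgr _)
    have := mass_nonneg u
    have := mass_nonneg (w (ns k))
    have := gradEnergy_nonneg u
    calc _ ≤ K * mass u * gradEnergy u := by
          have := hm (ns k)
          gcongr
      _ ≤ _ := by gcongr; linarith

end Ladyzhenskaya

/-! ### The operator $E_1$ and its quadratic form. -/

section NonlocalForm

variable {f g k u v : Plane → ℂ}

/-- The real symbol `ξ₁² / |ξ|²`. -/
def realSymbol (ξ : Plane) : ℝ := ξ 0 ^ 2 / ‖ξ‖ ^ 2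

lemma symbol_eq (ξ : Plane) : symbol ξ = (realSymbol ξ : ℂ) := rfl

lemma realSymbol_nonneg (ξ : Plane) : 0 ≤ realSymbol ξ := by unfold realSymbol; positivity

lemma realSymbol_le_one (ξ : Plane) : realSymbol ξ ≤ 1 := by
  refine div_le_one_of_le₀ ?_ (by positivity)
  rw [EuclideanSpace.norm_sq_eq, Fin.sum_univ_two, Real.norm_eq_abs, Real.norm_eq_abs, sq_abs,
    sq_abs]
  nlinarith [sq_nonneg (ξ 1)]

lemma realSymbol_neg (ξ : Plane) : realSymbol (-ξ) = realSymbol ξ := by simp [realSymbol]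

lemma measurable_realSymbol : Measurable realSymbol := by unfold realSymbol; fun_prop

lemma memLp_E1 (f : Plane → ℂ) : MemLp (E1 f) 2 volume := by
  unfold E1
  split_ifs with h
  · exact Lp.memLp _
  · exact MemLp.zero

lemma FT_E1 (hf : MemLp f 2 volume) : FT (E1 f) =ᵐ[volume] fun ξ => realSymbol ξ * FT f ξ := by
  have h1 : E1 f = (E1L2 (hf.toLp f) : Plane → ℂ) := by rw [E1, dif_pos hf]
  rw [h1, FT_eq (Lp.memLp _), Lp.toLp_coeFn, E1L2, FourierTransform.fourier_fourierInv_eq,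
    FT_eq hf]
  filter_upwards [Lp.coeFn_lpSMul (r := 2) (memLp_symbol.toLp symbol)
    (𝓕 (hf.toLp f) : Lp ℂ 2 (volume : Measure Plane)), memLp_symbol.coeFn_toLp] with ξ h2 h3
  rw [h2, Pi.smul_apply', h3, symbol_eq, smul_eq_mul]

lemma ae_eq_of_FT_ae_eq (hf : MemLp f 2 volume) (hg : MemLp g 2 volume)
    (h : FT f =ᵐ[volume] FT g) : f =ᵐ[volume] g := by
  have h1 : (memLp_FT f).toLp (FT f) = (memLp_FT g).toLp (FT g) :=
    (MemLp.toLp_eq_toLp_iff _ _).2 h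
  rw [toLp_FT hf, toLp_FT hg] at h1
  have h2 := congrArg (fun z : Lp ℂ 2 (volume : Measure Plane) => 𝓕⁻ z) h1
  simp only [FourierTransform.fourierInv_fourier_eq] at h2
  exact (MemLp.toLp_eq_toLp_iff _ _).1 h2

/-- `E₁` maps real functions to real functions. -/
lemma E1_conj (hf : MemLp f 2 volume) (hr : ∀ x, conj (f x) = f x) :
    ∀ᵐ x, conj (E1 f x) = E1 f x := by
  refine ae_eq_of_FT_ae_eq (memLp_E1 f).star (memLp_E1 f) ?_
  have h1 := FT_conj (memLp_E1 f)
  have h2 := FT_conj hf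
  simp only [hr] at h2
  have h3 := FT_E1 hf
  -- The formula for the transform of $E_1f$ is also needed at $-\xi$. Reality is preserved because
  -- the symbol is real and even.
  have h4 := (Measure.measurePreserving_neg (volume : Measure Plane)).quasiMeasurePreserving.ae h3
  filter_upwards [h1, h2, h3, h4] with ξ h1 h2 h3 h4
  refine h1.trans ?_
  rw [h4, h3, map_mul, Complex.conj_ofReal, realSymbol_neg, ← h2]

/-- The quadratic form of `E₁`, polarized. -/
def nlForm (f g : Plane → ℂ) : ℝ := ∫ ξ, realSymbol ξ * (FT f ξ * conj (FT g ξ)).re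

lemma integrable_nlForm (f g : Plane → ℂ) :
    Integrable fun ξ => realSymbol ξ * (FT f ξ * conj (FT g ξ)).re := by
  refine (integrable_mul_conj (memLp_FT f) (memLp_FT g)).re.bdd_mul (c := 1)
    measurable_realSymbol.aestronglyMeasurable (Eventually.of_forall fun ξ => ?_)
  rw [Real.norm_of_nonneg (realSymbol_nonneg ξ)]
  exact realSymbol_le_one ξ

lemma integral_E1_mul_re (hf : MemLp f 2 volume) (hg : MemLp g 2 volume)
    (hr : ∀ x, conj (g x) = g x) : ∫ x, (E1 f x * g x).re = nlForm f g := by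
  have h1 := integral_FT_mul_conj (memLp_E1 f) hg
  simp only [hr] at h1
  have i1 : Integrable fun x => E1 f x * g x := (memLp_E1 f).integrable_mul hg
  have h2 : ∫ x, (E1 f x * g x).re = (∫ x, E1 f x * g x).re := integral_re i1
  rw [h2, ← h1]
  have h3 : (∫ ξ, FT (E1 f) ξ * conj (FT g ξ)).re = ∫ ξ, (FT (E1 f) ξ * conj (FT g ξ)).re :=
    (integral_re (integrable_mul_conj (memLp_FT _) (memLp_FT g))).symm
  rw [h3, nlForm]
  refine integral_congr_ae ?_
  filter_upwards [FT_E1 hf] with ξ hξ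
  rw [hξ, mul_assoc, Complex.re_ofReal_mul]

lemma integral_E1_mul (hf : MemLp f 2 volume) (hg : MemLp g 2 volume)
    (hfr : ∀ x, conj (f x) = f x) (hr : ∀ x, conj (g x) = g x) :
    ∫ x, E1 f x * g x = (nlForm f g : ℂ) := by
  rw [← integral_E1_mul_re hf hg hr, ← integral_complex_ofReal]
  refine integral_congr_ae ?_
  filter_upwards [E1_conj hf hfr] with x hx
  refine (Complex.conj_eq_iff_re.1 ?_).symm
  rw [map_mul, hx, hr]

lemma nlForm_comm (f g : Plane → ℂ) : nlForm f g = nlForm g f := by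
  unfold nlForm
  congr 1; ext ξ
  rw [← Complex.conj_re (FT f ξ * _), map_mul, Complex.conj_conj, mul_comm (conj _)]

lemma nlForm_add_left (hf : MemLp f 2 volume) (hg : MemLp g 2 volume) :
    nlForm (fun x => f x + g x) k = nlForm f k + nlForm g k := by
  unfold nlForm
  rw [← integral_add (integrable_nlForm f k) (integrable_nlForm g k)]
  refine integral_congr_ae ?_
  filter_upwards [FT_add hf hg] with ξ h
  rw [h, add_mul, Complex.add_re, mul_add]

lemma nlForm_const_mul_left (c : ℝ) (hf : MemLp f 2 volume) :
    nlForm (fun x => c * f x) k = c * nlForm f k := by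
  unfold nlForm
  rw [← integral_const_mul]
  refine integral_congr_ae ?_
  filter_upwards [FT_const_mul c hf] with ξ h
  rw [h, mul_assoc, Complex.re_ofReal_mul]; ring

lemma nlForm_add_right (hf : MemLp f 2 volume) (hg : MemLp g 2 volume) :
    nlForm k (fun x => f x + g x) = nlForm k f + nlForm k g := by
  rw [nlForm_comm, nlForm_add_left hf hg, nlForm_comm f, nlForm_comm g]

lemma nlForm_const_mul_right (c : ℝ) (hf : MemLp f 2 volume) :
    nlForm k (fun x => c * f x) = c * nlForm k f := by
  rw [nlForm_comm, nlForm_const_mul_left c hf, nlForm_comm]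

lemma nlForm_self (f : Plane → ℂ) : nlForm f f = ∫ ξ, realSymbol ξ * ‖FT f ξ‖ ^ 2 := by
  unfold nlForm
  congr 1; ext ξ
  rw [Complex.mul_conj, Complex.ofReal_re, Complex.normSq_eq_norm_sq]

lemma nlForm_self_nonneg (f : Plane → ℂ) : 0 ≤ nlForm f f := by
  rw [nlForm_self]
  exact integral_nonneg fun ξ => mul_nonneg (realSymbol_nonneg ξ) (by positivity)

/-- The symbol lies in $[0,1]$, so Cauchy–Schwarz and Plancherel apply with constant $1$. -/
lemma abs_nlForm_le (hf : MemLp f 2 volume) (hg : MemLp g 2 volume) :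
    |nlForm f g| ≤ Real.sqrt (mass f) * Real.sqrt (mass g) := by
  rw [← mass_FT hf, ← mass_FT hg]
  have h1 : |nlForm f g| ≤ ∫ ξ, ‖FT f ξ‖ * ‖FT g ξ‖ := by
    rw [← Real.norm_eq_abs]
    refine norm_integral_le_of_norm_le ((memLp_FT f).norm.integrable_mul (memLp_FT g).norm)
      (Eventually.of_forall fun ξ => ?_)
    rw [norm_mul, Real.norm_of_nonneg (realSymbol_nonneg ξ)]
    have h2 : ‖(FT f ξ * conj (FT g ξ)).re‖ ≤ ‖FT f ξ‖ * ‖FT g ξ‖ := by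
      refine (Complex.abs_re_le_norm _).trans ?_
      rw [norm_mul, Complex.norm_conj]
    exact (mul_le_mul (realSymbol_le_one ξ) h2 (norm_nonneg _) zero_le_one).trans
      (le_of_eq (one_mul _))
  refine h1.trans ?_
  rw [← Real.sqrt_mul (mass_nonneg _)]
  exact Real.le_sqrt_of_sq_le (sq_integral_mul_le (memLp_FT f).norm (memLp_FT g).norm)

lemma nlForm_self_le (hf : MemLp f 2 volume) : nlForm f f ≤ mass f :=
  (le_abs_self _).trans ((abs_nlForm_le hf hf).trans
    (le_of_eq (Real.mul_self_sqrt (mass_nonneg f))))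

/-- A common translation multiplies both transforms by the same unimodular factor, which cancels
against its conjugate. -/
lemma nlForm_comp_add (hf : MemLp f 2 volume) (hg : MemLp g 2 volume) (h : Plane) :
    nlForm (fun x => f (x + h)) (fun x => g (x + h)) = nlForm f g := by
  refine integral_congr_ae ?_
  filter_upwards [FT_comp_add hf h, FT_comp_add hg h] with ξ h1 h2
  rw [h1, h2]
  congr 2
  set e := Real.fourierChar (inner ℝ h ξ)
  have : (e : ℂ) * conj (e : ℂ) = 1 := by
    rw [Complex.mul_conj, Circle.normSq_coe]; simp
  rw [map_mul]
  linear_combination (FT f ξ * conj (FT g ξ)) * this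

end NonlocalForm

/-! ### The quartic integral and $L^2$ bounds for products. -/

section Quartic

variable {f g k u v : Plane → ℂ}

/-- `∫ |u|⁴ dx`. -/
def quartic (u : Plane → ℂ) : ℝ := ∫ x, ‖u x‖ ^ 4

lemma quartic_nonneg (u : Plane → ℂ) : 0 ≤ quartic u := integral_nonneg fun _ => by positivity

/-- The constant in Ladyzhenskaya's inequality. -/
def ladyConst : ℝ := exists_ladyzhenskaya.choose

lemma ladyConst_pos : 0 < ladyConst := exists_ladyzhenskaya.choose_spec.1

lemma MemH1.integrable_quartic (hu : MemH1 u) : Integrable fun x => ‖u x‖ ^ 4 :=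
  (exists_ladyzhenskaya.choose_spec.2 u hu).1

lemma MemH1.quartic_le (hu : MemH1 u) : quartic u ≤ ladyConst * mass u * gradEnergy u :=
  (exists_ladyzhenskaya.choose_spec.2 u hu).2

/-- The product `u v̄` of two `H¹` functions is square integrable. -/
lemma MemH1.memLp_mul (hu : MemH1 u) (hv : MemH1 v) :
    MemLp (fun x => (‖u x‖ * ‖v x‖ : ℝ)) 2 volume := by
  refine (memLp_two_iff_integrable_sq (hu.1.1.norm.mul hv.1.1.norm)).2 ?_
  refine (hu.integrable_quartic.add hv.integrable_quartic).mono'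
    ((hu.1.1.norm.mul hv.1.1.norm).pow 2) (Eventually.of_forall fun x => ?_)
  rw [Real.norm_of_nonneg (by positivity)]
  change (‖u x‖ * ‖v x‖) ^ 2 ≤ ‖u x‖ ^ 4 + ‖v x‖ ^ 4
  nlinarith [sq_nonneg (‖u x‖ ^ 2 - ‖v x‖ ^ 2), sq_nonneg (‖u x‖ ^ 2), sq_nonneg (‖v x‖ ^ 2)]

lemma memLp_of_norm_le_mul (hu : MemH1 u) (hv : MemH1 v) (hf : AEStronglyMeasurable f volume)
    (h : ∀ x, ‖f x‖ ≤ ‖u x‖ * ‖v x‖) : MemLp f 2 volume :=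
  (hu.memLp_mul hv).mono hf (Eventually.of_forall fun x => by
    rw [Real.norm_of_nonneg (by positivity)]; exact h x)

lemma MemH1.memLp_absSq (hu : MemH1 u) : MemLp (absSq u) 2 volume := by
  refine memLp_of_norm_le_mul hu hu ?_ fun x => ?_
  · exact Complex.continuous_ofReal.comp_aestronglyMeasurable (hu.1.1.norm.pow 2)
  · rw [absSq, Complex.norm_real, Real.norm_of_nonneg (by positivity), sq]

lemma absSq_conj (u : Plane → ℂ) (x : Plane) : conj (absSq u x) = absSq u x :=
  Complex.conj_ofReal _

lemma mass_absSq (u : Plane → ℂ) : mass (absSq u) = quartic u := by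
  unfold mass quartic absSq
  congr 1; ext x
  rw [Complex.norm_real, Real.norm_of_nonneg (by positivity)]; ring

lemma MemH1.nonlocalEnergy_eq (hu : MemH1 u) :
    nonlocalEnergy u = nlForm (absSq u) (absSq u) :=
  integral_E1_mul_re hu.memLp_absSq hu.memLp_absSq (absSq_conj u)

lemma MemH1.nonlocalEnergy_nonneg (hu : MemH1 u) : 0 ≤ nonlocalEnergy u := by
  rw [hu.nonlocalEnergy_eq]; exact nlForm_self_nonneg _

lemma MemH1.nonlocalEnergy_le_quartic (hu : MemH1 u) : nonlocalEnergy u ≤ quartic u := by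
  rw [hu.nonlocalEnergy_eq, ← mass_absSq]; exact nlForm_self_le hu.memLp_absSq

/-- `∫ |uv|² ≤ (∫|u|⁴)^{1/2} (∫|v|⁴)^{1/2}`. -/
lemma integral_sq_mul_le (hu : MemH1 u) (hv : MemH1 v) :
    ∫ x, (‖u x‖ * ‖v x‖) ^ 2 ≤ Real.sqrt (quartic u) * Real.sqrt (quartic v) := by
  rw [← Real.sqrt_mul (quartic_nonneg _)]
  refine Real.le_sqrt_of_sq_le ?_
  have h : ∀ {w : Plane → ℂ}, MemH1 w → MemLp (fun x => ‖w x‖ ^ 2) 2 volume := fun {w} hw => by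
    simpa only [sq] using hw.memLp_mul hw
  have := sq_integral_mul_le (h hu) (h hv)
  simp only [← pow_mul, ← mul_pow] at this ⊢
  exact this

end Quartic

/-! ### Elementary bounds for powers. -/

section PowerBounds

/-- If $s^r>\varepsilon$ then $s$ is bounded below, and $s^{r-2}$ is decreasing. With the small
constant on the zeroth power, this bounds the quartic integral below along a minimizing sequence. -/
lemma exists_rpow_le_add_sq {r ε : ℝ} (hr : 0 < r) (hr2 : r < 2) (hε : 0 < ε) :
    ∃ C : ℝ, 0 < C ∧ ∀ s : ℝ, 0 ≤ s → s ^ r ≤ ε + C * s ^ 2 := by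
  refine ⟨(ε ^ (1 / r)) ^ (r - 2), by positivity, fun s hs => ?_⟩
  by_cases h : s ^ r ≤ ε
  · have : 0 ≤ (ε ^ (1 / r)) ^ (r - 2) * s ^ 2 := by positivity
    linarith
  · push Not at h
    have hs0 : 0 < s := by
      rcases hs.eq_or_lt with rfl | h0
      · rw [Real.zero_rpow hr.ne'] at h; linarith
      · exact h0
    have h1 : ε ^ (1 / r) ≤ s := by
      have := Real.rpow_le_rpow hε.le h.le (by positivity : (0 : ℝ) ≤ 1 / r)
      rwa [← Real.rpow_mul hs, mul_one_div_cancel hr.ne', Real.rpow_one] at this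
    have h2 : s ^ (r - 2) ≤ (ε ^ (1 / r)) ^ (r - 2) :=
      Real.rpow_le_rpow_of_nonpos (by positivity) h1 (by linarith)
    have h3 : s ^ r = s ^ (r - 2) * s ^ 2 := by
      rw [← Real.rpow_natCast s 2, ← Real.rpow_add hs0]; norm_num
    rw [h3]
    have : s ^ (r - 2) * s ^ 2 ≤ (ε ^ (1 / r)) ^ (r - 2) * s ^ 2 := by gcongr
    linarith

/-- The complementary form, with the small constant on the square: $T$ is chosen so that
$T^{r-2}=\varepsilon$. It serves for coercivity. -/
lemma exists_rpow_le_add_mul_sq {r ε : ℝ} (hr : 0 < r) (hr2 : r < 2) (hε : 0 < ε) :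
    ∃ C : ℝ, 0 < C ∧ ∀ s : ℝ, 0 ≤ s → s ^ r ≤ C + ε * s ^ 2 := by
  set T := ε ^ (1 / (r - 2)) with hT
  have hT0 : 0 < T := by positivity
  refine ⟨T ^ r, by positivity, fun s hs => ?_⟩
  rcases le_total s T with h | h
  · have : s ^ r ≤ T ^ r := Real.rpow_le_rpow hs h hr.le
    have : 0 ≤ ε * s ^ 2 := by positivity
    linarith
  · have hs0 : 0 < s := hT0.trans_le h
    have h2 : s ^ (r - 2) ≤ T ^ (r - 2) := Real.rpow_le_rpow_of_nonpos hT0 h (by linarith)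
    have h4 : T ^ (r - 2) = ε := by
      rw [hT, ← Real.rpow_mul hε.le, one_div_mul_cancel (by linarith), Real.rpow_one]
    have h3 : s ^ r = s ^ (r - 2) * s ^ 2 := by
      rw [← Real.rpow_natCast s 2, ← Real.rpow_add hs0]; norm_num
    rw [h3, ← h4]
    have h5 : s ^ (r - 2) * s ^ 2 ≤ T ^ (r - 2) * s ^ 2 := by gcongr
    have : 0 < T ^ r := by positivity
    linarith

lemma rpow_add_one_eq {p s : ℝ} (hp : 1 < p) (hs : 0 ≤ s) : s ^ (p + 1) = s ^ (p - 1) * s ^ 2 := by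
  rw [← Real.rpow_natCast s 2, ← Real.rpow_add' hs]
  · norm_num; ring_nf
  · norm_num; linarith

end PowerBounds

/-! ### Coercivity, homogeneity and invariance of the energy. -/

section Energy

variable {p m : ℝ} {u v : Plane → ℂ}

/-- `∫ |u|^(p+1) dx`. -/
def potential (p : ℝ) (u : Plane → ℂ) : ℝ := ∫ x, ‖u x‖ ^ (p + 1)

lemma energy_eq (p : ℝ) (u : Plane → ℂ) :
    energy p u = gradEnergy u - 2 / (p + 1) * potential p u - 1 / 2 * nonlocalEnergy u := rfl

lemma potential_nonneg (p : ℝ) (u : Plane → ℂ) : 0 ≤ potential p u :=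
  integral_nonneg fun _ => by positivity

lemma MemH1.integrable_potential (hp : 1 < p) (hp' : p < 3) (hu : MemH1 u) :
    Integrable fun x => ‖u x‖ ^ (p + 1) := by
  obtain ⟨C, hC0, hC⟩ := exists_rpow_le_add_sq (r := p - 1) (by linarith) (by linarith) one_pos
  refine ((integrable_norm_sq hu.1).add (hu.integrable_quartic.const_mul C)).mono'
    ((Real.continuous_rpow_const (by linarith)).comp_aestronglyMeasurable hu.1.1.norm)
    (Eventually.of_forall fun x => ?_)
  rw [Real.norm_of_nonneg (by positivity), rpow_add_one_eq hp (norm_nonneg _)]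
  have := mul_le_mul_of_nonneg_right (hC _ (norm_nonneg (u x))) (sq_nonneg ‖u x‖)
  refine this.trans (le_of_eq ?_)
  simp only [Pi.add_apply]; ring

/-- `∫|u|^(p+1)` is bounded by a linear combination of `∫|u|²` and `∫|u|⁴`. -/
lemma MemH1.potential_le_of_pointwise (hp : 1 < p) (hu : MemH1 u) {a b : ℝ}
    (h : ∀ s : ℝ, 0 ≤ s → s ^ (p - 1) ≤ a + b * s ^ 2) :
    potential p u ≤ a * mass u + b * quartic u := by
  have i2 := (integrable_norm_sq hu.1).const_mul a
  have i4 := hu.integrable_quartic.const_mul b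
  unfold potential mass quartic
  rw [← integral_const_mul, ← integral_const_mul, ← integral_add i2 i4]
  refine integral_mono_of_nonneg (Eventually.of_forall fun x => by positivity) (i2.add i4)
    (Eventually.of_forall fun x => ?_)
  simp only
  rw [rpow_add_one_eq hp (norm_nonneg _)]
  have := mul_le_mul_of_nonneg_right (h _ (norm_nonneg (u x))) (sq_nonneg ‖u x‖)
  refine this.trans (le_of_eq ?_)
  ring

lemma J_nonneg (hu : MemH1 u) : 0 ≤ J u :=
  div_nonneg (mul_nonneg (mass_nonneg u) (gradEnergy_nonneg u)) hu.nonlocalEnergy_nonneg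

lemma mass_eq_zero_iff (hu : MemLp u 2 volume) : mass u = 0 ↔ u =ᵐ[volume] 0 := by
  unfold mass
  rw [integral_eq_zero_iff_of_nonneg (fun x => by positivity) (integrable_norm_sq hu)]
  constructor <;> intro h <;> filter_upwards [h] with x hx <;> simpa using hx

/-- The variational inequality defining `d_J`. -/
lemma MemH1.nonlocalEnergy_mul_dJ_le (hu : MemH1 u) :
    nonlocalEnergy u * dJ ≤ mass u * gradEnergy u := by
  have h0 := mul_nonneg (mass_nonneg u) (gradEnergy_nonneg u)
  -- If the denominator of $J$ vanishes, the left side is $0$, so the default value of the quotient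
  -- plays no role.
  rcases hu.nonlocalEnergy_nonneg.eq_or_lt with h | h
  · rw [← h, zero_mul]; exact h0
  · have hne : ¬ u =ᵐ[volume] 0 := fun h1 => by
      have h2 : mass (absSq u) = 0 := by
        rw [mass_eq_zero_iff hu.memLp_absSq]
        filter_upwards [h1] with x hx
        simp [absSq, hx]
      have h3 := hu.nonlocalEnergy_le_quartic
      rw [← mass_absSq, h2] at h3
      linarith
    have h1 : dJ ≤ J u := by
      refine csInf_le ⟨0, ?_⟩ ⟨u, hu, hne, rfl⟩
      rintro r ⟨v, hv, -, rfl⟩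
      exact J_nonneg hv
    rw [J, le_div_iff₀ h] at h1
    linarith

/-- Positivity of $d_J$ is read off from the mass range and needs no separate estimate. -/
lemma dJ_pos (hm : 0 < m) (hm' : m < 2 * dJ) : 0 < dJ := by linarith

lemma MemH1.half_nonlocalEnergy_le (hm : 0 < m) (hm' : m < 2 * dJ) (hu : MemH1 u)
    (hmu : mass u ≤ m) : 1 / 2 * nonlocalEnergy u ≤ m / (2 * dJ) * gradEnergy u := by
  have hd := dJ_pos hm hm'
  have h1 := hu.nonlocalEnergy_mul_dJ_le
  have h2 : mass u * gradEnergy u ≤ m * gradEnergy u :=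
    mul_le_mul_of_nonneg_right hmu (gradEnergy_nonneg u)
  have h3 : nonlocalEnergy u ≤ m * gradEnergy u / dJ := by
    rw [le_div_iff₀ hd]; linarith
  calc _ ≤ 1 / 2 * (m * gradEnergy u / dJ) := by linarith
    _ = _ := by field_simp

/-- Below the critical mass the quadratic and nonlocal parts of the energy are nonnegative. -/
lemma MemH1.neg_potential_le_energy (hm : 0 < m) (hm' : m < 2 * dJ) (hu : MemH1 u)
    (hmu : mass u ≤ m) : - (2 / (p + 1) * potential p u) ≤ energy p u := by
  have h1 := hu.half_nonlocalEnergy_le hm hm' hmu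
  have h2 : m / (2 * dJ) * gradEnergy u ≤ 1 * gradEnergy u := by
    refine mul_le_mul_of_nonneg_right ?_ (gradEnergy_nonneg u)
    rw [div_le_one (by linarith)]; exact hm'.le
  rw [energy_eq]; linarith

/-- Coercivity of the energy below the critical mass. -/
lemma exists_coercive (hp : 1 < p) (hp' : p < 3) (hm : 0 < m) (hm' : m < 2 * dJ) :
    ∃ c C : ℝ, 0 < c ∧ ∀ u : Plane → ℂ, MemH1 u → mass u ≤ m →
      c * gradEnergy u - C ≤ energy p u := by
  set κ := 1 - m / (2 * dJ) with hκ
  have hκ0 : 0 < κ := by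
    rw [hκ, sub_pos, div_lt_one (by linarith)]; exact hm'
  -- Chosen so that, after Ladyzhenskaya's inequality, the power term uses up half of the gradient
  -- coefficient $\kappa$ left over by the nonlocal term.
  set ε := κ / 2 / (ladyConst * m) with hε
  have hl := ladyConst_pos
  have hε0 : 0 < ε := by positivity
  obtain ⟨C, hC0, hC⟩ := exists_rpow_le_add_mul_sq (r := p - 1) (by linarith) (by linarith) hε0
  refine ⟨κ / 2, C * m, by positivity, fun u hu hmu => ?_⟩
  have hg := gradEnergy_nonneg u
  have h1 := hu.half_nonlocalEnergy_le hm hm' hmu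
  have h2 := hu.potential_le_of_pointwise hp hC
  have h3 : quartic u ≤ ladyConst * m * gradEnergy u := hu.quartic_le.trans (by gcongr)
  have h4 : potential p u ≤ C * m + κ / 2 * gradEnergy u := by
    calc _ ≤ C * mass u + ε * quartic u := h2
      _ ≤ C * m + ε * (ladyConst * m * gradEnergy u) := by gcongr
      _ = _ := by rw [hε]; field_simp
  have h5 : 2 / (p + 1) * potential p u ≤ 1 * potential p u := by
    refine mul_le_mul_of_nonneg_right ?_ (potential_nonneg p u)
    rw [div_le_one (by linarith)]; linarith
  rw [energy_eq]
  have : gradEnergy u = κ * gradEnergy u + m / (2 * dJ) * gradEnergy u := by rw [hκ]; ring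
  linarith

section Homogeneity

lemma gradEnergy_const_mul (c : ℝ) (hu : MemH1 u) :
    gradEnergy (fun x => (c : ℂ) * u x) = c ^ 2 * gradEnergy u := by
  rw [gradEnergy_eq, gradEnergy_eq, Finset.mul_sum]
  refine Finset.sum_congr rfl fun i _ => ?_
  rw [mass_congr (weakPartial_const_mul c hu i), mass_const_mul, Complex.norm_real, Real.norm_eq_abs,
    sq_abs]

lemma nonlocalEnergy_const_mul (c : ℝ) (hu : MemH1 u) :
    nonlocalEnergy (fun x => (c : ℂ) * u x) = c ^ 4 * nonlocalEnergy u := by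
  have e : absSq (fun x => (c : ℂ) * u x) = fun x => ((c ^ 2 : ℝ) : ℂ) * absSq u x := by
    ext x; simp [absSq, mul_pow]
  rw [(hu.const_mul c).nonlocalEnergy_eq, hu.nonlocalEnergy_eq, e,
    nlForm_const_mul_left _ hu.memLp_absSq, nlForm_const_mul_right _ hu.memLp_absSq]
  ring

lemma potential_const_mul (p : ℝ) {c : ℝ} (hc : 0 ≤ c) (u : Plane → ℂ) :
    potential p (fun x => (c : ℂ) * u x) = c ^ (p + 1) * potential p u := by
  unfold potential
  rw [← integral_const_mul]
  congr 1; ext x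
  rw [norm_mul, Complex.norm_real, Real.norm_of_nonneg hc, Real.mul_rpow hc (norm_nonneg _)]

/-- Scaling the amplitude by $\sqrt\theta$ multiplies the mass by $\theta$. In terms of $\theta$ the
gradient is then linear and the two attractive terms are superlinear, which drives both the mass
comparison and the constrained variation. -/
lemma energy_sqrt_mul (p : ℝ) {θ : ℝ} (hθ : 0 ≤ θ) (hu : MemH1 u) :
    energy p (fun x => (Real.sqrt θ : ℂ) * u x) =
      θ * gradEnergy u - 2 / (p + 1) * (θ ^ ((p + 1) / 2) * potential p u)
        - 1 / 2 * (θ ^ 2 * nonlocalEnergy u) := by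
  rw [energy_eq, gradEnergy_const_mul _ hu, nonlocalEnergy_const_mul _ hu,
    potential_const_mul p (Real.sqrt_nonneg θ), Real.sq_sqrt hθ]
  have h1 : Real.sqrt θ ^ (p + 1) = θ ^ ((p + 1) / 2) := by
    rw [Real.sqrt_eq_rpow, ← Real.rpow_mul hθ]; congr 1; ring
  have h2 : Real.sqrt θ ^ 4 = θ ^ 2 := by
    rw [show (4 : ℕ) = 2 * 2 from rfl, pow_mul, Real.sq_sqrt hθ]
  rw [h1, h2]

lemma mass_sqrt_mul {θ : ℝ} (hθ : 0 ≤ θ) (u : Plane → ℂ) :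
    mass (fun x => (Real.sqrt θ : ℂ) * u x) = θ * mass u := by
  rw [mass_const_mul, Complex.norm_real, Real.norm_of_nonneg (Real.sqrt_nonneg _), Real.sq_sqrt hθ]

end Homogeneity

section Congruence

lemma absSq_congr (h : u =ᵐ[volume] v) : absSq u =ᵐ[volume] absSq v := by
  filter_upwards [h] with x hx
  simp [absSq, hx]

lemma potential_congr (h : u =ᵐ[volume] v) : potential p u = potential p v :=
  integral_congr_ae (by filter_upwards [h] with x hx; rw [hx])

lemma gradEnergy_congr (h : u =ᵐ[volume] v) (hu : MemH1 u) : gradEnergy u = gradEnergy v := by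
  rw [gradEnergy_eq, gradEnergy_eq]
  exact Finset.sum_congr rfl fun i _ => (mass_congr (weakPartial_congr h hu i)).symm

lemma energy_congr (h : u =ᵐ[volume] v) (hu : MemH1 u) : energy p u = energy p v := by
  rw [energy_eq, energy_eq, gradEnergy_congr h hu, potential_congr h, hu.nonlocalEnergy_eq,
    (hu.congr h).nonlocalEnergy_eq, nlForm, nlForm, FT_congr (absSq_congr h)]

lemma energy_comp_add (hu : MemH1 u) (h : Plane) :
    energy p (fun x => u (x + h)) = energy p u := by
  have e : absSq (fun x => u (x + h)) = fun x => absSq u (x + h) := rfl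
  rw [energy_eq, energy_eq, gradEnergy_comp_add hu, (hu.comp_add h).nonlocalEnergy_eq,
    hu.nonlocalEnergy_eq, e, nlForm_comp_add hu.memLp_absSq hu.memLp_absSq]
  congr 3
  exact integral_add_right_eq_self (fun x => ‖u x‖ ^ (p + 1)) h

/-- Passing to the modulus does not increase the energy. -/
lemma energy_norm_le (hu : MemH1 u) : energy p (fun x => (‖u x‖ : ℂ)) ≤ energy p u := by
  have e : absSq (fun x => (‖u x‖ : ℂ)) = absSq u := by ext x; simp [absSq]
  have h1 : nonlocalEnergy (fun x => (‖u x‖ : ℂ)) = nonlocalEnergy u := by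
    rw [hu.norm.1.nonlocalEnergy_eq, hu.nonlocalEnergy_eq, e]
  have h2 : potential p (fun x => (‖u x‖ : ℂ)) = potential p u := by
    unfold potential; simp
  rw [energy_eq, energy_eq, h1, h2]
  linarith [hu.norm.2]

lemma mass_norm (u : Plane → ℂ) : mass (fun x => (‖u x‖ : ℂ)) = mass u := by
  unfold mass; simp

end Congruence

end Energy

/-! ### Test functions as elements of $H^1$, and dilations. -/

section TestFunctions

variable {φ ψ : Plane → ℝ}

lemma IsTestFunction.hasWeakPartial (hψ : IsTestFunction ψ) (i : Fin 2) :
    HasWeakPartial i (fun x => (ψ x : ℂ)) (fun x => (DaveyStewartson.partialDeriv i ψ x : ℂ)) := fun φ hφ => by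
  have h := integral_mul_fderiv_eq_neg_fderiv_mul_of_integrable (𝕜 := ℝ)
    (μ := (volume : Measure Plane)) (f := ψ) (g := φ) (v := EuclideanSpace.single i (1 : ℝ))
    (((hψ.partialDeriv i).continuous.mul hφ.continuous).integrable_of_hasCompactSupport
      hφ.2.mul_left)
    ((hψ.continuous.mul (hφ.partialDeriv i).continuous).integrable_of_hasCompactSupport
      hψ.2.mul_right)
    ((hψ.continuous.mul hφ.continuous).integrable_of_hasCompactSupport hφ.2.mul_left)
    (fun x _ => hψ.differentiable x) (fun x _ => hφ.differentiable x)
  have h' := congrArg (fun r : ℝ => (r : ℂ)) h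
  simp only [Complex.ofReal_neg, ← integral_complex_ofReal, Complex.ofReal_mul] at h'
  exact h'

lemma IsTestFunction.memH1 (hψ : IsTestFunction ψ) : MemH1 (fun x => (ψ x : ℂ)) :=
  ⟨hψ.memLp 2, fun i => ⟨_, (hψ.partialDeriv i).memLp 2, hψ.hasWeakPartial i⟩⟩

lemma IsTestFunction.weakPartial_ae_eq (hψ : IsTestFunction ψ) (i : Fin 2) :
    weakPartial i (fun x => (ψ x : ℂ)) =ᵐ[volume]
      fun x => (DaveyStewartson.partialDeriv i ψ x : ℂ) :=
  DaveyStewartson.weakPartial_ae_eq ((hψ.partialDeriv i).memLp 2) (hψ.hasWeakPartial i)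

lemma IsTestFunction.dilate (hψ : IsTestFunction ψ) {t : ℝ} (ht : t ≠ 0) :
    IsTestFunction (fun x => ψ (t • x)) :=
  ⟨hψ.1.comp (contDiff_const_smul t), hψ.2.comp_homeomorph (Homeomorph.smulOfNeZero t ht)⟩

lemma partialDeriv_dilate (hψ : IsTestFunction ψ) (t : ℝ) (i : Fin 2) (x : Plane) :
    partialDeriv i (fun x => ψ (t • x)) x = t * partialDeriv i ψ (t • x) := by
  have h1 : HasFDerivAt (fun x => ψ (t • x))
      ((fderiv ℝ ψ (t • x)).comp (t • ContinuousLinearMap.id ℝ Plane)) x :=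
    (hψ.differentiable (t • x)).hasFDerivAt.comp x ((hasFDerivAt_id x).const_smul t)
  unfold partialDeriv
  rw [h1.fderiv]; simp

lemma integral_comp_dilate (F : Plane → ℝ) {t : ℝ} (ht : 0 < t) :
    ∫ x, F (t • x) = (t ^ 2)⁻¹ * ∫ x, F x := by
  have := Measure.integral_comp_smul (volume : Measure Plane) F t
  rw [this]
  simp [abs_of_pos ht]

lemma mass_dilate (ψ : Plane → ℝ) {t : ℝ} (ht : 0 < t) :
    mass (fun x => (ψ (t • x) : ℂ)) = (t ^ 2)⁻¹ * mass (fun x => (ψ x : ℂ)) :=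
  integral_comp_dilate (fun x => ‖(ψ x : ℂ)‖ ^ 2) ht

lemma gradEnergy_dilate (hψ : IsTestFunction ψ) {t : ℝ} (ht : 0 < t) :
    gradEnergy (fun x => (ψ (t • x) : ℂ)) = gradEnergy (fun x => (ψ x : ℂ)) := by
  rw [gradEnergy_eq, gradEnergy_eq]
  refine Finset.sum_congr rfl fun i _ => ?_
  rw [mass_congr ((hψ.dilate ht.ne').weakPartial_ae_eq i), mass_congr (hψ.weakPartial_ae_eq i)]
  simp only [partialDeriv_dilate hψ, Complex.ofReal_mul]
  rw [mass_const_mul, mass_dilate (partialDeriv i ψ) ht, Complex.norm_real, Real.norm_eq_abs, sq_abs]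
  field_simp

lemma potential_dilate (p : ℝ) (ψ : Plane → ℝ) {t : ℝ} (ht : 0 < t) :
    potential p (fun x => (ψ (t • x) : ℂ)) = (t ^ 2)⁻¹ * potential p (fun x => (ψ x : ℂ)) :=
  integral_comp_dilate (fun x => ‖(ψ x : ℂ)‖ ^ (p + 1)) ht

end TestFunctions

/-! ### The infimum is finite and negative; comparison of different masses. -/

section Infimum

variable {p m d : ℝ} {u v : Plane → ℂ}

lemma potential_pos (hp : 1 < p) (hp' : p < 3) (hu : MemH1 u) (h : 0 < mass u) :
    0 < potential p u := by
  refine (potential_nonneg p u).lt_of_ne fun h0 => ?_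
  have h1 := h0.symm
  unfold potential at h1
  rw [integral_eq_zero_iff_of_nonneg (fun x => by positivity)
    (hu.integrable_potential hp hp')] at h1
  have h2 : u =ᵐ[volume] 0 := by
    filter_upwards [h1] with x hx
    rw [Pi.zero_apply, Real.rpow_eq_zero (norm_nonneg _) (by linarith)] at hx
    simpa using hx
  rw [(mass_eq_zero_iff hu.1).2 h2] at h
  exact lt_irrefl _ h

/-- Spread out a bump: $\sqrt{m/M}\,t\,\psi(tx)$ has mass $m$, gradient energy $At^2$ and power term
$bt^{p-1}$. As $p-1<2$, the power term wins for small $t$; the nonlocal term only lowers the energy.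
-/
lemma exists_energy_neg (hp : 1 < p) (hp' : p < 3) (hm : 0 < m) :
    ∃ u ∈ constraintSet m, energy p u < 0 := by
  have hψ := isTestFunction_cutoff 0
  set ψ := cutoff 0
  have hM : 0 < mass (fun x => (ψ x : ℂ)) := by
    refine (mass_nonneg _).lt_of_ne fun h0 => ?_
    have h1 := (mass_eq_zero_iff (hψ.memLp 2)).1 h0.symm
    have h2 := (Continuous.ae_eq_iff_eq (μ := (volume : Measure Plane)) hψ.ofReal.1.continuous
      continuous_zero).1 h1
    have h3 := congrFun h2 0
    have h4 : ψ 0 = 1 := cutoff_eq_one (by simp)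
    simp [h4] at h3
  set M := mass (fun x => (ψ x : ℂ))
  set G := gradEnergy (fun x => (ψ x : ℂ))
  set P := potential p (fun x => (ψ x : ℂ))
  have hP : 0 < P := potential_pos hp hp' hψ.memH1 hM
  have hG : 0 ≤ G := gradEnergy_nonneg _
  set A := m / M * G
  set b := 2 / (p + 1) * ((m / M) ^ ((p + 1) / 2) * P)
  have hA : 0 ≤ A := by positivity
  have hb : 0 < b := by positivity
  -- Then $t^{3-p}=b/(A+1)$, which gives $At^2<bt^{p-1}$. The $+1$ guards against division by zero
  -- and provides strictness.
  set t := (b / (A + 1)) ^ (1 / (3 - p)) with ht_def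
  have ht : 0 < t := by positivity
  have ht3 : t ^ (3 - p) = b / (A + 1) := by
    rw [ht_def, ← Real.rpow_mul (by positivity), one_div_mul_cancel (by linarith), Real.rpow_one]
  set w : Plane → ℂ := fun x => (ψ (t • x) : ℂ)
  have hw : MemH1 w := (hψ.dilate ht.ne').memH1
  have hθ : 0 ≤ m / M * t ^ 2 := by positivity
  refine ⟨fun x => (Real.sqrt (m / M * t ^ 2) : ℂ) * w x, ⟨hw.const_mul _, ?_⟩, ?_⟩
  · rw [mass_sqrt_mul hθ, mass_dilate ψ ht]
    have : M ≠ 0 := hM.ne'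
    change m / M * t ^ 2 * ((t ^ 2)⁻¹ * M) = m
    field_simp
  · rw [energy_sqrt_mul p hθ hw, gradEnergy_dilate hψ ht, potential_dilate p ψ ht]
    have hN := hw.nonlocalEnergy_nonneg
    change m / M * t ^ 2 * G - 2 / (p + 1) * ((m / M * t ^ 2) ^ ((p + 1) / 2) * ((t ^ 2)⁻¹ * P))
      - 1 / 2 * ((m / M * t ^ 2) ^ 2 * nonlocalEnergy w) < 0
    have e1 : (m / M * t ^ 2) ^ ((p + 1) / 2) * (t ^ 2)⁻¹
        = (m / M) ^ ((p + 1) / 2) * t ^ (p - 1) := by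
      rw [Real.mul_rpow (by positivity) (by positivity), ← Real.rpow_natCast t 2,
        ← Real.rpow_mul ht.le, ← Real.rpow_neg ht.le, mul_assoc, ← Real.rpow_add ht]
      congr 2; push_cast; ring
    have e2 : t ^ 2 = t ^ (p - 1) * t ^ (3 - p) := by
      rw [← Real.rpow_add ht, ← Real.rpow_natCast t 2]; congr 1; push_cast; ring
    have e3 : 2 / (p + 1) * ((m / M * t ^ 2) ^ ((p + 1) / 2) * ((t ^ 2)⁻¹ * P))
        = b * t ^ (p - 1) := by
      rw [← mul_assoc _ _ P, e1]; simp only [b]; ring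
    have e4 : m / M * t ^ 2 * G = t ^ (p - 1) * (b * (A / (A + 1))) := by
      rw [e2, ht3]; simp only [A]; ring
    have h5 : A / (A + 1) < 1 := by rw [div_lt_one (by linarith)]; linarith
    have h6 : t ^ (p - 1) * (b * (A / (A + 1))) < t ^ (p - 1) * (b * 1) := by gcongr
    rw [e3, e4]
    have h7 : 0 ≤ 1 / 2 * ((m / M * t ^ 2) ^ 2 * nonlocalEnergy w) := by positivity
    linarith

/-- The infimum `d_m` is a negative real number. -/
lemma exists_dm_eq (hp : 1 < p) (hp' : p < 3) (hm : 0 < m) (hm' : m < 2 * dJ) :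
    ∃ d : ℝ, dm p m = d ∧ d < 0 ∧ (∀ u ∈ constraintSet m, d ≤ energy p u) ∧
      ∀ ε > 0, ∃ u ∈ constraintSet m, energy p u < d + ε := by
  obtain ⟨u₀, hu₀, hE₀⟩ := exists_energy_neg hp hp' hm
  obtain ⟨c, C, hc, hC⟩ := exists_coercive hp hp' hm hm'
  have hlow : ((-C : ℝ) : EReal) ≤ dm p m := by
    refine le_iInf₂ fun u hu => EReal.coe_le_coe_iff.2 ?_
    have := hC u hu.1 hu.2.le
    nlinarith [gradEnergy_nonneg u]
  have hup : dm p m ≤ (energy p u₀ : EReal) := iInf₂_le u₀ hu₀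
  have hne_bot : dm p m ≠ ⊥ := fun h => by
    rw [h] at hlow; exact absurd (le_bot_iff.1 hlow) (EReal.coe_ne_bot _)
  have hne_top : dm p m ≠ ⊤ := fun h => by
    rw [h] at hup; exact absurd (top_le_iff.1 hup) (EReal.coe_ne_top _)
  refine ⟨(dm p m).toReal, (EReal.coe_toReal hne_top hne_bot).symm, ?_, fun u hu => ?_,
    fun ε hε => ?_⟩
  · have : (((dm p m).toReal : ℝ) : EReal) ≤ (energy p u₀ : EReal) := by
      rwa [EReal.coe_toReal hne_top hne_bot]
    exact (EReal.coe_le_coe_iff.1 this).trans_lt hE₀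
  · refine EReal.coe_le_coe_iff.1 ?_
    rw [EReal.coe_toReal hne_top hne_bot]
    exact iInf₂_le u hu
  · by_contra hcon
    push Not at hcon
    have h1 : (((dm p m).toReal + ε : ℝ) : EReal) ≤ dm p m :=
      le_iInf₂ fun u hu => EReal.coe_le_coe_iff.2 (hcon u hu)
    rw [← EReal.coe_toReal hne_top hne_bot, EReal.coe_le_coe_iff, EReal.toReal_coe] at h1
    linarith

lemma rpow_half_ge {p θ : ℝ} (hp : 1 < p) (hθ : 1 ≤ θ) : θ ≤ θ ^ ((p + 1) / 2) := by
  conv_lhs => rw [← Real.rpow_one θ]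
  exact Real.rpow_le_rpow_of_exponent_le hθ (by linarith)

/-- For $\theta\ge1$ the superlinear gain of the nonlocal term is discarded, but that of the power
term is kept: it supplies the strict inequality that excludes loss of mass. -/
lemma energy_sqrt_mul_le {θ : ℝ} (hθ : 1 ≤ θ) (hu : MemH1 u) :
    energy p (fun x => (Real.sqrt θ : ℂ) * u x) ≤
      θ * energy p u - 2 / (p + 1) * ((θ ^ ((p + 1) / 2) - θ) * potential p u) := by
  rw [energy_sqrt_mul p (by linarith) hu, energy_eq]
  have h1 : θ * nonlocalEnergy u ≤ θ ^ 2 * nonlocalEnergy u :=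
    mul_le_mul_of_nonneg_right (by nlinarith) hu.nonlocalEnergy_nonneg
  nlinarith

/-- The energy of a function with mass at most `m` is controlled by the infimum at mass `m`. -/
lemma mass_div_mul_le_energy (hp : 1 < p) (hm : 0 < m) (hm' : m < 2 * dJ)
    (hd : ∀ u ∈ constraintSet m, d ≤ energy p u) (hv : MemH1 v) (hmv : mass v ≤ m) :
    mass v / m * d ≤ energy p v := by
  rcases (mass_nonneg v).eq_or_lt with h0 | h0
  · have hv0 : v =ᵐ[volume] 0 := (mass_eq_zero_iff hv.1).1 h0.symm
    have h1 : potential p v = 0 := by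
      rw [potential_congr hv0]
      have : p + 1 ≠ 0 := by linarith
      simp [potential, Real.zero_rpow this]
    have h2 := hv.neg_potential_le_energy (p := p) hm hm' hmv
    rw [h1] at h2
    rw [← h0, zero_div, zero_mul]
    linarith
  -- Scale $v$ up to mass $m$ and compare with $d$; the superlinear gain has the right sign to be
  -- dropped.
  · have hθ : 1 ≤ m / mass v := by rwa [one_le_div h0]
    have h1 := hd (fun x => (Real.sqrt (m / mass v) : ℂ) * v x)
      ⟨hv.const_mul _, by rw [mass_sqrt_mul (by positivity)]; field_simp⟩
    have h2 := h1.trans (energy_sqrt_mul_le hθ hv)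
    have h3 : 0 ≤ 2 / (p + 1) * (((m / mass v) ^ ((p + 1) / 2) - m / mass v) * potential p v) := by
      have := rpow_half_ge hp hθ
      have := potential_nonneg p v
      have : 0 ≤ (m / mass v) ^ ((p + 1) / 2) - m / mass v := by linarith
      positivity
    have h4 : d ≤ m / mass v * energy p v := by linarith
    calc mass v / m * d ≤ mass v / m * (m / mass v * energy p v) := by gcongr
      _ = energy p v := by field_simp

end Infimum

/-! ### Weak convergence and weak compactness. -/

section Weak

/-- Weak convergence in `L²`. -/
def WeakTendsto (f : ℕ → Plane → ℂ) (f₀ : Plane → ℂ) : Prop :=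
  ∀ g : Plane → ℂ, MemLp g 2 volume →
    Tendsto (fun n => ∫ x, f n x * g x) atTop (𝓝 (∫ x, f₀ x * g x))

lemma WeakTendsto.comp {f : ℕ → Plane → ℂ} {f₀ : Plane → ℂ} (h : WeakTendsto f f₀)
    {ns : ℕ → ℕ} (hns : StrictMono ns) : WeakTendsto (fun k => f (ns k)) f₀ :=
  fun g hg => (h g hg).comp hns.tendsto_atTop

lemma WeakTendsto.sub_self {f : ℕ → Plane → ℂ} {f₀ : Plane → ℂ} (h : WeakTendsto f f₀)
    (hf : ∀ n, MemLp (f n) 2 volume) (hf₀ : MemLp f₀ 2 volume) :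
    WeakTendsto (fun n x => f n x - f₀ x) 0 := fun g hg => by
  have h1 := (h g hg).sub_const (∫ x, f₀ x * g x)
  simp only [Pi.zero_apply, zero_mul, integral_zero, _root_.sub_self] at h1 ⊢
  refine h1.congr fun n => ?_
  have := integral_sub ((hf n).integrable_mul hg) (hf₀.integrable_mul hg)
  simp only [Pi.mul_apply] at this
  rw [← this]
  simp only [sub_mul]

lemma WeakTendsto.congr {f f' : ℕ → Plane → ℂ} {f₀ : Plane → ℂ} (h : WeakTendsto f f₀)
    (hf : ∀ n, f n =ᵐ[volume] f' n) : WeakTendsto f' f₀ := fun g hg =>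
  (h g hg).congr fun n => integral_congr_ae (by filter_upwards [hf n] with x hx; rw [hx])

/-- Sequential Banach–Alaoglu together with the Riesz isomorphism. The functions are conjugated
because the pairing in `WeakTendsto` is bilinear while the inner product is conjugate-linear in its
first argument. -/
lemma exists_weakTendsto_subseq {f : ℕ → Plane → ℂ} (hf : ∀ n, MemLp (f n) 2 volume) {R : ℝ}
    (hR : ∀ n, mass (f n) ≤ R) : ∃ f₀ : Plane → ℂ, MemLp f₀ 2 volume ∧ ∃ ns : ℕ → ℕ,
      StrictMono ns ∧ WeakTendsto (fun k => f (ns k)) f₀ := by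
  have hfc : ∀ n, MemLp (fun x => conj (f n x)) 2 volume := fun n => (hf n).star
  set X : ℕ → Lp ℂ 2 (volume : Measure Plane) := fun n => (hfc n).toLp _
  have hX : ∀ n, ‖X n‖ ≤ Real.sqrt R := fun n => by
    refine Real.le_sqrt_of_sq_le ?_
    rw [← mass_eq_norm_sq (hfc n)]
    refine le_trans (le_of_eq ?_) (hR n)
    simp [mass]
  set φ : ℕ → WeakDual ℂ (Lp ℂ 2 (volume : Measure Plane)) := fun n =>
    StrongDual.toWeakDual (InnerProductSpace.toDual ℂ _ (X n))
  have hφ : ∀ n, φ n ∈ WeakDual.toStrongDual ⁻¹' Metric.closedBall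
      (0 : StrongDual ℂ (Lp ℂ 2 (volume : Measure Plane))) (Real.sqrt R) := fun n => by
    rw [Set.mem_preimage, mem_closedBall_zero_iff]
    change ‖InnerProductSpace.toDual ℂ _ (X n)‖ ≤ _
    rw [LinearIsometryEquiv.norm_map]; exact hX n
  have : Fact ((2 : ℝ≥0∞) ≠ ∞) := ⟨by norm_num⟩
  obtain ⟨ψ, -, ns, hns, hlim⟩ := WeakDual.isSeqCompact_closedBall ℂ
    (Lp ℂ 2 (volume : Measure Plane)) 0 (Real.sqrt R) hφ
  set Y := (InnerProductSpace.toDual ℂ _).symm (WeakDual.toStrongDual ψ)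
  refine ⟨fun x => conj (Y x), (Lp.memLp Y).star, ns, hns, fun g hg => ?_⟩
  have h1 : Tendsto (fun k => φ (ns k) (hg.toLp g)) atTop (𝓝 (ψ (hg.toLp g))) :=
    ((WeakDual.eval_continuous (hg.toLp g)).tendsto ψ).comp hlim
  have h2 : ψ (hg.toLp g) = ∫ x, conj (Y x) * g x := by
    have : ψ (hg.toLp g) = inner ℂ Y (hg.toLp g) := by
      rw [InnerProductSpace.toDual_symm_apply]; rfl
    rw [this, L2.inner_def]
    refine integral_congr_ae ?_
    filter_upwards [hg.coeFn_toLp] with x hx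
    rw [hx, RCLike.inner_apply, mul_comm]
  rw [h2] at h1
  refine h1.congr fun k => ?_
  have : φ (ns k) (hg.toLp g) = inner ℂ (X (ns k)) (hg.toLp g) := rfl
  rw [this, L2.inner_def]
  refine integral_congr_ae ?_
  filter_upwards [hg.coeFn_toLp, (hfc (ns k)).coeFn_toLp] with x hx hx'
  rw [hx, RCLike.inner_apply, hx', Complex.conj_conj, mul_comm]

lemma mass_weakPartial_le (i : Fin 2) (u : Plane → ℂ) : mass (weakPartial i u) ≤ gradEnergy u := by
  rw [gradEnergy_eq]
  exact Finset.single_le_sum (f := fun i => mass (weakPartial i u))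
    (fun j _ => mass_nonneg _) (Finset.mem_univ i)

/-- Weak sequential compactness of bounded sets of `H¹`. -/
lemma exists_weakTendsto_subseq_H1 {u : ℕ → Plane → ℂ} (hu : ∀ n, MemH1 (u n)) {R : ℝ}
    (hm : ∀ n, mass (u n) ≤ R) (hg : ∀ n, gradEnergy (u n) ≤ R) :
    ∃ u₀ : Plane → ℂ, MemH1 u₀ ∧ ∃ ns : ℕ → ℕ, StrictMono ns ∧
      WeakTendsto (fun k => u (ns k)) u₀ ∧
      ∀ i, WeakTendsto (fun k => weakPartial i (u (ns k))) (weakPartial i u₀) := by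
  obtain ⟨u₀, hu₀, n₁, hn₁, h₁⟩ := exists_weakTendsto_subseq (fun n => (hu n).1) hm
  obtain ⟨g₀, hg₀, n₂, hn₂, h₂⟩ := exists_weakTendsto_subseq
    (f := fun k => weakPartial 0 (u (n₁ k))) (fun n => memLp_weakPartial _ _)
    (fun n => (mass_weakPartial_le 0 _).trans (hg _))
  obtain ⟨g₁, hg₁, n₃, hn₃, h₃⟩ := exists_weakTendsto_subseq
    (f := fun k => weakPartial 1 (u (n₁ (n₂ k)))) (fun n => memLp_weakPartial _ _)
    (fun n => (mass_weakPartial_le 1 _).trans (hg _))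
  have hns : StrictMono fun k => n₁ (n₂ (n₃ k)) := hn₁.comp (hn₂.comp hn₃)
  have hu' : WeakTendsto (fun k => u (n₁ (n₂ (n₃ k)))) u₀ := (h₁.comp hn₂).comp hn₃
  -- The defining identity of a weak derivative passes to weak limits on both sides, so the limits
  -- of the derivatives are the derivatives of the limit.
  have hpass : ∀ (i : Fin 2) (g : Plane → ℂ),
      WeakTendsto (fun k => weakPartial i (u (n₁ (n₂ (n₃ k))))) g → HasWeakPartial i u₀ g := by
    intro i g h φ hφ
    have l1 := hu' _ ((hφ.partialDeriv i).memLp 2)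
    have l2 := (h _ (hφ.memLp 2)).neg
    refine tendsto_nhds_unique (l1.congr fun k => ?_) l2
    exact (hu _).hasWeakPartial i φ hφ
  have w0 := hpass 0 g₀ (h₂.comp hn₃)
  have w1 := hpass 1 g₁ h₃
  have hH : MemH1 u₀ := ⟨hu₀, fun i => by
    fin_cases i
    · exact ⟨g₀, hg₀, w0⟩
    · exact ⟨g₁, hg₁, w1⟩⟩
  refine ⟨u₀, hH, _, hns, hu', fun i g hg => ?_⟩
  fin_cases i
  · have e : ∫ x, weakPartial 0 u₀ x * g x = ∫ x, g₀ x * g x := integral_congr_ae (by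
      filter_upwards [weakPartial_ae_eq hg₀ w0] with x hx; rw [hx])
    simp only [Fin.zero_eta]
    rw [e]
    exact (h₂.comp hn₃) g hg
  · have e : ∫ x, weakPartial 1 u₀ x * g x = ∫ x, g₁ x * g x := integral_congr_ae (by
      filter_upwards [weakPartial_ae_eq hg₁ w1] with x hx; rw [hx])
    simp only [Fin.mk_one]
    rw [e]
    exact h₃ g hg

end Weak

/-! ### Localization by translated cutoffs. -/

section Localization

variable {u : Plane → ℂ} {χ : Plane → ℝ}

/-- Written as a convolution, this is Fubini. It turns local estimates around every centre $y$ into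
global ones by integrating over $y$, with no covering argument. -/
lemma integrable_and_integral_cross {a b : Plane → ℝ} (ha : Integrable a) (hb : Integrable b) :
    Integrable (fun y => ∫ x, a x * b (x + y)) ∧
      ∫ y, ∫ x, a x * b (x + y) = (∫ x, a x) * ∫ x, b x := by
  have e : (fun y => ∫ x, a x * b (x + y)) =
      convolution (fun x => a (-x)) b (ContinuousLinearMap.mul ℝ ℝ) volume := by
    ext y
    rw [convolution_def, ← integral_neg_eq_self]
    simp [add_comm, sub_eq_add_neg]
  have ha' : Integrable (fun x => a (-x)) := ha.comp_neg
  rw [e]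
  refine ⟨ha'.integrable_convolution _ hb, ?_⟩
  rw [integral_convolution _ ha' hb]
  simp [integral_neg_eq_self]

lemma IsTestFunction.sq_integrable (hχ : IsTestFunction χ) (k : ℕ) (hk : k ≠ 0) :
    Integrable fun x => χ x ^ k :=
  (hχ.continuous.pow k).integrable_of_hasCompactSupport
    (hχ.2.comp_left (g := fun t : ℝ => t ^ k) (by simp [hk]))

/-- The gradient norm of a localized function. -/
lemma MemH1.gradEnergy_mul_test_le (hu : MemH1 u) (hχ : IsTestFunction χ) :
    gradEnergy (fun x => (χ x : ℂ) * u x) ≤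
      ∑ i, (2 * (∫ x, χ x ^ 2 * ‖weakPartial i u x‖ ^ 2) +
        2 * ∫ x, partialDeriv i χ x ^ 2 * ‖u x‖ ^ 2) := by
  rw [gradEnergy_eq]
  refine Finset.sum_le_sum fun i _ => ?_
  rw [mass_congr (weakPartial_mul_test hu hχ i)]
  have i1 : Integrable fun x => χ x ^ 2 * ‖weakPartial i u x‖ ^ 2 := by
    have := integrable_norm_sq (MemLp.mul_test (memLp_weakPartial i u) hχ)
    simpa [mul_pow] using this
  have i2 : Integrable fun x => partialDeriv i χ x ^ 2 * ‖u x‖ ^ 2 := by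
    have := integrable_norm_sq (MemLp.mul_test hu.1 (hχ.partialDeriv i))
    simpa [mul_pow] using this
  rw [← integral_const_mul, ← integral_const_mul, ← integral_add (i1.const_mul 2) (i2.const_mul 2)]
  refine integral_mono_of_nonneg (Eventually.of_forall fun x => by positivity)
    ((i1.const_mul 2).add (i2.const_mul 2)) (Eventually.of_forall fun x => ?_)
  simp only
  calc _ ≤ (‖(χ x : ℂ) * weakPartial i u x‖ + ‖(partialDeriv i χ x : ℂ) * u x‖) ^ 2 := by
        gcongr; exact norm_add_le _ _
    _ ≤ 2 * ‖(χ x : ℂ) * weakPartial i u x‖ ^ 2 + 2 * ‖(partialDeriv i χ x : ℂ) * u x‖ ^ 2 := by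
        nlinarith [sq_nonneg (‖(χ x : ℂ) * weakPartial i u x‖ - ‖(partialDeriv i χ x : ℂ) * u x‖)]
    _ = _ := by simp [mul_pow]

lemma IsTestFunction.exists_bound (hχ : IsTestFunction χ) : ∃ C : ℝ, 0 ≤ C ∧ ∀ x, |χ x| ≤ C := by
  obtain ⟨C, hC⟩ := hχ.continuous.bounded_above_of_compact_support hχ.2
  exact ⟨C, (abs_nonneg _).trans (hC 0), hC⟩

lemma exists_gradEnergy_mul_test_le (hχ : IsTestFunction χ) :
    ∃ C : ℝ, 0 ≤ C ∧ ∀ u : Plane → ℂ, MemH1 u →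
      gradEnergy (fun x => (χ x : ℂ) * u x) ≤ C * (mass u + gradEnergy u) := by
  obtain ⟨C₀, h00, h0⟩ := hχ.exists_bound
  choose D hD0 hD using fun i => (hχ.partialDeriv i).exists_bound
  refine ⟨2 * C₀ ^ 2 + ∑ i, 2 * D i ^ 2, by positivity, fun u hu => ?_⟩
  refine (hu.gradEnergy_mul_test_le hχ).trans ?_
  have hb : ∀ (a : Plane → ℝ) (A : ℝ) (f : Plane → ℂ), MemLp f 2 volume → (∀ x, |a x| ≤ A) →
      ∫ x, a x ^ 2 * ‖f x‖ ^ 2 ≤ A ^ 2 * mass f := fun a A f hf ha => by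
    rw [mass, ← integral_const_mul]
    refine integral_mono_of_nonneg (Eventually.of_forall fun x => by positivity)
      ((integrable_norm_sq hf).const_mul _) (Eventually.of_forall fun x => ?_)
    have : a x ^ 2 ≤ A ^ 2 := by
      rw [← sq_abs (a x)]; exact pow_le_pow_left₀ (abs_nonneg _) (ha x) 2
    exact mul_le_mul_of_nonneg_right this (by positivity)
  calc _ ≤ ∑ i, (2 * (C₀ ^ 2 * mass (weakPartial i u)) + 2 * (D i ^ 2 * mass u)) := by
        refine Finset.sum_le_sum fun i _ => ?_
        have h1 := hb χ C₀ _ (memLp_weakPartial i u) h0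
        have h2 := hb _ _ _ hu.1 (hD i)
        linarith
    _ = 2 * C₀ ^ 2 * gradEnergy u + (∑ i, 2 * D i ^ 2) * mass u := by
        rw [gradEnergy_eq, Finset.sum_add_distrib, Finset.mul_sum, Finset.sum_mul]
        congr 1 <;> exact Finset.sum_congr rfl fun i _ => by ring
    _ ≤ _ := by
        have h1 := mass_nonneg u
        have h2 := gradEnergy_nonneg u
        have h3 : 0 ≤ ∑ i, 2 * D i ^ 2 := by positivity
        have h4 : 0 ≤ 2 * C₀ ^ 2 := by positivity
        nlinarith [mul_nonneg h3 h2, mul_nonneg h4 h1]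

/-- The `L⁴` norm is controlled by the local masses. -/
lemma exists_quartic_le_of_local_mass_le (hχ : IsTestFunction χ) (hχ0 : 0 < ∫ x, χ x ^ 4) :
    ∃ C : ℝ, 0 < C ∧ ∀ u : Plane → ℂ, MemH1 u → ∀ s : ℝ,
      (∀ y, mass (fun x => (χ x : ℂ) * u (x + y)) ≤ s) →
      quartic u ≤ C * s * (mass u + gradEnergy u) := by
  set a := ∫ x, χ x ^ 2
  set D : Fin 2 → ℝ := fun i => ∫ x, partialDeriv i χ x ^ 2
  have ha0 : 0 ≤ a := integral_nonneg fun x => by positivity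
  have hD0 : ∀ i, 0 ≤ D i := fun i => integral_nonneg fun x => by positivity
  have hl := ladyConst_pos
  set c := 2 * a + ∑ i, 2 * D i + 1
  have hS0 : 0 ≤ ∑ i, 2 * D i := Finset.sum_nonneg fun i _ => by have := hD0 i; positivity
  have hc0 : 0 < c := by positivity
  refine ⟨ladyConst * c / ∫ x, χ x ^ 4, by positivity, fun u hu s hs => ?_⟩
  have hs0 : 0 ≤ s := (mass_nonneg _).trans (hs 0)
  have hm := mass_nonneg u
  have hgr := gradEnergy_nonneg u
  have q := integrable_and_integral_cross (hχ.sq_integrable 4 (by norm_num)) hu.integrable_quartic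
  have g1 := fun i => integrable_and_integral_cross (hχ.sq_integrable 2 (by norm_num))
    (integrable_norm_sq_weakPartial i u)
  have g2 := fun i => integrable_and_integral_cross
    ((hχ.partialDeriv i).sq_integrable 2 (by norm_num)) (integrable_norm_sq hu.1)
  -- Ladyzhenskaya's inequality for $\chi\,u(\cdot+y)$, with its mass factor bounded by $s$. What
  -- remains is linear in $|u|^2$ and $|\nabla u|^2$, hence integrable in $y$.
  have hpt : ∀ y, ∫ x, χ x ^ 4 * ‖u (x + y)‖ ^ 4 ≤ ladyConst * s *
      ∑ i, (2 * (∫ x, χ x ^ 2 * ‖weakPartial i u (x + y)‖ ^ 2) +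
        2 * ∫ x, partialDeriv i χ x ^ 2 * ‖u (x + y)‖ ^ 2) := fun y => by
    have hy := hu.comp_add y
    have h1 := (hy.mul_test hχ).quartic_le
    have h2 := hy.gradEnergy_mul_test_le hχ
    have e1 : quartic (fun x => (χ x : ℂ) * u (x + y)) = ∫ x, χ x ^ 4 * ‖u (x + y)‖ ^ 4 := by
      unfold quartic
      congr 1; ext x
      rw [norm_mul, mul_pow, Complex.norm_real, Real.norm_eq_abs, Even.pow_abs (by decide)]
    have e2 : ∀ i, ∫ x, χ x ^ 2 * ‖weakPartial i (fun x => u (x + y)) x‖ ^ 2 =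
        ∫ x, χ x ^ 2 * ‖weakPartial i u (x + y)‖ ^ 2 := fun i => integral_congr_ae (by
      filter_upwards [weakPartial_comp_add hu y i] with x hx; rw [hx])
    simp only [e2] at h2
    rw [e1] at h1
    refine h1.trans ?_
    have := gradEnergy_nonneg (fun x => (χ x : ℂ) * u (x + y))
    calc _ ≤ ladyConst * s * gradEnergy (fun x => (χ x : ℂ) * u (x + y)) := by
          have := hs y
          gcongr
      _ ≤ _ := by gcongr
  have gi : ∀ i, Integrable fun y => 2 * (∫ x, χ x ^ 2 * ‖weakPartial i u (x + y)‖ ^ 2) +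
      2 * ∫ x, partialDeriv i χ x ^ 2 * ‖u (x + y)‖ ^ 2 := fun i =>
    ((g1 i).1.const_mul 2).add ((g2 i).1.const_mul 2)
  have hint := integral_mono q.1 ((integrable_finsetSum Finset.univ fun i _ => gi i).const_mul
    (ladyConst * s)) hpt
  have hrhs : ∫ y, ladyConst * s *
      ∑ i, (2 * (∫ x, χ x ^ 2 * ‖weakPartial i u (x + y)‖ ^ 2) +
        2 * ∫ x, partialDeriv i χ x ^ 2 * ‖u (x + y)‖ ^ 2) =
      ladyConst * s * (2 * a * gradEnergy u + (∑ i, 2 * D i) * mass u) := by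
    rw [integral_const_mul, integral_finsetSum _ fun i _ => gi i]
    congr 1
    rw [gradEnergy_eq, Finset.mul_sum, Finset.sum_mul, ← Finset.sum_add_distrib]
    refine Finset.sum_congr rfl fun i _ => ?_
    rw [integral_add ((g1 i).1.const_mul 2) ((g2 i).1.const_mul 2), integral_const_mul,
      integral_const_mul, (g1 i).2, (g2 i).2]
    simp only [a, D, mass]; ring
  rw [hrhs, q.2] at hint
  have hle : 2 * a * gradEnergy u + (∑ i, 2 * D i) * mass u ≤ c * (mass u + gradEnergy u) := by
    simp only [c]
    nlinarith [mul_nonneg hS0 hgr, mul_nonneg ha0 hm]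
  calc quartic u = (∫ x, χ x ^ 4) * quartic u / ∫ x, χ x ^ 4 := by field_simp
    _ ≤ (ladyConst * s * (c * (mass u + gradEnergy u))) / ∫ x, χ x ^ 4 := by
        have hl := ladyConst_pos
        exact div_le_div_of_nonneg_right (hint.trans (by gcongr)) (by positivity)
    _ = _ := by ring

end Localization

/-! ### Local compactness, proved on the Fourier side. -/

section Rellich

variable {v : ℕ → Plane → ℂ} {χ : Plane → ℝ} {R : ℝ}

/-- **Rellich's theorem**: weak convergence in `H¹` implies local strong convergence in `L²`. -/
lemma tendsto_mass_mul_test (hv : ∀ n, MemH1 (v n)) (hm : ∀ n, mass (v n) ≤ R)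
    (hg : ∀ n, gradEnergy (v n) ≤ R) (hw : WeakTendsto v 0) (hχ : IsTestFunction χ) :
    Tendsto (fun n => mass (fun x => (χ x : ℂ) * v n x)) atTop (𝓝 0) := by
  obtain ⟨C, hC0, hC⟩ := exists_gradEnergy_mul_test_le hχ
  have hR0 : 0 ≤ R := (mass_nonneg _).trans (hm 0)
  set w : ℕ → Plane → ℂ := fun n x => (χ x : ℂ) * v n x
  have hwH : ∀ n, MemH1 (w n) := fun n => (hv n).mul_test hχ
  have hwi : ∀ n, Integrable (w n) := fun n => by
    have := integrable_mul_test (hv n).1 hχ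
    simpa only [w, mul_comm] using this
  have hgw : ∀ n, gradEnergy (w n) ≤ C * (R + R) := fun n =>
    (hC _ (hv n)).trans (by have := hm n; have := hg n; gcongr)
  have hF : ∀ n, FT (w n) =ᵐ[volume] 𝓕 (w n) := fun n => FT_eq_fourier (hwH n).1 (hwi n)
  -- At fixed $\xi$ the transform of $\chi v_n$ is the pairing of $v_n$ with a fixed $L^2$ function,
  -- so weak convergence gives pointwise convergence.
  have hpt : ∀ ξ, Tendsto (fun n => 𝓕 (w n) ξ) atTop (𝓝 0) := fun ξ => by
    have hg : MemLp (fun x : Plane => (Real.fourierChar (-inner ℝ x ξ) : ℂ) * (χ x : ℂ)) 2 volume := by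
      refine (hχ.memLp 2).mono ?_ (Eventually.of_forall fun x => ?_)
      · have := Real.continuous_fourierChar
        have h1 : Continuous fun x : Plane => (Real.fourierChar (-inner ℝ x ξ) : ℂ) := by fun_prop
        exact (h1.mul hχ.ofReal.1.continuous).aestronglyMeasurable
      · rw [norm_mul, Circle.norm_coe, one_mul]
    have h1 := hw _ hg
    simp only [Pi.zero_apply, zero_mul, integral_zero] at h1
    refine h1.congr fun n => ?_
    rw [Real.fourier_eq]
    congr 1; ext x
    rw [Circle.smul_def, smul_eq_mul]
    simp only [w]; ring
  set B := Real.sqrt (∫ x, χ x ^ 2) * Real.sqrt R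
  have hbd : ∀ n ξ, ‖𝓕 (w n) ξ‖ ≤ B := fun n ξ => by
    have h1 : ‖𝓕 (w n) ξ‖ ≤ ∫ x, ‖w n x‖ := by
      have := VectorFourier.norm_fourierIntegral_le_integral_norm Real.fourierChar
        (volume : Measure Plane) (innerₗ Plane) (w n) ξ
      exact this
    refine h1.trans ?_
    have h2 : ∫ x, ‖w n x‖ = ∫ x, |χ x| * ‖v n x‖ := by
      congr 1; ext x; simp [w]
    have hχm : MemLp (fun x => |χ x|) 2 volume := by
      have := (hχ.memLp 2).norm
      simpa using this
    have h3 := sq_integral_mul_le hχm (hv n).1.norm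
    simp only [sq_abs] at h3
    rw [h2]
    change _ ≤ Real.sqrt (∫ x, χ x ^ 2) * Real.sqrt R
    rw [← Real.sqrt_mul (integral_nonneg fun x => by positivity)]
    refine Real.le_sqrt_of_sq_le (h3.trans ?_)
    have : ∫ x, ‖v n x‖ ^ 2 ≤ R := hm n
    have h0 : 0 ≤ ∫ x, χ x ^ 2 := integral_nonneg fun x => by positivity
    gcongr
  -- Low frequencies: bounded convergence on a ball.
  have hball : ∀ T : ℝ, Tendsto (fun n => ∫ ξ in Metric.closedBall (0 : Plane) T, ‖𝓕 (w n) ξ‖ ^ 2)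
      atTop (𝓝 0) := fun T => by
    have h0 : (0 : ℝ) = ∫ ξ in Metric.closedBall (0 : Plane) T, (0 : ℝ) := by simp
    rw [h0]
    have : IsFiniteMeasure ((volume : Measure Plane).restrict (Metric.closedBall 0 T)) :=
      ⟨by rw [Measure.restrict_apply_univ]; exact measure_closedBall_lt_top⟩
    apply tendsto_integral_of_dominated_convergence (fun _ => B ^ 2)
    · exact fun n => ((continuous_fourier (hwi n)).norm.pow 2).aestronglyMeasurable
    · exact integrable_const _
    · intro n
      filter_upwards with ξ
      rw [Real.norm_of_nonneg (by positivity)]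
      exact pow_le_pow_left₀ (norm_nonneg _) (hbd n ξ) 2
    · filter_upwards with ξ
      simpa using (hpt ξ).norm.pow 2
  -- High frequencies: for $|\xi|>T$ one has $1\le|\xi|^2/T^2$, and the gradient bound makes the
  -- tail uniformly small.
  have hsplit : ∀ (T : ℝ), 0 < T → ∀ n, mass (w n) ≤
      (∫ ξ in Metric.closedBall (0 : Plane) T, ‖𝓕 (w n) ξ‖ ^ 2) + C * (R + R) / T ^ 2 := by
    intro T hT n
    have hcoord := fun i => integrable_coord_sq_mul ((hwH n).memLp_coord_mul_FT i)
    have hxi : Integrable fun ξ : Plane => ‖ξ‖ ^ 2 * ‖FT (w n) ξ‖ ^ 2 := by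
      refine ((hcoord 0).add (hcoord 1)).congr (Eventually.of_forall fun ξ => ?_)
      simp only [Pi.add_apply]
      rw [EuclideanSpace.norm_sq_eq, Fin.sum_univ_two, Real.norm_eq_abs, Real.norm_eq_abs, sq_abs,
        sq_abs]; ring
    have hxg : ∫ ξ : Plane, ‖ξ‖ ^ 2 * ‖FT (w n) ξ‖ ^ 2 ≤ gradEnergy (w n) := by
      have e : ∫ ξ : Plane, ‖ξ‖ ^ 2 * ‖FT (w n) ξ‖ ^ 2 =
          ∑ i, ∫ ξ : Plane, ξ i ^ 2 * ‖FT (w n) ξ‖ ^ 2 := by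
        rw [← integral_finsetSum _ fun i _ => hcoord i]
        congr 1; ext ξ
        rw [EuclideanSpace.norm_sq_eq, Finset.sum_mul]
        simp
      rw [e, gradEnergy_eq]
      refine Finset.sum_le_sum fun i _ => ?_
      rw [(hwH n).mass_weakPartial]
      have h1 : 0 ≤ ∫ ξ : Plane, ξ i ^ 2 * ‖FT (w n) ξ‖ ^ 2 :=
        integral_nonneg fun ξ => by positivity
      have h2 : (1 : ℝ) ≤ (2 * Real.pi) ^ 2 := by nlinarith [Real.pi_gt_three]
      nlinarith
    have hFi := integrable_norm_sq (memLp_FT (w n))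
    have e1 : ∫ ξ in Metric.closedBall (0 : Plane) T, ‖𝓕 (w n) ξ‖ ^ 2 =
        ∫ ξ, (Metric.closedBall (0 : Plane) T).indicator (fun ξ => ‖FT (w n) ξ‖ ^ 2) ξ := by
      rw [integral_indicator Metric.isClosed_closedBall.measurableSet]
      refine integral_congr_ae (ae_restrict_of_ae ?_)
      filter_upwards [hF n] with ξ hξ
      rw [hξ]
    rw [← mass_FT (hwH n).1, e1]
    have i1 : Integrable ((Metric.closedBall (0 : Plane) T).indicator
        (fun ξ => ‖FT (w n) ξ‖ ^ 2)) := hFi.indicator Metric.isClosed_closedBall.measurableSet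
    have i2 := hxi.const_mul (T ^ 2)⁻¹
    calc mass (FT (w n)) ≤ ∫ ξ, ((Metric.closedBall (0 : Plane) T).indicator
          (fun ξ => ‖FT (w n) ξ‖ ^ 2) ξ + (T ^ 2)⁻¹ * (‖ξ‖ ^ 2 * ‖FT (w n) ξ‖ ^ 2)) := by
          refine integral_mono hFi (i1.add i2) fun ξ => ?_
          by_cases hξ : ξ ∈ Metric.closedBall (0 : Plane) T
          · simp only [Set.indicator_of_mem hξ]
            have : 0 ≤ (T ^ 2)⁻¹ * (‖ξ‖ ^ 2 * ‖FT (w n) ξ‖ ^ 2) := by positivity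
            linarith
          · simp only [Set.indicator_of_notMem hξ, zero_add]
            rw [mem_closedBall_zero_iff, not_le] at hξ
            have h1 : 1 ≤ (T ^ 2)⁻¹ * ‖ξ‖ ^ 2 := by
              rw [inv_mul_eq_div, one_le_div (by positivity)]
              gcongr
            rw [← mul_assoc]
            exact le_mul_of_one_le_left (by positivity) h1
      _ = _ := integral_add i1 i2
      _ ≤ _ := by
          rw [integral_const_mul, div_eq_inv_mul]
          gcongr
          exact hxg.trans (hgw n)
  rw [Metric.tendsto_atTop]
  intro ε hε
  set T := Real.sqrt (2 * (C * (R + R) + 1) / ε)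
  have hT2 : T ^ 2 = 2 * (C * (R + R) + 1) / ε := Real.sq_sqrt (by positivity)
  have hT : 0 < T := Real.sqrt_pos.2 (by positivity)
  obtain ⟨N, hN⟩ := Metric.tendsto_atTop.1 (hball T) (ε / 2) (by positivity)
  refine ⟨N, fun n hn => ?_⟩
  have h1 := hN n hn
  have h2 := hsplit T hT n
  rw [Real.dist_eq, sub_zero] at h1 ⊢
  rw [abs_of_nonneg (mass_nonneg _)]
  have h3 : C * (R + R) / T ^ 2 < ε / 2 := by
    rw [hT2, div_div_eq_mul_div, div_lt_iff₀ (by positivity)]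
    nlinarith
  have h4 := le_abs_self (∫ ξ in Metric.closedBall (0 : Plane) T, ‖𝓕 (w n) ξ‖ ^ 2)
  change mass (w n) < ε
  linarith

end Rellich

/-! ### Expanding mass, gradient, nonlocal and power terms at a sum. -/

section Expansions

variable {u v f g : Plane → ℂ}

/-- The real inner product of `L²`. -/
def dot (f g : Plane → ℂ) : ℝ := ∫ x, (f x * conj (g x)).re

lemma integrable_dot (hf : MemLp f 2 volume) (hg : MemLp g 2 volume) :
    Integrable fun x => (f x * conj (g x)).re := (integrable_mul_conj hf hg).re

lemma mass_add (hf : MemLp f 2 volume) (hg : MemLp g 2 volume) :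
    mass (fun x => f x + g x) = mass f + 2 * dot f g + mass g := by
  unfold mass dot
  rw [← integral_const_mul, ← integral_add (integrable_norm_sq hf) ((integrable_dot hf hg).const_mul 2),
    ← integral_add _ (integrable_norm_sq hg)]
  · congr 1; ext x
    rw [← Complex.normSq_eq_norm_sq, ← Complex.normSq_eq_norm_sq, ← Complex.normSq_eq_norm_sq,
      Complex.normSq_add]
    ring
  · exact (integrable_norm_sq hf).add ((integrable_dot hf hg).const_mul 2)

lemma abs_dot_le (hf : MemLp f 2 volume) (hg : MemLp g 2 volume) :
    |dot f g| ≤ Real.sqrt (mass f) * Real.sqrt (mass g) := by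
  rw [← Real.sqrt_mul (mass_nonneg f)]
  refine Real.le_sqrt_of_sq_le ?_
  have h1 := sq_integral_mul_le hf.norm hg.norm
  refine le_trans ?_ h1
  have h2 : |dot f g| ≤ ∫ x, ‖f x‖ * ‖g x‖ := by
    rw [← Real.norm_eq_abs]
    refine norm_integral_le_of_norm_le (hf.norm.integrable_mul hg.norm)
      (Eventually.of_forall fun x => ?_)
    rw [Real.norm_eq_abs]
    refine (Complex.abs_re_le_norm _).trans ?_
    simp
  gcongr

/-- The polarization of `∫ |∇u|²`. -/
def gradDot (u v : Plane → ℂ) : ℝ := ∑ i, dot (weakPartial i u) (weakPartial i v)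

lemma gradEnergy_add (hu : MemH1 u) (hv : MemH1 v) :
    gradEnergy (fun x => u x + v x) = gradEnergy u + 2 * gradDot u v + gradEnergy v := by
  simp only [gradEnergy_eq, gradDot, Finset.mul_sum, ← Finset.sum_add_distrib]
  refine Finset.sum_congr rfl fun i _ => ?_
  rw [mass_congr (weakPartial_add hu hv i), mass_add (memLp_weakPartial i u) (memLp_weakPartial i v)]

/-- The polarization `2 Re (u v̄)` of `|u|²`, as a complex valued function. -/
def absCross (u v : Plane → ℂ) (x : Plane) : ℂ := ((2 * (u x * conj (v x)).re : ℝ) : ℂ)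

lemma absSq_add (u v : Plane → ℂ) :
    absSq (fun x => u x + v x) = fun x => absSq u x + (absCross u v x + absSq v x) := by
  ext x
  simp only [absSq, absCross]
  rw [← Complex.ofReal_add, ← Complex.ofReal_add, ← Complex.normSq_eq_norm_sq,
    ← Complex.normSq_eq_norm_sq, ← Complex.normSq_eq_norm_sq, Complex.normSq_add]
  congr 1; ring

lemma norm_absCross_le (u v : Plane → ℂ) (x : Plane) : ‖absCross u v x‖ ≤ 2 * (‖u x‖ * ‖v x‖) := by
  rw [absCross, Complex.norm_real, Real.norm_eq_abs, abs_mul, abs_two]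
  gcongr
  refine (Complex.abs_re_le_norm _).trans ?_
  simp

lemma MemH1.memLp_absCross (hu : MemH1 u) (hv : MemH1 v) : MemLp (absCross u v) 2 volume := by
  refine ((hu.memLp_mul hv).const_mul 2).mono ?_ (Eventually.of_forall fun x => ?_)
  · refine Complex.continuous_ofReal.comp_aestronglyMeasurable (AEStronglyMeasurable.const_mul ?_ 2)
    exact Complex.continuous_re.comp_aestronglyMeasurable
      (hu.1.1.mul (Complex.continuous_conj.comp_aestronglyMeasurable hv.1.1))
  · rw [Real.norm_of_nonneg (by positivity)]
    exact norm_absCross_le u v x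

lemma mass_absCross_le (hu : MemH1 u) (hv : MemH1 v) :
    mass (absCross u v) ≤ 4 * ∫ x, (‖u x‖ * ‖v x‖) ^ 2 := by
  unfold mass
  rw [← integral_const_mul]
  refine integral_mono (integrable_norm_sq (hu.memLp_absCross hv))
    ((hu.memLp_mul hv).integrable_sq.const_mul 4) fun x => ?_
  have := norm_absCross_le u v x
  calc ‖absCross u v x‖ ^ 2 ≤ (2 * (‖u x‖ * ‖v x‖)) ^ 2 := by gcongr
    _ = _ := by ring

lemma nonlocalEnergy_add (hu : MemH1 u) (hv : MemH1 v) :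
    nonlocalEnergy (fun x => u x + v x) = nonlocalEnergy u + 2 * nlForm (absSq u) (absCross u v)
      + (2 * nlForm (absSq u) (absSq v) + nlForm (absCross u v) (absCross u v)
      + 2 * nlForm (absCross u v) (absSq v) + nonlocalEnergy v) := by
  have hr := hu.memLp_absCross hv
  have ha := hu.memLp_absSq
  have hb := hv.memLp_absSq
  have hrb : MemLp (fun x => absCross u v x + absSq v x) 2 volume := hr.add hb
  rw [(hu.add hv).nonlocalEnergy_eq, hu.nonlocalEnergy_eq, hv.nonlocalEnergy_eq, absSq_add,
    nlForm_add_left ha hrb, nlForm_add_right ha hrb, nlForm_add_right hr hb,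
    nlForm_add_left hr hb, nlForm_add_right ha hrb, nlForm_add_right ha hrb,
    nlForm_add_right hr hb, nlForm_add_right hr hb, nlForm_comm (absCross u v) (absSq u),
    nlForm_comm (absSq v) (absSq u), nlForm_comm (absSq v) (absCross u v)]
  ring

/-- The mean value estimate for powers. -/
lemma abs_rpow_sub_rpow_le {q s t : ℝ} (hq : 1 ≤ q) (hs : 0 ≤ s) (ht : 0 ≤ t) :
    |s ^ q - t ^ q| ≤ q * max s t ^ (q - 1) * |s - t| := by
  have h := (convex_Icc 0 (max s t)).norm_image_sub_le_of_norm_hasDerivWithin_le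
    (f := fun y : ℝ => y ^ q) (f' := fun y => q * y ^ (q - 1)) (C := q * max s t ^ (q - 1))
    (x := t) (y := s)
    (fun y _ => (Real.hasDerivAt_rpow_const (Or.inr hq)).hasDerivWithinAt) (fun y hy => by
      have h0 : 0 ≤ y ^ (q - 1) := Real.rpow_nonneg hy.1 _
      rw [Real.norm_of_nonneg (by positivity)]
      have := Real.rpow_le_rpow hy.1 hy.2 (by linarith : 0 ≤ q - 1)
      gcongr) ⟨ht, le_max_right _ _⟩ ⟨hs, le_max_left _ _⟩
  simpa only [Real.norm_eq_abs] using h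

lemma rpow_le_one_add_sq {p : ℝ} (hp : 1 < p) (hp' : p < 3) {s : ℝ} (hs : 0 ≤ s) :
    s ^ (p - 1) ≤ 1 + s ^ 2 := by
  rcases le_total s 1 with h | h
  · have := Real.rpow_le_one hs h (by linarith : 0 ≤ p - 1)
    nlinarith
  · have := Real.rpow_le_rpow_of_exponent_le h (by linarith : p - 1 ≤ 2)
    rw [Real.rpow_two] at this
    linarith

/-- A quantitative Brezis–Lieb inequality: every term on the right contains both $|a|$ and $|b|$. By
symmetry let $|a|\le|b|$. The mean value theorem leaves a multiple of $|a||b|^p$, and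
$|b|^{p-1}\le1+|b|^2$. -/
lemma exists_abs_norm_rpow_add_sub_le {p : ℝ} (hp : 1 < p) (hp' : p < 3) :
    ∃ C : ℝ, 0 < C ∧ ∀ a b : ℂ, |‖a + b‖ ^ (p + 1) - ‖a‖ ^ (p + 1) - ‖b‖ ^ (p + 1)| ≤
      C * (‖a‖ * ‖b‖ + ‖a‖ ^ 2 * (‖a‖ * ‖b‖) + ‖a‖ * ‖b‖ * ‖b‖ ^ 2) := by
  have key : ∀ a b : ℂ, ‖a‖ ≤ ‖b‖ → |‖a + b‖ ^ (p + 1) - ‖a‖ ^ (p + 1) - ‖b‖ ^ (p + 1)| ≤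
      ((p + 1) * 2 ^ p + 1) * (‖a‖ * ‖b‖ + ‖a‖ * ‖b‖ * ‖b‖ ^ 2) := fun a b hab => by
    have h1 := abs_rpow_sub_rpow_le (q := p + 1) (by linarith) (norm_nonneg (a + b)) (norm_nonneg b)
    have h2 : max ‖a + b‖ ‖b‖ ≤ 2 * ‖b‖ :=
      max_le ((norm_add_le a b).trans (by linarith)) (by linarith [norm_nonneg b])
    have h3 : |‖a + b‖ - ‖b‖| ≤ ‖a‖ := by simpa using abs_norm_sub_norm_le (a + b) b
    have e1 : p + 1 - 1 = p := by ring
    rw [e1] at h1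
    have h4 : max ‖a + b‖ ‖b‖ ^ p ≤ 2 ^ p * ‖b‖ ^ p := by
      rw [← Real.mul_rpow (by norm_num) (norm_nonneg b)]
      exact Real.rpow_le_rpow (le_max_of_le_right (norm_nonneg b)) h2 (by linarith)
    have h5 : ‖a‖ ^ (p + 1) ≤ ‖a‖ * ‖b‖ ^ p := by
      rw [Real.rpow_add_one' (norm_nonneg a) (by linarith), mul_comm]
      have := Real.rpow_le_rpow (norm_nonneg a) hab (by linarith : 0 ≤ p)
      gcongr
    have h6 : ‖b‖ ^ p ≤ ‖b‖ + ‖b‖ * ‖b‖ ^ 2 := by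
      have e : ‖b‖ ^ p = ‖b‖ * ‖b‖ ^ (p - 1) := by
        rw [mul_comm, ← Real.rpow_add_one' (norm_nonneg b) (by linarith)]; ring_nf
      rw [e]
      have h7 := rpow_le_one_add_sq hp hp' (norm_nonneg b)
      calc ‖b‖ * ‖b‖ ^ (p - 1) ≤ ‖b‖ * (1 + ‖b‖ ^ 2) := by gcongr
        _ = _ := by ring
    have e2 : ‖a + b‖ ^ (p + 1) - ‖a‖ ^ (p + 1) - ‖b‖ ^ (p + 1) =
      (‖a + b‖ ^ (p + 1) - ‖b‖ ^ (p + 1)) - ‖a‖ ^ (p + 1) := by ring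
    rw [e2]
    refine (abs_sub _ _).trans ?_
    rw [abs_of_nonneg (a := ‖a‖ ^ (p + 1)) (by positivity)]
    calc _ ≤ (p + 1) * (2 ^ p * ‖b‖ ^ p) * ‖a‖ + ‖a‖ * ‖b‖ ^ p := by
          refine add_le_add (h1.trans ?_) h5
          gcongr
      _ = ((p + 1) * 2 ^ p + 1) * (‖a‖ * ‖b‖ ^ p) := by ring
      _ ≤ ((p + 1) * 2 ^ p + 1) * (‖a‖ * (‖b‖ + ‖b‖ * ‖b‖ ^ 2)) := by gcongr
      _ = _ := by ring
  refine ⟨(p + 1) * 2 ^ p + 1, by positivity, fun a b => ?_⟩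
  rcases le_total ‖a‖ ‖b‖ with h | h
  · refine (key a b h).trans ?_
    have : 0 ≤ ‖a‖ ^ 2 * (‖a‖ * ‖b‖) := by positivity
    gcongr
    linarith
  · have := key b a h
    rw [add_comm b a, sub_right_comm] at this
    refine this.trans ?_
    have : 0 ≤ ‖a‖ * ‖b‖ * ‖b‖ ^ 2 := by positivity
    refine mul_le_mul_of_nonneg_left ?_ (by positivity)
    nlinarith

end Expansions

/-! ### Asymptotic decoupling of a fixed function and a weakly null sequence. -/

section Splitting

variable {v : ℕ → Plane → ℂ} {R : ℝ}

lemma integral_mul_le_sqrt {f g : Plane → ℝ} (hf : MemLp f 2 volume) (hg : MemLp g 2 volume) :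
    ∫ x, f x * g x ≤ Real.sqrt (∫ x, f x ^ 2) * Real.sqrt (∫ x, g x ^ 2) := by
  rw [← Real.sqrt_mul (integral_nonneg fun x => by positivity)]
  exact Real.le_sqrt_of_sq_le (sq_integral_mul_le hf hg)

lemma tendsto_dot {f : Plane → ℂ} {g : ℕ → Plane → ℂ} (hf : MemLp f 2 volume)
    (hg' : ∀ n, MemLp (g n) 2 volume) (hgw : WeakTendsto g 0) :
    Tendsto (fun n => dot f (g n)) atTop (𝓝 0) := by
  have h := hgw _ hf.star
  simp only [Pi.zero_apply, zero_mul, integral_zero] at h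
  have h2 := (Complex.continuous_re.tendsto 0).comp h
  refine h2.congr fun n => ?_
  have := integral_re (𝕜 := ℂ) ((hg' n).integrable_mul hf.star)
  unfold dot
  simp only [Function.comp]
  refine Eq.trans this.symm ?_
  congr 1; ext x
  simp only [Pi.mul_apply, Pi.star_apply, RCLike.re_eq_complex_re, RCLike.star_def]
  rw [← Complex.conj_re, map_mul, Complex.conj_conj, mul_comm]

/-- A bounded sequence of `L²` which tends to `0` locally also tends to `0` when integrated against
a fixed element of `L²`. -/
lemma tendsto_integral_mul_of_local {w : ℕ → Plane → ℝ} (hw : ∀ n, MemLp (w n) 2 volume) {K : ℝ}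
    (hK : ∀ n, ∫ x, w n x ^ 2 ≤ K)
    (hloc : ∀ k, Tendsto (fun n => ∫ x, cutoff k x ^ 4 * w n x ^ 2) atTop (𝓝 0))
    {f : Plane → ℝ} (hf : MemLp f 2 volume) :
    Tendsto (fun n => ∫ x, |f x| * |w n x|) atTop (𝓝 0) := by
  -- The tail of $f$ far out. It is small for large $k$ and is paired with the uniform bound on
  -- $w_n$, while the part inside the cutoff uses the local convergence.
  set T : ℕ → ℝ := fun k => ∫ x, ((1 - cutoff k x ^ 2) * |f x|) ^ 2 with hTdef
  have hc : ∀ k, Continuous (cutoff k) := fun k => (isTestFunction_cutoff k).continuous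
  have hc1 : ∀ k x, |cutoff k x ^ 2| ≤ 1 := fun k x => by
    rw [abs_of_nonneg (by positivity)]
    have := cutoff_nonneg k x; have := cutoff_le_one k x; nlinarith
  have hc2 : ∀ k x, |1 - cutoff k x ^ 2| ≤ 1 := fun k x => by
    have h0 := cutoff_nonneg k x; have h1 := cutoff_le_one k x
    rw [abs_of_nonneg (by nlinarith)]
    nlinarith
  have hfa : MemLp (fun x => |f x|) 2 volume := hf.abs
  have hwa : ∀ n, MemLp (fun x => |w n x|) 2 volume := fun n => (hw n).abs
  have hT : Tendsto T atTop (𝓝 0) := by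
    have h0 : (0 : ℝ) = ∫ x : Plane, (0 : ℝ) := by simp
    rw [h0]
    refine tendsto_integral_of_dominated_convergence (fun x => f x ^ 2) (fun k => ?_)
      hf.integrable_sq (fun k => Eventually.of_forall fun x => ?_)
      (Eventually.of_forall fun x => ?_)
    · have : Continuous fun x => 1 - cutoff k x ^ 2 := by have := hc k; fun_prop
      exact (this.aestronglyMeasurable.mul hfa.1).pow 2
    · rw [Real.norm_of_nonneg (by positivity), mul_pow, sq_abs]
      have h1 := hc2 k x
      have : (1 - cutoff k x ^ 2) ^ 2 ≤ 1 := by rw [← sq_abs]; nlinarith [abs_nonneg (1 - cutoff k x ^ 2)]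
      nlinarith [sq_nonneg (f x)]
    · have := ((((tendsto_cutoff x).pow 2).const_sub 1).mul_const |f x|).pow 2
      simpa using this
  have hfk : ∀ k, MemLp (fun x => (1 - cutoff k x ^ 2) * |f x|) 2 volume := fun k => by
    refine hfa.mono ?_ (Eventually.of_forall fun x => ?_)
    · have : Continuous fun x => 1 - cutoff k x ^ 2 := by have := hc k; fun_prop
      exact this.aestronglyMeasurable.mul hfa.1
    · rw [norm_mul, Real.norm_eq_abs]
      exact mul_le_of_le_one_left (norm_nonneg _) (hc2 k x)
  have hwk : ∀ k n, MemLp (fun x => cutoff k x ^ 2 * |w n x|) 2 volume := fun k n => by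
    refine (hwa n).mono ?_ (Eventually.of_forall fun x => ?_)
    · have : Continuous fun x => cutoff k x ^ 2 := by have := hc k; fun_prop
      exact this.aestronglyMeasurable.mul (hwa n).1
    · rw [norm_mul, Real.norm_eq_abs]
      exact mul_le_of_le_one_left (norm_nonneg _) (hc1 k x)
  have hbd : ∀ k n, ∫ x, |f x| * |w n x| ≤ Real.sqrt (∫ x, f x ^ 2) *
      Real.sqrt (∫ x, cutoff k x ^ 4 * w n x ^ 2) + Real.sqrt (T k) * Real.sqrt K := fun k n => by
    have h1 := integral_mul_le_sqrt hfa (hwk k n)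
    have h2 := integral_mul_le_sqrt (hfk k) (hwa n)
    have i1 : Integrable fun x => |f x| * (cutoff k x ^ 2 * |w n x|) := hfa.integrable_mul (hwk k n)
    have i2 : Integrable fun x => (1 - cutoff k x ^ 2) * |f x| * |w n x| :=
      (hfk k).integrable_mul (hwa n)
    simp only [mul_pow, sq_abs, ← pow_mul, Nat.reduceMul] at h1
    calc ∫ x, |f x| * |w n x| = (∫ x, |f x| * (cutoff k x ^ 2 * |w n x|)) +
          ∫ x, (1 - cutoff k x ^ 2) * |f x| * |w n x| := by
          rw [← integral_add i1 i2]; congr 1; ext x; ring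
      _ ≤ _ := by
          refine add_le_add h1 (h2.trans ?_)
          simp only [sq_abs]
          gcongr
          exact hK n
  have hTs : Tendsto (fun k => Real.sqrt (T k) * Real.sqrt K) atTop (𝓝 0) := by
    simpa using (hT.sqrt).mul_const (Real.sqrt K)
  rw [Metric.tendsto_atTop]
  intro ε hε
  obtain ⟨k, hk⟩ := ((hTs.eventually (gt_mem_nhds (half_pos hε)))).exists
  have h3 : Tendsto (fun n => Real.sqrt (∫ x, f x ^ 2) *
      Real.sqrt (∫ x, cutoff k x ^ 4 * w n x ^ 2)) atTop (𝓝 0) := by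
    simpa using ((hloc k).sqrt).const_mul (Real.sqrt (∫ x, f x ^ 2))
  obtain ⟨N, hN⟩ := eventually_atTop.1 (h3.eventually (gt_mem_nhds (half_pos hε)))
  refine ⟨N, fun n hn => ?_⟩
  rw [Real.dist_eq, sub_zero, abs_of_nonneg (integral_nonneg fun x => by positivity)]
  linarith [hbd k n, hN n hn]

variable (hv : ∀ n, MemH1 (v n)) (hm : ∀ n, mass (v n) ≤ R)
    (hg : ∀ n, gradEnergy (v n) ≤ R) (hw : WeakTendsto v 0)

include hv hm hg in
lemma quartic_le_of_le (n : ℕ) : quartic (v n) ≤ ladyConst * R * R := by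
  have := ladyConst_pos
  have hR0 : 0 ≤ R := (mass_nonneg _).trans (hm 0)
  have := gradEnergy_nonneg (v n)
  have := hm n
  have := hg n
  exact (hv n).quartic_le.trans (by gcongr)

include hv hm hg hw

lemma tendsto_integral_mul_norm {f : Plane → ℝ} (hf : MemLp f 2 volume) :
    Tendsto (fun n => ∫ x, |f x| * ‖v n x‖) atTop (𝓝 0) := by
  have h := tendsto_integral_mul_of_local (w := fun n x => ‖v n x‖) (fun n => (hv n).1.norm) (K := R)
    hm (fun k => ?_) hf
  · simpa only [abs_norm] using h
  · have h1 := tendsto_mass_mul_test hv hm hg hw (isTestFunction_cutoff k)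
    refine squeeze_zero (fun n => integral_nonneg fun x => by positivity) (fun n => ?_) h1
    have i1 := integrable_norm_sq (MemLp.mul_test (hv n).1 (isTestFunction_cutoff k))
    have hle : ∀ x, cutoff k x ^ 4 * ‖v n x‖ ^ 2 ≤ ‖(cutoff k x : ℂ) * v n x‖ ^ 2 := fun x => by
      rw [norm_mul, mul_pow, Complex.norm_real, Real.norm_eq_abs, sq_abs]
      have h0 := cutoff_nonneg k x
      have := pow_le_pow_of_le_one h0 (cutoff_le_one k x) (by norm_num : 2 ≤ 4)
      gcongr
    exact integral_mono_of_nonneg (Eventually.of_forall fun x => by positivity) i1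
      (Eventually.of_forall hle)

/-- Ladyzhenskaya's inequality for $\chi v_n$ upgrades the local $L^2$ convergence of $v_n$ to local
$L^4$ convergence, that is, local $L^2$ convergence of $|v_n|^2$. -/
lemma tendsto_integral_mul_norm_sq {f : Plane → ℝ} (hf : MemLp f 2 volume) :
    Tendsto (fun n => ∫ x, |f x| * ‖v n x‖ ^ 2) atTop (𝓝 0) := by
  have hq : ∀ n, MemLp (fun x => ‖v n x‖ ^ 2) 2 volume := fun n => by
    have := (hv n).memLp_mul (hv n)
    simpa only [sq] using this
  have h := tendsto_integral_mul_of_local (w := fun n x => ‖v n x‖ ^ 2) hq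
    (K := ladyConst * R * R) (fun n => ?_) (fun k => ?_) hf
  · refine h.congr fun n => ?_
    congr 1; ext x
    rw [abs_of_nonneg (a := ‖v n x‖ ^ 2) (by positivity)]
  · refine le_trans (le_of_eq ?_) (quartic_le_of_le hv hm hg n)
    unfold quartic; congr 1; ext x; ring
  · have hχ := isTestFunction_cutoff k
    have h1 := tendsto_mass_mul_test hv hm hg hw hχ
    obtain ⟨C, hC0, hC⟩ := exists_gradEnergy_mul_test_le hχ
    have h2 : Tendsto (fun n => ladyConst * mass (fun x => (cutoff k x : ℂ) * v n x) *
        (C * (R + R))) atTop (𝓝 0) := by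
      simpa using (h1.const_mul ladyConst).mul_const (C * (R + R))
    refine squeeze_zero (fun n => integral_nonneg fun x => by positivity) (fun n => ?_) h2
    have h3 := ((hv n).mul_test hχ).quartic_le
    have e : quartic (fun x => (cutoff k x : ℂ) * v n x) =
        ∫ x, cutoff k x ^ 4 * (‖v n x‖ ^ 2) ^ 2 := by
      unfold quartic; congr 1; ext x
      rw [norm_mul, Complex.norm_real, Real.norm_of_nonneg (cutoff_nonneg k x)]; ring
    rw [← e]
    refine h3.trans ?_
    have := ladyConst_pos
    have := mass_nonneg (fun x => (cutoff k x : ℂ) * v n x)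
    have h4 := hC _ (hv n)
    have := hm n
    have := hg n
    gcongr
    exact h4.trans (by gcongr)

lemma tendsto_integral_sq_mul {u : Plane → ℂ} (hu : MemH1 u) :
    Tendsto (fun n => ∫ x, (‖u x‖ * ‖v n x‖) ^ 2) atTop (𝓝 0) := by
  have hq : MemLp (fun x => ‖u x‖ ^ 2) 2 volume := by
    have := hu.memLp_mul hu
    simpa only [sq] using this
  refine (tendsto_integral_mul_norm_sq hv hm hg hw hq).congr fun n => ?_
  congr 1; ext x
  rw [abs_of_nonneg (by positivity)]; ring

lemma tendsto_potential_sub {p : ℝ} (hp : 1 < p) (hp' : p < 3) {u : Plane → ℂ} (hu : MemH1 u) :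
    Tendsto (fun n => potential p (fun x => u x + v n x) - potential p u - potential p (v n))
      atTop (𝓝 0) := by
  obtain ⟨C, hC0, hC⟩ := exists_abs_norm_rpow_add_sub_le hp hp'
  have hX := tendsto_integral_sq_mul hv hm hg hw hu
  have h1 := tendsto_integral_mul_norm hv hm hg hw hu.1.norm
  simp only [abs_norm] at h1
  have hS := hX.sqrt
  rw [Real.sqrt_zero] at hS
  have hlim : Tendsto (fun n => C * ((∫ x, ‖u x‖ * ‖v n x‖) +
      Real.sqrt (quartic u) * Real.sqrt (∫ x, (‖u x‖ * ‖v n x‖) ^ 2) +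
      Real.sqrt (∫ x, (‖u x‖ * ‖v n x‖) ^ 2) * Real.sqrt (ladyConst * R * R))) atTop (𝓝 0) := by
    simpa using ((h1.add (hS.const_mul (Real.sqrt (quartic u)))).add
      (hS.mul_const (Real.sqrt (ladyConst * R * R)))).const_mul C
  have hsq : ∀ {w : Plane → ℂ}, MemH1 w → MemLp (fun x => ‖w x‖ ^ 2) 2 volume := fun {w} hw => by
    have := hw.memLp_mul hw
    simpa only [sq] using this
  have hq4 : ∀ w : Plane → ℂ, ∫ x, (‖w x‖ ^ 2) ^ 2 = quartic w := fun w => by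
    unfold quartic; congr 1; ext x; ring
  refine squeeze_zero_norm (fun n => ?_) hlim
  have i1 : Integrable fun x => ‖u x‖ * ‖v n x‖ := hu.1.norm.integrable_mul (hv n).1.norm
  have i2 : Integrable fun x => ‖u x‖ ^ 2 * (‖u x‖ * ‖v n x‖) :=
    (hsq hu).integrable_mul (hu.memLp_mul (hv n))
  have i3 : Integrable fun x => ‖u x‖ * ‖v n x‖ * ‖v n x‖ ^ 2 :=
    (hu.memLp_mul (hv n)).integrable_mul (hsq (hv n))
  have j1 := (hu.add (hv n)).integrable_potential hp hp'
  have j2 := hu.integrable_potential hp hp'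
  have j3 := (hv n).integrable_potential hp hp'
  have i12 : Integrable fun x => ‖u x‖ * ‖v n x‖ + ‖u x‖ ^ 2 * (‖u x‖ * ‖v n x‖) := i1.add i2
  have i123 : Integrable fun x => ‖u x‖ * ‖v n x‖ + ‖u x‖ ^ 2 * (‖u x‖ * ‖v n x‖) +
    ‖u x‖ * ‖v n x‖ * ‖v n x‖ ^ 2 := i12.add i3
  have j12 : Integrable fun x => ‖u x + v n x‖ ^ (p + 1) - ‖u x‖ ^ (p + 1) := j1.sub j2
  unfold potential
  rw [← integral_sub j1 j2, ← integral_sub j12 j3]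
  have h2 := integral_mul_le_sqrt (hsq hu) (hu.memLp_mul (hv n))
  have h3 := integral_mul_le_sqrt (hu.memLp_mul (hv n)) (hsq (hv n))
  rw [hq4] at h2 h3
  calc _ ≤ ∫ x, C * (‖u x‖ * ‖v n x‖ + ‖u x‖ ^ 2 * (‖u x‖ * ‖v n x‖) +
        ‖u x‖ * ‖v n x‖ * ‖v n x‖ ^ 2) :=
        norm_integral_le_of_norm_le (i123.const_mul C) (Eventually.of_forall fun x => hC _ _)
    _ = C * ((∫ x, ‖u x‖ * ‖v n x‖) + (∫ x, ‖u x‖ ^ 2 * (‖u x‖ * ‖v n x‖)) +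
        ∫ x, ‖u x‖ * ‖v n x‖ * ‖v n x‖ ^ 2) := by
        rw [integral_const_mul, integral_add i12 i3, integral_add i1 i2]
    _ ≤ _ := by
        gcongr
        exact h3.trans (by gcongr; exact quartic_le_of_le hv hm hg n)

/-- The cross term $2\,\mathrm{Re}(u\bar v_n)$ tends to $0$ strongly in $L^2$, which handles every
product containing it. In $\int E_1(|u|^2)|v_n|^2$ the nonlocality is harmless: $E_1(|u|^2)$ is a
fixed $L^2$ function, and $|v_n|^2$ is bounded in $L^2$ and locally null. -/
lemma tendsto_nonlocalEnergy_sub {u : Plane → ℂ} (hu : MemH1 u) :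
    Tendsto (fun n => nonlocalEnergy (fun x => u x + v n x) - nonlocalEnergy u
      - nonlocalEnergy (v n)) atTop (𝓝 0) := by
  have hX := (tendsto_integral_sq_mul hv hm hg hw hu).const_mul 4
  rw [mul_zero] at hX
  have hr : Tendsto (fun n => mass (absCross u (v n))) atTop (𝓝 0) :=
    squeeze_zero (fun n => mass_nonneg _) (fun n => mass_absCross_le hu (hv n)) hX
  have hS := hr.sqrt
  rw [Real.sqrt_zero] at hS
  have h1 := tendsto_integral_mul_norm_sq hv hm hg hw (memLp_E1 (absSq u)).norm
  simp only [abs_norm] at h1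
  have hlim : Tendsto (fun n => 2 * (Real.sqrt (mass (absSq u)) * Real.sqrt (mass (absCross u (v n))))
      + (2 * (∫ x, ‖E1 (absSq u) x‖ * ‖v n x‖ ^ 2) + mass (absCross u (v n))
      + 2 * (Real.sqrt (mass (absCross u (v n))) * Real.sqrt (ladyConst * R * R)))) atTop (𝓝 0) := by
    simpa using ((hS.const_mul (Real.sqrt (mass (absSq u)))).const_mul 2).add
      (((h1.const_mul 2).add hr).add ((hS.mul_const (Real.sqrt (ladyConst * R * R))).const_mul 2))
  refine squeeze_zero_norm (fun n => ?_) hlim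
  have hrn := hu.memLp_absCross (hv n)
  have b1 := abs_nlForm_le hu.memLp_absSq hrn
  have b2 : |nlForm (absSq u) (absSq (v n))| ≤ ∫ x, ‖E1 (absSq u) x‖ * ‖v n x‖ ^ 2 := by
    rw [← integral_E1_mul_re hu.memLp_absSq (hv n).memLp_absSq (absSq_conj _), ← Real.norm_eq_abs]
    have hi : Integrable fun x => ‖E1 (absSq u) x‖ * ‖v n x‖ ^ 2 := by
      refine ((memLp_E1 (absSq u)).norm.integrable_mul (hv n).memLp_absSq.norm).congr
        (Eventually.of_forall fun x => ?_)
      simp [absSq]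
    refine norm_integral_le_of_norm_le hi (Eventually.of_forall fun x => ?_)
    rw [Real.norm_eq_abs]
    refine (Complex.abs_re_le_norm _).trans ?_
    simp [absSq]
  have b3 := nlForm_self_le hrn
  have b3' := nlForm_self_nonneg (absCross u (v n))
  have b4 := abs_nlForm_le hrn (hv n).memLp_absSq
  have b5 : Real.sqrt (mass (absSq (v n))) ≤ Real.sqrt (ladyConst * R * R) := by
    rw [mass_absSq]; exact Real.sqrt_le_sqrt (quartic_le_of_le hv hm hg n)
  have b6 := b4.trans (mul_le_mul_of_nonneg_left b5 (Real.sqrt_nonneg _))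
  rw [nonlocalEnergy_add hu (hv n), Real.norm_eq_abs]
  rw [abs_le] at b1 b2 b6 ⊢
  constructor <;> linarith [b1.1, b1.2, b2.1, b2.2, b6.1, b6.2]

omit hm hg in
lemma tendsto_mass_sub {u : Plane → ℂ} (hu : MemH1 u) :
    Tendsto (fun n => mass (fun x => u x + v n x) - mass u - mass (v n)) atTop (𝓝 0) := by
  have h := (tendsto_dot hu.1 (fun n => (hv n).1) hw).const_mul 2
  rw [mul_zero] at h
  refine h.congr fun n => ?_
  rw [mass_add hu.1 (hv n).1]; ring

lemma tendsto_energy_sub {p : ℝ} (hp : 1 < p) (hp' : p < 3) {u : Plane → ℂ} (hu : MemH1 u)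
    (hwg : ∀ i, WeakTendsto (fun n => weakPartial i (v n)) 0) :
    Tendsto (fun n => energy p (fun x => u x + v n x) - energy p u - energy p (v n))
      atTop (𝓝 0) := by
  have h1 : Tendsto (fun n => 2 * gradDot u (v n)) atTop (𝓝 0) := by
    have := (tendsto_finsetSum Finset.univ fun i _ => tendsto_dot (memLp_weakPartial i u)
      (fun n => memLp_weakPartial i (v n)) (hwg i)).const_mul 2
    simpa only [Finset.sum_const_zero, mul_zero, gradDot] using this
  have h2 := (tendsto_potential_sub hv hm hg hw hp hp' hu).const_mul (2 / (p + 1))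
  have h3 := (tendsto_nonlocalEnergy_sub hv hm hg hw hu).const_mul (1 / 2)
  have h := (h1.sub h2).sub h3
  simp only [mul_zero, sub_zero] at h
  refine h.congr fun n => ?_
  rw [energy_eq, energy_eq, energy_eq, gradEnergy_add hu (hv n)]
  ring

end Splitting

/-! ### Existence of a minimizer. -/

section Existence

lemma mass_add_le {f g : Plane → ℂ} (hf : MemLp f 2 volume) (hg : MemLp g 2 volume) :
    mass (fun x => f x + g x) ≤ 2 * mass f + 2 * mass g := by
  have h1 := abs_dot_le hf hg
  have h2 := le_abs_self (dot f g)
  have h3 := Real.sq_sqrt (mass_nonneg f)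
  have h4 := Real.sq_sqrt (mass_nonneg g)
  rw [mass_add hf hg]
  nlinarith [sq_nonneg (Real.sqrt (mass f) - Real.sqrt (mass g))]

lemma mass_sub_le {f g : Plane → ℂ} (hf : MemLp f 2 volume) (hg : MemLp g 2 volume) :
    mass (fun x => f x - g x) ≤ 2 * mass f + 2 * mass g := by
  have h := mass_add_le hf (hg.const_mul (-1))
  rw [mass_const_mul] at h
  simpa [sub_eq_add_neg] using h

lemma gradEnergy_sub_le {u v : Plane → ℂ} (hu : MemH1 u) (hv : MemH1 v) :
    gradEnergy (fun x => u x - v x) ≤ 2 * gradEnergy u + 2 * gradEnergy v := by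
  simp only [gradEnergy_eq, Finset.mul_sum, ← Finset.sum_add_distrib]
  refine Finset.sum_le_sum fun i _ => ?_
  rw [mass_congr (weakPartial_sub hu hv i)]
  exact mass_sub_le (memLp_weakPartial i u) (memLp_weakPartial i v)

lemma mass_mul_cutoff_le {u : Plane → ℂ} (hu : MemLp u 2 volume) (k : ℕ) :
    mass (fun x => (cutoff k x : ℂ) * u x) ≤ mass u := by
  refine integral_mono (integrable_norm_sq (MemLp.mul_test hu (isTestFunction_cutoff k)))
    (integrable_norm_sq hu) fun x => ?_
  have h0 := cutoff_nonneg k x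
  have h1 := cutoff_le_one k x
  simp only [norm_mul, Complex.norm_real, Real.norm_of_nonneg h0]
  have : cutoff k x * ‖u x‖ ≤ ‖u x‖ := mul_le_of_le_one_left (norm_nonneg _) h1
  gcongr

lemma integral_cutoff_pow_pos : 0 < ∫ x, cutoff 0 x ^ 4 := by
  have hc := (isTestFunction_cutoff 0).continuous
  refine (hc.pow 4).integral_pos_of_hasCompactSupport_nonneg_nonzero ?_
    (fun x => by positivity) (x := 0) ?_
  · exact (isTestFunction_cutoff 0).2.comp_left (g := fun t : ℝ => t ^ 4) (by norm_num)
  · rw [cutoff_eq_one (by simp)]; norm_num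

variable {p m d : ℝ}

/-- A minimizing sequence can be translated so that it does not vanish near the origin. -/
lemma exists_nonvanishing_minimizing (hp : 1 < p) (hp' : p < 3) (hm : 0 < m) (hm' : m < 2 * dJ)
    (hd0 : d < 0) (happ : ∀ ε > 0, ∃ u ∈ constraintSet m, energy p u < d + ε) :
    ∃ (w : ℕ → Plane → ℂ) (R s : ℝ), 0 < s ∧ (∀ n, w n ∈ constraintSet m) ∧
      (∀ n, gradEnergy (w n) ≤ R) ∧ (∀ n, energy p (w n) < d + -d / 2 * ((n : ℝ) + 1)⁻¹) ∧
      ∀ n, s ≤ mass (fun x => (cutoff 0 x : ℂ) * w n x) := by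
  choose u hu hE using fun n : ℕ => happ (-d / 2 * ((n : ℝ) + 1)⁻¹)
    (mul_pos (by linarith) (by positivity))
  -- The error was chosen at most $-d/2$, so the whole sequence has uniformly negative energy.
  have hE2 : ∀ n, energy p (u n) ≤ d / 2 := fun n => by
    have h1 : ((n : ℝ) + 1)⁻¹ ≤ 1 := inv_le_one_of_one_le₀ (by linarith [Nat.cast_nonneg (α := ℝ) n])
    have := hE n
    nlinarith
  obtain ⟨c, C, hc, hC⟩ := exists_coercive hp hp' hm hm'
  set R := max m (C / c)
  have hRm : m ≤ R := le_max_left _ _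
  have hG : ∀ n, gradEnergy (u n) ≤ R := fun n => by
    refine le_trans ?_ (le_max_right _ _)
    rw [le_div_iff₀ hc]
    have := hC _ (hu n).1 (hu n).2.le
    linarith [hE2 n]
  have hδ : 0 < (p + 1) / 2 * (-d / 2) := mul_pos (by linarith) (by linarith)
  set δ := (p + 1) / 2 * (-d / 2)
  -- Below the critical mass the gradient dominates the nonlocal term, so only the power term can
  -- make the energy negative.
  have hP : ∀ n, δ ≤ potential p (u n) := fun n => by
    have h1 := (hu n).1.neg_potential_le_energy (p := p) hm hm' (hu n).2.le
    have h2 := hE2 n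
    have h3 : -d / 2 ≤ 2 / (p + 1) * potential p (u n) := by linarith
    have h4 : 0 < (p + 1) / 2 := by linarith
    calc δ ≤ (p + 1) / 2 * (2 / (p + 1) * potential p (u n)) := by simp only [δ]; gcongr
      _ = _ := by field_simp
  obtain ⟨C', hC'0, hC'⟩ := exists_rpow_le_add_sq (r := p - 1) (ε := δ / (2 * m)) (by linarith)
    (by linarith) (by positivity)
  have hQ : ∀ n, δ / (2 * C') ≤ quartic (u n) := fun n => by
    have h1 := (hu n).1.potential_le_of_pointwise hp hC'
    rw [(hu n).2] at h1
    have h2 : δ / (2 * m) * m = δ / 2 := by field_simp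
    rw [div_le_iff₀ (by positivity)]
    linarith [hP n]
  obtain ⟨D, hD0, hD⟩ := exists_quartic_le_of_local_mass_le (isTestFunction_cutoff 0)
    integral_cutoff_pow_pos
  have hR0 : 0 < R := hm.trans_le hRm
  -- If all local masses were at most $s$, the localized inequality would bound the quartic integral
  -- by half of its established lower bound.
  set s := δ / (2 * C') / (2 * (D * (R + R)))
  have hs : 0 < s := by positivity
  have hy : ∀ n, ∃ y, s ≤ mass (fun x => (cutoff 0 x : ℂ) * u n (x + y)) := fun n => by
    by_contra! hcon
    have h1 := hD _ (hu n).1 s fun y => (hcon y).le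
    have h2 : D * s * (mass (u n) + gradEnergy (u n)) ≤ D * s * (R + R) := by
      have := hG n
      rw [(hu n).2]
      gcongr
    have h3 : D * s * (R + R) = δ / (2 * C') / 2 := by simp only [s]; field_simp
    have h4 : 0 < δ / (2 * C') := by positivity
    linarith [hQ n]
  choose y hy using hy
  refine ⟨fun n x => u n (x + y n), R, s, hs, fun n => ⟨(hu n).1.comp_add _, ?_⟩, fun n => ?_,
    fun n => ?_, hy⟩
  · rw [mass_comp_add]; exact (hu n).2
  · rw [gradEnergy_comp_add (hu n).1]; exact hG n
  · rw [energy_comp_add (hu n).1]; exact hE n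

/-- The infimum of the energy at fixed mass is attained. -/
lemma exists_minimizer (hp : 1 < p) (hp' : p < 3) (hm : 0 < m) (hm' : m < 2 * dJ)
    (hd0 : d < 0) (hd : ∀ u ∈ constraintSet m, d ≤ energy p u)
    (happ : ∀ ε > 0, ∃ u ∈ constraintSet m, energy p u < d + ε) :
    ∃ u ∈ constraintSet m, energy p u = d := by
  obtain ⟨w, R, s, hs, hw, hG, hE, hloc⟩ := exists_nonvanishing_minimizing hp hp' hm hm' hd0 happ
  obtain ⟨u, hu, ns, hns, hwu, hwg⟩ := exists_weakTendsto_subseq_H1 (fun n => (hw n).1)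
    (R := max m R) (fun n => (hw n).2.le.trans (le_max_left _ _))
    (fun n => (hG n).trans (le_max_right _ _))
  set v : ℕ → Plane → ℂ := fun k x => w (ns k) x - u x
  have hv : ∀ k, MemH1 (v k) := fun k => (hw _).1.sub hu
  have huv : ∀ k, (fun x => u x + v k x) = w (ns k) := fun k => by ext x; simp [v]
  set R' := max (2 * m + 2 * mass u) (2 * R + 2 * gradEnergy u)
  have hvm : ∀ k, mass (v k) ≤ R' := fun k => by
    refine le_trans ?_ (le_max_left _ _)
    have := mass_sub_le (hw (ns k)).1.1 hu.1
    rwa [(hw (ns k)).2] at this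
  have hvg : ∀ k, gradEnergy (v k) ≤ R' := fun k => by
    refine le_trans ?_ (le_max_right _ _)
    have := gradEnergy_sub_le (hw (ns k)).1 hu
    linarith [hG (ns k)]
  have hvw : WeakTendsto v 0 := hwu.sub_self (fun k => (hw _).1.1) hu.1
  have hvwg : ∀ i, WeakTendsto (fun k => weakPartial i (v k)) 0 := fun i =>
    ((hwg i).sub_self (fun k => memLp_weakPartial i _) (memLp_weakPartial i u)).congr fun k =>
      (weakPartial_sub (hw _).1 hu i).symm
  have hχ := isTestFunction_cutoff 0
  -- The remainder vanishes locally in $L^2$ by Rellich, so the local mass near the origin must come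
  -- from $u$.
  have hμ : 0 < mass u := by
    have h1 := tendsto_mass_mul_test hv hvm hvg hvw hχ
    have h2 := (h1.const_mul 2).const_add (2 * mass (fun x => (cutoff 0 x : ℂ) * u x))
    have h3 : s ≤ 2 * mass (fun x => (cutoff 0 x : ℂ) * u x) + 2 * 0 := by
      refine ge_of_tendsto' h2 fun k => ?_
      have h4 := mass_add_le (MemLp.mul_test hu.1 hχ) (MemLp.mul_test (hv k).1 hχ)
      refine (hloc (ns k)).trans ?_
      rw [← huv k]
      simpa only [mul_add] using h4
    have h5 := mass_mul_cutoff_le hu.1 0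
    linarith
  set μ := mass u
  have hmv : Tendsto (fun k => mass (v k)) atTop (𝓝 (m - μ)) := by
    have h1 := tendsto_mass_sub hv hvw hu
    simp only [huv, (hw _).2] at h1
    have h2 := h1.const_sub (m - μ)
    rw [sub_zero] at h2
    refine h2.congr fun k => ?_
    ring
  have hμm : μ ≤ m := by
    have := ge_of_tendsto' hmv fun k => mass_nonneg (v k)
    linarith
  have hEw : Tendsto (fun k => energy p (w (ns k))) atTop (𝓝 d) := by
    have h1 : Tendsto (fun n : ℕ => d + -d / 2 * ((n : ℝ) + 1)⁻¹) atTop (𝓝 d) := by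
      have := (tendsto_const_mul_inv_add_one (-d / 2)).const_add d
      simpa using this
    exact tendsto_of_tendsto_of_tendsto_of_le_of_le tendsto_const_nhds
      (h1.comp hns.tendsto_atTop) (fun k => hd _ (hw _)) (fun k => (hE _).le)
  have hEv : Tendsto (fun k => energy p (v k)) atTop (𝓝 (d - energy p u)) := by
    have h1 := tendsto_energy_sub hv hvm hvg hvw hp hp' hu hvwg
    simp only [huv] at h1
    have h2 := (hEw.sub_const (energy p u)).sub h1
    rw [sub_zero] at h2
    refine h2.congr fun k => ?_
    ring
  -- The remainder carries mass tending to $m-\mu$ and hence energy at least about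
  -- $\frac{m-\mu}{m}d$; the splitting leaves at most $\frac\mu md$ for $u$.
  have hEu : energy p u ≤ μ / m * d := by
    have h1 : (m - μ) / m * d ≤ d - energy p u := by
      refine le_of_tendsto_of_tendsto ((hmv.div_const m).mul_const d) hEv ?_
      -- Here $\mu>0$ enters: it makes the remainder mass eventually smaller than $m$.
      filter_upwards [hmv.eventually (gt_mem_nhds (by linarith : m - μ < m))] with k hk
      exact mass_div_mul_le_energy hp hm hm' hd (hv k) hk.le
    have h2 : (m - μ) / m * d = d - μ / m * d := by field_simp
    linarith
  have hθ : 1 ≤ m / μ := (one_le_div hμ).2 hμm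
  have hs1 := energy_sqrt_mul_le (p := p) hθ hu
  have hs2 := hd _ ⟨hu.const_mul (Real.sqrt (m / μ)), by
    rw [mass_sqrt_mul (by positivity)]; exact div_mul_cancel₀ m hμ.ne'⟩
  have hs3 : m / μ * energy p u ≤ d := by
    calc m / μ * energy p u ≤ m / μ * (μ / m * d) := by gcongr
      _ = d := by field_simp
  have hPpos := potential_pos hp hp' hu hμ
  -- Otherwise the rescaled $u$, of mass $m$, would have energy strictly below $d$. As $(p+1)/2>1$,
  -- this forces $m/\mu=1$.
  have hle : (m / μ) ^ ((p + 1) / 2) ≤ m / μ := by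
    by_contra! hlt
    have : 0 < 2 / (p + 1) * (((m / μ) ^ ((p + 1) / 2) - m / μ) * potential p u) :=
      mul_pos (by positivity) (mul_pos (by linarith) hPpos)
    linarith
  have hmμ : μ = m := by
    by_contra hne
    have h1 : 1 < m / μ := (one_lt_div hμ).2 (lt_of_le_of_ne hμm hne)
    have := Real.rpow_lt_rpow_of_exponent_lt h1 (by linarith : 1 < (p + 1) / 2)
    rw [Real.rpow_one] at this
    linarith
  refine ⟨u, ⟨hu, hmμ⟩, le_antisymm ?_ (hd u ⟨hu, hmμ⟩)⟩
  rw [hmμ, div_self hm.ne', one_mul] at hEu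
  exact hEu

/-- The infimum of the energy at fixed mass is attained at a nonnegative function. -/
lemma exists_nonneg_minimizer (hp : 1 < p) (hp' : p < 3) (hm : 0 < m) (hm' : m < 2 * dJ)
    (hd0 : d < 0) (hd : ∀ u ∈ constraintSet m, d ≤ energy p u)
    (happ : ∀ ε > 0, ∃ u ∈ constraintSet m, energy p u < d + ε) :
    ∃ Q : Plane → ℝ, (∀ x, 0 ≤ Q x) ∧ (fun x => (Q x : ℂ)) ∈ constraintSet m ∧
      energy p (fun x => (Q x : ℂ)) = d := by
  obtain ⟨u, hu, hE⟩ := exists_minimizer hp hp' hm hm' hd0 hd happ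
  have h1 : (fun x => (‖u x‖ : ℂ)) ∈ constraintSet m := ⟨hu.1.norm.1, by rw [mass_norm]; exact hu.2⟩
  exact ⟨fun x => ‖u x‖, fun x => norm_nonneg _, h1,
    le_antisymm ((energy_norm_le hu.1).trans hE.le) (hd _ h1)⟩

end Existence

/-! ### First variation on the constraint set. -/

section EulerLagrange

/-- A real function on the plane, viewed as a complex one. -/
abbrev toC (Q : Plane → ℝ) : Plane → ℂ := fun x => (Q x : ℂ)

variable {u v f g : Plane → ℂ} {Q φ : Plane → ℝ} {p m d ω : ℝ}

lemma dot_const_mul_right (c : ℝ) (f g : Plane → ℂ) :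
    dot f (fun x => (c : ℂ) * g x) = c * dot f g := by
  unfold dot
  rw [← integral_const_mul]
  congr 1; ext x
  rw [map_mul, Complex.conj_ofReal, ← Complex.re_ofReal_mul]
  congr 1; ring

lemma dot_congr_right (h : g =ᵐ[volume] v) : dot f g = dot f v :=
  integral_congr_ae (by filter_upwards [h] with x hx; rw [hx])

lemma gradDot_const_mul_right (c : ℝ) (hv : MemH1 v) :
    gradDot u (fun x => (c : ℂ) * v x) = c * gradDot u v := by
  simp only [gradDot, Finset.mul_sum]
  refine Finset.sum_congr rfl fun i _ => ?_
  rw [dot_congr_right (weakPartial_const_mul c hv i), dot_const_mul_right]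

lemma MemH1.memLp_toC (h : MemH1 (toC Q)) : MemLp Q 2 volume := by
  have h1 := h.1.re
  simpa using h1

lemma dot_toC (Q φ : Plane → ℝ) : dot (toC Q) (toC φ) = ∫ x, Q x * φ x := by
  unfold dot
  congr 1; ext x
  rw [Complex.conj_ofReal, ← Complex.ofReal_mul, Complex.ofReal_re]

lemma mass_toC (Q : Plane → ℝ) : mass (toC Q) = ∫ x, Q x ^ 2 := by
  unfold mass
  congr 1; ext x
  rw [Complex.norm_real, Real.norm_eq_abs, sq_abs]

lemma memLp_toC_mul (hQ : MemH1 (toC Q)) (hφ : MemH1 (toC φ)) :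
    MemLp (toC fun x => Q x * φ x) 2 volume := by
  refine memLp_of_norm_le_mul hQ hφ ?_ fun x => ?_
  · exact Complex.continuous_ofReal.comp_aestronglyMeasurable
      (hQ.memLp_toC.1.mul hφ.memLp_toC.1)
  · simp

lemma MemH1.abs_toC (hQ : MemH1 (toC Q)) : MemH1 (toC fun x => |Q x|) := by
  have := hQ.norm.1
  simpa only [Complex.norm_real, Real.norm_eq_abs] using this

/-- `t ↦ ∫ |Q + tφ|^(p+1)` is differentiable at `0`. -/
lemma hasDerivAt_potential (hp : 1 < p) (hp' : p < 3) (hQ : MemH1 (toC Q)) (hφ : MemH1 (toC φ)) :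
    Integrable (fun x => |Q x| ^ (p - 1) * Q x * φ x) ∧
    HasDerivAt (fun t : ℝ => potential p (fun x => (Q x : ℂ) + (t : ℂ) * (φ x : ℂ)))
      ((p + 1) * ∫ x, |Q x| ^ (p - 1) * Q x * φ x) 0 := by
  have hS : MemH1 (toC fun x => |Q x| + |φ x|) := by
    have h := hQ.abs_toC.add hφ.abs_toC
    simp only [← Complex.ofReal_add] at h
    exact h
  have hb := (hS.integrable_potential hp hp').const_mul (p + 1)
  have hQm := hQ.memLp_toC.1
  have hφm := hφ.memLp_toC.1
  have hpot : ∀ t : ℝ, potential p (fun x => (Q x : ℂ) + (t : ℂ) * (φ x : ℂ)) =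
      ∫ x, |Q x + t * φ x| ^ (p + 1) := fun t => by
    unfold potential
    congr 1; ext x
    simp only [← Complex.ofReal_mul, ← Complex.ofReal_add, Complex.norm_real, Real.norm_eq_abs]
  have hpm : Continuous fun s : ℝ => |s| ^ (p - 1) * s :=
    ((Real.continuous_rpow_const (by linarith)).comp continuous_abs).mul continuous_id
  have hpm1 : Continuous fun s : ℝ => |s| ^ (p + 1) :=
    (Real.continuous_rpow_const (by linarith)).comp continuous_abs
  -- For $|t|<1$ the derivative of the integrand is dominated by $(p+1)(|Q|+|\varphi|)^{p+1}$,
  -- integrable because $|Q|+|\varphi|$ is in $H^1$.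
  have h := hasDerivAt_integral_of_dominated_loc_of_deriv_le
    (F := fun (t : ℝ) x => |Q x + t * φ x| ^ (p + 1))
    (F' := fun (t : ℝ) x => (p + 1) * (|Q x + t * φ x| ^ (p - 1) * (Q x + t * φ x) * φ x))
    (x₀ := (0 : ℝ)) (s := Metric.ball 0 1) (μ := (volume : Measure Plane))
    (bound := fun x => (p + 1) * ‖toC (fun x => |Q x| + |φ x|) x‖ ^ (p + 1))
    (Metric.ball_mem_nhds 0 one_pos)
    (Eventually.of_forall fun t => hpm1.comp_aestronglyMeasurable (hQm.add (hφm.const_mul t)))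
    ?_ ?_ (Eventually.of_forall fun x t ht => ?_) hb (Eventually.of_forall fun x t ht => ?_)
  · simp only [zero_mul, add_zero] at h
    have hp1 : p + 1 ≠ 0 := by linarith
    refine ⟨?_, ?_⟩
    · refine (h.1.const_mul (p + 1)⁻¹).congr (Eventually.of_forall fun x => ?_)
      field_simp
    · simp only [hpot, ← integral_const_mul]
      exact h.2
  · simpa using hQ.integrable_potential hp hp'
  · simp only [zero_mul, add_zero]
    exact ((hpm.comp_aestronglyMeasurable hQm).mul hφm).const_mul _
  · rw [mem_ball_zero_iff, Real.norm_eq_abs] at ht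
    set s := |Q x| + |φ x|
    have hs0 : 0 ≤ s := by positivity
    have hle : |Q x + t * φ x| ≤ s := by
      refine (abs_add_le _ _).trans ?_
      rw [abs_mul]
      have := mul_le_of_le_one_left (abs_nonneg (φ x)) ht.le
      simp only [s]; linarith
    have hφs : |φ x| ≤ s := by simp only [s]; linarith [abs_nonneg (Q x)]
    rw [Complex.norm_real, Real.norm_of_nonneg hs0, rpow_add_one_eq hp hs0, norm_mul, norm_mul, norm_mul,
      Real.norm_of_nonneg (by linarith : 0 ≤ p + 1), Real.norm_of_nonneg (by positivity),
      Real.norm_eq_abs, Real.norm_eq_abs]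
    have := Real.rpow_le_rpow (abs_nonneg _) hle (by linarith : 0 ≤ p - 1)
    calc _ ≤ (p + 1) * (s ^ (p - 1) * s * s) := by gcongr
      _ = _ := by ring
  · have h1 := hasDerivAt_abs_rpow (Q x + t * φ x) (p := p + 1) (by linarith)
    have h2 : HasDerivAt (fun t : ℝ => Q x + t * φ x) (φ x) t := by
      simpa using ((hasDerivAt_id t).mul_const (φ x)).const_add (Q x)
    have h3 := h1.comp t h2
    have e : p + 1 - 2 = p - 1 := by ring
    rw [e] at h3
    refine h3.congr_deriv ?_
    ring

/-- Mass, gradient and nonlocal energy are polynomials of degree at most $4$ along $Q+t\varphi$, so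
their derivatives at $0$ are linear coefficients. -/
lemma hasDerivAt_of_poly (a b c e k : ℝ) :
    HasDerivAt (fun t : ℝ => a + b * t + c * t ^ 2 + e * t ^ 3 + k * t ^ 4) b 0 := by
  have h := ((((hasDerivAt_const (0 : ℝ) a).add ((hasDerivAt_id (0 : ℝ)).const_mul b)).add
    ((hasDerivAt_pow 2 (0 : ℝ)).const_mul c)).add ((hasDerivAt_pow 3 (0 : ℝ)).const_mul e)).add
    ((hasDerivAt_pow 4 (0 : ℝ)).const_mul k)
  refine h.congr_deriv ?_
  simp

lemma hasDerivAt_nonlocalEnergy (hQ : MemH1 (toC Q)) (hφ : MemH1 (toC φ)) :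
    HasDerivAt (fun t : ℝ => nonlocalEnergy (fun x => (Q x : ℂ) + (t : ℂ) * (φ x : ℂ)))
      (4 * nlForm (absSq (toC Q)) (toC fun x => Q x * φ x)) 0 := by
  have hQφ := memLp_toC_mul hQ hφ
  set q : Plane → ℂ := toC fun x => Q x * φ x
  set A := absSq (toC Q)
  set B := absSq (toC φ)
  have hB : MemLp B 2 volume := hφ.memLp_absSq
  have e : ∀ t : ℝ, nonlocalEnergy (fun x => (Q x : ℂ) + (t : ℂ) * (φ x : ℂ)) =
      nonlocalEnergy (toC Q) + 4 * nlForm A q * t + (2 * nlForm A B + 4 * nlForm q q) * t ^ 2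
        + 4 * nlForm q B * t ^ 3 + nonlocalEnergy (toC φ) * t ^ 4 := fun t => by
    have hφt : MemH1 (fun x => (t : ℂ) * (φ x : ℂ)) := hφ.const_mul t
    have e1 : absCross (toC Q) (fun x => (t : ℂ) * (φ x : ℂ)) = fun x => ((2 * t : ℝ) : ℂ) * q x := by
      ext x
      simp only [absCross, q, toC]
      rw [← Complex.ofReal_mul, Complex.conj_ofReal, ← Complex.ofReal_mul, Complex.ofReal_re,
        ← Complex.ofReal_mul]
      congr 1; ring
    have e2 : absSq (fun x => (t : ℂ) * (φ x : ℂ)) = fun x => ((t ^ 2 : ℝ) : ℂ) * B x := by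
      ext x
      simp only [absSq, B, toC]
      rw [← Complex.ofReal_mul (t ^ 2), norm_mul, Complex.norm_real, Complex.norm_real, mul_pow,
        Real.norm_eq_abs t, sq_abs]
    have h := nonlocalEnergy_add hQ hφt
    rw [e1, e2] at h
    have hN := nonlocalEnergy_const_mul t hφ
    have hqt : MemLp (fun x => ((2 * t : ℝ) : ℂ) * q x) 2 volume := hQφ.const_mul _
    have hBt : MemLp (fun x => ((t ^ 2 : ℝ) : ℂ) * B x) 2 volume := hB.const_mul _
    refine h.trans ?_
    rw [nlForm_const_mul_left _ hQφ, nlForm_const_mul_left _ hQφ, nlForm_const_mul_right _ hB,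
      nlForm_const_mul_right _ hB, nlForm_const_mul_right _ hQφ, nlForm_const_mul_right _ hQφ]
    rw [hN]
    ring
  simp only [e]
  exact hasDerivAt_of_poly _ _ _ _ _

lemma hasDerivAt_mass (hQ : MemH1 (toC Q)) (hφ : MemH1 (toC φ)) :
    HasDerivAt (fun t : ℝ => mass (fun x => (Q x : ℂ) + (t : ℂ) * (φ x : ℂ)))
      (2 * ∫ x, Q x * φ x) 0 := by
  have e : ∀ t : ℝ, mass (fun x => (Q x : ℂ) + (t : ℂ) * (φ x : ℂ)) =
      mass (toC Q) + (2 * ∫ x, Q x * φ x) * t + mass (toC φ) * t ^ 2 + 0 * t ^ 3 + 0 * t ^ 4 :=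
    fun t => by
    have h := mass_add hQ.1 (hφ.1.const_mul (t : ℂ))
    rw [dot_const_mul_right, dot_toC, mass_const_mul, Complex.norm_real, Real.norm_eq_abs, sq_abs] at h
    refine h.trans ?_
    ring
  simp only [e]
  exact hasDerivAt_of_poly _ _ _ _ _

lemma hasDerivAt_gradEnergy (hQ : MemH1 (toC Q)) (hφ : MemH1 (toC φ)) :
    HasDerivAt (fun t : ℝ => gradEnergy (fun x => (Q x : ℂ) + (t : ℂ) * (φ x : ℂ)))
      (2 * gradDot (toC Q) (toC φ)) 0 := by
  have e : ∀ t : ℝ, gradEnergy (fun x => (Q x : ℂ) + (t : ℂ) * (φ x : ℂ)) =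
      gradEnergy (toC Q) + (2 * gradDot (toC Q) (toC φ)) * t + gradEnergy (toC φ) * t ^ 2
        + 0 * t ^ 3 + 0 * t ^ 4 := fun t => by
    have h := gradEnergy_add hQ (hφ.const_mul (t : ℂ))
    rw [gradDot_const_mul_right t hφ, gradEnergy_const_mul t hφ] at h
    refine h.trans ?_
    ring
  simp only [e]
  exact hasDerivAt_of_poly _ _ _ _ _

/-- The Lagrange multiplier of a function of mass `m`. -/
def multiplier (p m : ℝ) (u : Plane → ℂ) : ℝ :=
  (potential p u + nonlocalEnergy u - gradEnergy u) / m

/-- The Euler–Lagrange equation, tested with an arbitrary real element of `H¹`. -/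
lemma euler_lagrange (hp : 1 < p) (hp' : p < 3) (hm : 0 < m)
    (hd : ∀ u ∈ constraintSet m, d ≤ energy p u) (hQ : toC Q ∈ constraintSet m)
    (hE : energy p (toC Q) = d) (hφ : MemH1 (toC φ)) :
    gradDot (toC Q) (toC φ) + multiplier p m (toC Q) * ∫ x, Q x * φ x =
      (∫ x, |Q x| ^ (p - 1) * Q x * φ x)
        + nlForm (absSq (toC Q)) (toC fun x => Q x * φ x) := by
  obtain ⟨hQ1, hQm⟩ := hQ
  have dP := (hasDerivAt_potential hp hp' hQ1 hφ).2
  have dN := hasDerivAt_nonlocalEnergy hQ1 hφ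
  have dM := hasDerivAt_mass hQ1 hφ
  have dG := hasDerivAt_gradEnergy hQ1 hφ
  set w : ℝ → Plane → ℂ := fun t x => (Q x : ℂ) + (t : ℂ) * (φ x : ℂ)
  have hw : ∀ t, MemH1 (w t) := fun t => hQ1.add (hφ.const_mul t)
  have hw0 : w 0 = toC Q := by ext x; simp [w]
  have hM0 : mass (w 0) = m := by rw [hw0, hQm]
  -- Scaling the mass by $\theta(t)=m/\int|w_t|^2$ returns to the constraint set, so $t=0$ is an
  -- unconstrained local minimum. The multiplier arises from differentiating $\theta$.
  have dθ : HasDerivAt (fun t => m / mass (w t)) (-(2 * ∫ x, Q x * φ x) / m) 0 := by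
    have h := (dM.inv (by rw [show mass _ = m from hM0]; exact hm.ne')).const_mul m
    refine h.congr_deriv ?_
    rw [show mass (fun x => (Q x : ℂ) + ((0 : ℝ) : ℂ) * (φ x : ℂ)) = m from hM0]
    field_simp
  have hθ0 : m / mass (w 0) = 1 := by rw [hM0, div_self hm.ne']
  have dθp : HasDerivAt (fun t => (m / mass (w t)) ^ ((p + 1) / 2))
      (-(2 * ∫ x, Q x * φ x) / m * ((p + 1) / 2)) 0 := by
    have h := dθ.rpow_const (p := (p + 1) / 2) (Or.inr (by linarith))
    refine h.congr_deriv ?_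
    rw [hθ0, Real.one_rpow, mul_one]
  have dθ2 : HasDerivAt (fun t => (m / mass (w t)) ^ 2) (2 * (-(2 * ∫ x, Q x * φ x) / m)) 0 := by
    refine (dθ.pow 2).congr_deriv ?_
    rw [hθ0]; norm_num
  have dF := ((dθ.mul dG).sub ((dθp.mul dP).const_mul (2 / (p + 1)))).sub
    ((dθ2.mul dN).const_mul (1 / 2))
  have hmin : IsLocalMin (fun t : ℝ => m / mass (w t) * gradEnergy (w t)
      - 2 / (p + 1) * ((m / mass (w t)) ^ ((p + 1) / 2) * potential p (w t))
      - 1 / 2 * ((m / mass (w t)) ^ 2 * nonlocalEnergy (w t))) 0 := by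
    have hpos : ∀ᶠ t in 𝓝 (0 : ℝ), 0 < mass (w t) :=
      dM.continuousAt.eventually (lt_mem_nhds (hm.trans_eq hM0.symm))
    filter_upwards [hpos] with t ht
    have hθ : 0 ≤ m / mass (w t) := by positivity
    rw [← energy_sqrt_mul p hθ (hw t)]
    have h0 := energy_sqrt_mul p (θ := m / mass (w 0)) (by rw [hθ0]; norm_num) (hw 0)
    have h1 : energy p (fun x => (Real.sqrt (m / mass (w 0)) : ℂ) * w 0 x) = d := by
      rw [hθ0, hw0, ← hE]; simp
    rw [h1] at h0
    refine h0.symm.le.trans ?_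
    refine hd _ ⟨(hw t).const_mul _, ?_⟩
    rw [mass_sqrt_mul hθ]; exact div_mul_cancel₀ m ht.ne'
  have h0 := hmin.hasDerivAt_eq_zero dF
  change _ * gradEnergy (w 0) + m / mass (w 0) * _ - 2 / (p + 1) * (_ * potential p (w 0) +
    (m / mass (w 0)) ^ ((p + 1) / 2) * _) - 1 / 2 * (_ * nonlocalEnergy (w 0) +
    (m / mass (w 0)) ^ 2 * _) = 0 at h0
  rw [hθ0, hw0, Real.one_rpow] at h0
  unfold multiplier
  have hp1 : p + 1 ≠ 0 := by linarith
  field_simp at h0 ⊢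
  linarith

/-- Negative energy gives $\int|\nabla u|^2<\frac2{p+1}\int|u|^{p+1}+\frac12\int E_1(|u|^2)|u|^2$,
and both coefficients are at most $1$. -/
lemma multiplier_pos (hp : 1 < p) (hm : 0 < m) (hu : MemH1 u) (hE : energy p u < 0) :
    0 < multiplier p m u := by
  refine div_pos ?_ hm
  rw [energy_eq] at hE
  have h1 : 2 / (p + 1) ≤ 1 := by rw [div_le_one (by linarith)]; linarith
  have h2 := mul_le_mul_of_nonneg_right h1 (potential_nonneg p u)
  linarith [hu.nonlocalEnergy_nonneg]

end EulerLagrange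

/-! ### The weak equation and uniqueness of $\omega$. -/

section WeakSolution

variable {Q φ : Plane → ℝ} {p m d ω : ℝ}

/-- Conjugating the defining identity, tested with real functions, shows that the conjugate is also
a weak derivative; uniqueness concludes. -/
lemma weakPartial_toC_conj (hQ : MemH1 (toC Q)) (i : Fin 2) :
    ∀ᵐ x, conj (weakPartial i (toC Q) x) = weakPartial i (toC Q) x := by
  refine HasWeakPartial.ae_unique (memLp_weakPartial i _).star (memLp_weakPartial i _)
    (fun φ hφ => ?_) (hQ.hasWeakPartial i)
  have h := congrArg conj (hQ.hasWeakPartial i φ hφ)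
  rw [map_neg, ← integral_conj, ← integral_conj] at h
  simpa using h

lemma integral_mul_ofReal {f : Plane → ℂ} (hf : ∀ᵐ x, conj (f x) = f x) :
    ∫ x, f x * (φ x : ℂ) = ((∫ x, (f x * (φ x : ℂ)).re : ℝ) : ℂ) := by
  rw [← integral_complex_ofReal]
  refine integral_congr_ae ?_
  filter_upwards [hf] with x hx
  obtain ⟨r, hr⟩ := Complex.conj_eq_iff_real.1 hx
  rw [hr, ← Complex.ofReal_mul, Complex.ofReal_re]

lemma gradDot_test (hQ : MemH1 (toC Q)) (hφ : IsTestFunction φ) :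
    ∑ i, ∫ x, weakPartial i (toC Q) x * (partialDeriv i φ x : ℂ) =
      (gradDot (toC Q) (toC φ) : ℂ) := by
  unfold gradDot
  rw [Complex.ofReal_sum]
  refine Finset.sum_congr rfl fun i _ => ?_
  rw [dot_congr_right (hφ.weakPartial_ae_eq i), integral_mul_ofReal (weakPartial_toC_conj hQ i)]
  simp [dot]

/-- For real `Q` the left hand side of the weak formulation is a real number. -/
lemma integral_solution (hp : 1 < p) (hp' : p < 3) (hQ : MemH1 (toC Q)) (hφ : IsTestFunction φ)
    (ω : ℝ) :
    ∫ x, (- (∑ i : Fin 2, weakPartial i (toC Q) x * (partialDeriv i φ x : ℂ))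
      - (ω : ℂ) * toC Q x * (φ x : ℂ)
      + ((‖toC Q x‖ ^ (p - 1) : ℝ) : ℂ) * toC Q x * (φ x : ℂ)
      + E1 (absSq (toC Q)) x * toC Q x * (φ x : ℂ)) =
    ((- gradDot (toC Q) (toC φ) - ω * (∫ x, Q x * φ x) + (∫ x, |Q x| ^ (p - 1) * Q x * φ x)
      + nlForm (absSq (toC Q)) (toC fun x => Q x * φ x) : ℝ) : ℂ) := by
  have hφ1 : MemH1 (toC φ) := hφ.memH1
  have i1 : ∀ i, Integrable fun x => weakPartial i (toC Q) x * (partialDeriv i φ x : ℂ) := fun i =>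
    integrable_mul_test (memLp_weakPartial i _) (hφ.partialDeriv i)
  have i1' : Integrable fun x => - ∑ i : Fin 2, weakPartial i (toC Q) x * (partialDeriv i φ x : ℂ) :=
    (integrable_finsetSum Finset.univ fun i _ => i1 i).neg
  have i2r : Integrable fun x => Q x * φ x := hQ.memLp_toC.integrable_mul hφ1.memLp_toC
  have i2 : Integrable fun x => (ω : ℂ) * toC Q x * (φ x : ℂ) := by
    refine (i2r.ofReal.const_mul (ω : ℂ)).congr (Eventually.of_forall fun x => ?_)
    simp [mul_assoc]
  have i3r := (hasDerivAt_potential hp hp' hQ hφ1).1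
  have e3 : ∀ x, ((‖toC Q x‖ ^ (p - 1) : ℝ) : ℂ) * toC Q x * (φ x : ℂ) =
      ((|Q x| ^ (p - 1) * Q x * φ x : ℝ) : ℂ) := fun x => by
    rw [Complex.norm_real, Real.norm_eq_abs, Complex.ofReal_mul, Complex.ofReal_mul]
  have i3 : Integrable fun x => ((‖toC Q x‖ ^ (p - 1) : ℝ) : ℂ) * toC Q x * (φ x : ℂ) := by
    simp only [e3]; exact i3r.ofReal
  have hq := memLp_toC_mul hQ hφ1
  have e4 : ∀ x, E1 (absSq (toC Q)) x * toC Q x * (φ x : ℂ) =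
      E1 (absSq (toC Q)) x * toC (fun x => Q x * φ x) x := fun x => by
    simp only [toC, Complex.ofReal_mul, mul_assoc]
  have i4 : Integrable fun x => E1 (absSq (toC Q)) x * toC Q x * (φ x : ℂ) := by
    simp only [e4]; exact (memLp_E1 _).integrable_mul hq
  have i12 := i1'.sub i2
  have i123 := i12.add i3
  have h := integral_add i123 i4
  simp only [Pi.add_apply, Pi.sub_apply] at h
  refine h.trans ?_
  have h' := integral_add i12 i3
  simp only [Pi.sub_apply] at h'
  rw [h', integral_sub i1' i2, integral_neg, integral_finsetSum _ fun i _ => i1 i, gradDot_test hQ hφ]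
  have h2 : ∫ x, (ω : ℂ) * toC Q x * (φ x : ℂ) = ((ω * ∫ x, Q x * φ x : ℝ) : ℂ) := by
    rw [Complex.ofReal_mul, ← integral_complex_ofReal, ← integral_const_mul]
    congr 1; ext x; simp [mul_assoc]
  simp only [e3, e4]
  rw [h2, integral_complex_ofReal, integral_E1_mul hQ.memLp_absSq hq (absSq_conj _)
    (fun x => Complex.conj_ofReal _)]
  push_cast
  ring

lemma isSolution_multiplier (hp : 1 < p) (hp' : p < 3) (hm : 0 < m)
    (hd : ∀ u ∈ constraintSet m, d ≤ energy p u) (hQ : toC Q ∈ constraintSet m)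
    (hE : energy p (toC Q) = d) : IsSolution p (multiplier p m (toC Q)) (toC Q) := by
  refine ⟨hQ.1, fun φ hφ => ?_⟩
  rw [integral_solution hp hp' hQ.1 hφ, Complex.ofReal_eq_zero]
  linarith [euler_lagrange hp hp' hm hd hQ hE hφ.memH1]

/-- Subtracting the two equations tested with a cutoff leaves $(\omega'-\omega)\int Q\varphi=0$, and
that integral is positive. -/
lemma IsSolution.unique {ω' : ℝ} (hp : 1 < p) (hp' : p < 3) (hc : Continuous Q) (hpos : ∀ x, 0 < Q x)
    (h : IsSolution p ω (toC Q)) (h' : IsSolution p ω' (toC Q)) : ω' = ω := by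
  have hφ := isTestFunction_cutoff 0
  have h1 := h.2 _ hφ
  have h2 := h'.2 _ hφ
  rw [integral_solution hp hp' h.1 hφ, Complex.ofReal_eq_zero] at h1 h2
  have h3 : 0 < ∫ x, Q x * cutoff 0 x := by
    refine (hc.mul hφ.continuous).integral_pos_of_hasCompactSupport_nonneg_nonzero
      (hφ.2.mul_left) (fun x => mul_nonneg (hpos x).le (cutoff_nonneg 0 x)) (x := 0) ?_
    rw [cutoff_eq_one (by simp), mul_one]
    exact (hpos 0).ne'
  have h4 : (ω' - ω) * ∫ x, Q x * cutoff 0 x = 0 := by linarith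
  rcases mul_eq_zero.1 h4 with h5 | h5
  · linarith
  · exact absurd h5 h3.ne'

end WeakSolution

/-! ### Energy estimate for the difference of two solutions. -/

section DifferenceEstimate

variable {Q δ : Plane → ℝ} {p ω K : ℝ}

lemma dot_add_left {f g k : Plane → ℂ} (hf : MemLp f 2 volume) (hg : MemLp g 2 volume)
    (hk : MemLp k 2 volume) : dot (fun x => f x + g x) k = dot f k + dot g k := by
  unfold dot
  rw [← integral_add (integrable_dot hf hk) (integrable_dot hg hk)]
  simp only [add_mul, Complex.add_re]

lemma dot_self (f : Plane → ℂ) : dot f f = mass f := by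
  unfold dot mass
  congr 1; ext x
  rw [Complex.mul_conj, Complex.ofReal_re, Complex.normSq_eq_norm_sq]

lemma dot_comm (f g : Plane → ℂ) : dot f g = dot g f := by
  unfold dot
  congr 1; ext x
  rw [← Complex.conj_re, map_mul, Complex.conj_conj, mul_comm]

lemma gradDot_add_left {u v w : Plane → ℂ} (hu : MemH1 u) (hv : MemH1 v) :
    gradDot (fun x => u x + v x) w = gradDot u w + gradDot v w := by
  simp only [gradDot, ← Finset.sum_add_distrib]
  refine Finset.sum_congr rfl fun i _ => ?_
  rw [dot_comm, dot_congr_right (weakPartial_add hu hv i), dot_comm,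
    dot_add_left (memLp_weakPartial i u) (memLp_weakPartial i v) (memLp_weakPartial i w)]

lemma gradDot_self (u : Plane → ℂ) : gradDot u u = gradEnergy u := by
  simp only [gradDot, dot_self, gradEnergy_eq]

/-- The Euler–Lagrange equation with multiplier `ω`, tested with arbitrary real elements of `H¹`. -/
def SolvesEL (p ω : ℝ) (Q : Plane → ℝ) : Prop :=
  ∀ φ : Plane → ℝ, MemH1 (toC φ) → gradDot (toC Q) (toC φ) + ω * ∫ x, Q x * φ x =
      (∫ x, |Q x| ^ (p - 1) * Q x * φ x) + nlForm (absSq (toC Q)) (toC fun x => Q x * φ x)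

lemma abs_rpow_mul_self {s : ℝ} (hp : 1 < p) (hs : 0 ≤ s) : |s| ^ (p - 1) * s = s ^ p := by
  rw [abs_of_nonneg hs, ← Real.rpow_add_one' hs (by linarith)]
  ring_nf

lemma integral_mul_sq_le (hQ : MemH1 (toC Q)) (hδ : MemH1 (toC δ)) (hK : quartic (toC Q) ≤ K) :
    Integrable (fun x => Q x ^ 2 * δ x ^ 2) ∧
    ∫ x, Q x ^ 2 * δ x ^ 2 ≤ Real.sqrt K * Real.sqrt (quartic (toC δ)) := by
  have e : ∀ x, (‖toC Q x‖ * ‖toC δ x‖) ^ 2 = Q x ^ 2 * δ x ^ 2 := fun x => by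
    rw [mul_pow, Complex.norm_real, Complex.norm_real, Real.norm_eq_abs, Real.norm_eq_abs, sq_abs,
      sq_abs]
  have h1 := (hQ.memLp_mul hδ).integrable_sq
  have h2 := integral_sq_mul_le hQ hδ
  simp only [e] at h1 h2
  exact ⟨h1, h2.trans (by gcongr)⟩

/-- The difference of two nonnegative solutions is controlled in `H¹` by its `L²` norm. -/
lemma gradEnergy_le_of_solvesEL (hp : 1 < p) (hp' : p < 3) (hω : 0 ≤ ω) (hQ : MemH1 (toC Q))
    (hδ : MemH1 (toC δ)) (hQ0 : ∀ x, 0 ≤ Q x) (hR0 : ∀ x, 0 ≤ Q x + δ x)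
    (hE : SolvesEL p ω Q) (hE' : SolvesEL p ω fun x => Q x + δ x)
    (hK : quartic (toC Q) ≤ K) (hK' : quartic (toC fun x => Q x + δ x) ≤ K) :
    gradEnergy (toC δ) ≤ (2 * p + (2 * p + 3) ^ 2 * (K * ladyConst)) * mass (toC δ) := by
  set R : Plane → ℝ := fun x => Q x + δ x with hRdef
  have hRc : toC R = fun x => toC Q x + toC δ x := by ext x; simp [R]
  have hR : MemH1 (toC R) := by rw [hRc]; exact hQ.add hδ
  have hK0 : 0 ≤ K := (quartic_nonneg _).trans hK
  set S := Real.sqrt K * Real.sqrt (quartic (toC δ)) with hS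
  have hS0 : 0 ≤ S := by positivity
  obtain ⟨iQ, bQ⟩ := integral_mul_sq_le hQ hδ hK
  obtain ⟨iR, bR⟩ := integral_mul_sq_le hR hδ hK'
  -- Both equations are tested with $\delta$ and subtracted. The nonlinear terms are bounded by
  -- $\int\delta^2$ and by $S$, the common bound for $\int Q^2\delta^2$ and $\int R^2\delta^2$.
  have h1 := hE δ hδ
  have h2 := hE' δ hδ
  have hδ2 := hδ.memLp_toC
  have e1 : gradDot (toC R) (toC δ) = gradDot (toC Q) (toC δ) + gradEnergy (toC δ) := by
    rw [hRc, gradDot_add_left hQ hδ, gradDot_self]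
  have e2 : ∫ x, R x * δ x = (∫ x, Q x * δ x) + mass (toC δ) := by
    have i1 : Integrable fun x => Q x * δ x := hQ.memLp_toC.integrable_mul hδ2
    rw [mass_toC, ← integral_add i1 hδ2.integrable_sq]
    congr 1; ext x; simp only [R]; ring
  have b3 : (∫ x, |R x| ^ (p - 1) * R x * δ x) - (∫ x, |Q x| ^ (p - 1) * Q x * δ x) ≤
      p * (mass (toC δ) + 2 * S) := by
    have j1 := (hasDerivAt_potential hp hp' hR hδ).1
    have j2 := (hasDerivAt_potential hp hp' hQ hδ).1
    have iRQ : Integrable fun x => R x ^ 2 * δ x ^ 2 + Q x ^ 2 * δ x ^ 2 := iR.add iQ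
    have j3 : Integrable fun x => δ x ^ 2 + (R x ^ 2 * δ x ^ 2 + Q x ^ 2 * δ x ^ 2) :=
      hδ2.integrable_sq.add iRQ
    rw [← integral_sub j1 j2]
    calc _ ≤ ∫ x, p * (δ x ^ 2 + (R x ^ 2 * δ x ^ 2 + Q x ^ 2 * δ x ^ 2)) := by
          refine integral_mono (j1.sub j2) (j3.const_mul p) fun x => ?_
          simp only []
          rw [abs_rpow_mul_self hp (hR0 x), abs_rpow_mul_self hp (hQ0 x), ← sub_mul]
          refine (le_abs_self _).trans ?_
          rw [abs_mul]
          have h3 := abs_rpow_sub_rpow_le hp.le (hR0 x) (hQ0 x)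
          have h4 : R x - Q x = δ x := by simp [R]
          rw [h4] at h3
          have h5 : max (R x) (Q x) ^ (p - 1) ≤ 1 + (R x ^ 2 + Q x ^ 2) := by
            refine (rpow_le_one_add_sq hp hp' ((hR0 x).trans (le_max_left _ _))).trans ?_
            rcases max_choice (R x) (Q x) with h | h <;> rw [h] <;>
              nlinarith [sq_nonneg (R x), sq_nonneg (Q x)]
          calc _ ≤ p * max (R x) (Q x) ^ (p - 1) * |δ x| * |δ x| := by gcongr
            _ ≤ p * (1 + (R x ^ 2 + Q x ^ 2)) * |δ x| * |δ x| := by gcongr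
            _ = p * (1 + (R x ^ 2 + Q x ^ 2)) * δ x ^ 2 := by rw [mul_assoc, ← sq, sq_abs]
            _ = _ := by ring
      _ = p * (mass (toC δ) + ((∫ x, R x ^ 2 * δ x ^ 2) + ∫ x, Q x ^ 2 * δ x ^ 2)) := by
          rw [integral_const_mul, mass_toC, ← integral_add iR iQ,
            ← integral_add hδ2.integrable_sq iRQ]
      _ ≤ _ := by gcongr; linarith
  have mQ := memLp_toC_mul hQ hδ
  have mR := memLp_toC_mul hR hδ
  have mδ := memLp_toC_mul hδ hδ
  have mS : MemLp (fun x => toC (fun x => R x * δ x) x + toC (fun x => Q x * δ x) x) 2 volume :=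
    mR.add mQ
  have massR : mass (toC fun x => R x * δ x) ≤ S := by
    rw [mass_toC]; simpa only [mul_pow] using bR
  have massQ : mass (toC fun x => Q x * δ x) ≤ S := by
    rw [mass_toC]; simpa only [mul_pow] using bQ
  have massδ : mass (toC fun x => δ x * δ x) = quartic (toC δ) := by
    rw [mass_toC]; unfold quartic
    congr 1; ext x
    rw [Complex.norm_real, Real.norm_eq_abs, Even.pow_abs (by decide)]; ring
  have b4 : nlForm (absSq (toC R)) (toC fun x => R x * δ x) -
      nlForm (absSq (toC Q)) (toC fun x => Q x * δ x) ≤ 3 * S := by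
    -- $R^2-Q^2=(R+Q)\delta$, so each piece of the nonlocal difference is a product controlled by
    -- $S$.
    have e3 : absSq (toC R) = fun x => absSq (toC Q) x +
        (toC (fun x => R x * δ x) x + toC (fun x => Q x * δ x) x) := by
      ext x
      simp only [absSq, toC, Complex.norm_real, Real.norm_eq_abs, sq_abs, ← Complex.ofReal_add]
      congr 1; simp only [R]; ring
    have e4 : (toC fun x => R x * δ x) = fun x => toC (fun x => Q x * δ x) x +
        toC (fun x => δ x * δ x) x := by
      ext x
      simp only [toC, ← Complex.ofReal_add]
      congr 1; simp only [R]; ring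
    have e5 : nlForm (absSq (toC R)) (toC fun x => R x * δ x) =
        nlForm (absSq (toC Q)) (toC fun x => Q x * δ x) +
        nlForm (absSq (toC Q)) (toC fun x => δ x * δ x) +
        nlForm (fun x => toC (fun x => R x * δ x) x + toC (fun x => Q x * δ x) x)
          (toC fun x => R x * δ x) := by
      rw [e3, nlForm_add_left hQ.memLp_absSq mS]
      congr 1
      rw [← nlForm_add_right mQ mδ, ← e4]
    have c1 := (le_abs_self _).trans (abs_nlForm_le hQ.memLp_absSq mδ)
    have c2 := (le_abs_self _).trans (abs_nlForm_le mS mR)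
    have c3 := mass_add_le mR mQ
    rw [mass_absSq, massδ] at c1
    have c4 : Real.sqrt (quartic (toC Q)) * Real.sqrt (quartic (toC δ)) ≤ S := by
      rw [hS]; gcongr
    have c5 : Real.sqrt (mass fun x => toC (fun x => R x * δ x) x + toC (fun x => Q x * δ x) x) *
        Real.sqrt (mass (toC fun x => R x * δ x)) ≤ 2 * S := by
      rw [← Real.sqrt_mul (mass_nonneg _)]
      refine Real.sqrt_le_iff.2 ⟨by positivity, ?_⟩
      calc _ ≤ (4 * S) * S := by
            have := mass_nonneg (toC fun x => R x * δ x)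
            gcongr; linarith
        _ = _ := by ring
    rw [e5]
    linarith
  have hmδ := mass_nonneg (toC δ)
  have hgδ := gradEnergy_nonneg (toC δ)
  -- The term $\omega\int\delta^2$ is nonnegative and is dropped. Since $S^2$ is at most a constant
  -- times $\int\delta^2\int|\nabla\delta|^2$, Young's inequality then absorbs $S$ into the left
  -- side.
  have main : gradEnergy (toC δ) ≤ p * mass (toC δ) + (2 * p + 3) * S := by
    rw [e1, e2] at h2
    have : 0 ≤ ω * mass (toC δ) := by positivity
    linarith
  have hSsq : S ^ 2 ≤ K * ladyConst * mass (toC δ) * gradEnergy (toC δ) := by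
    rw [hS, mul_pow, Real.sq_sqrt hK0, Real.sq_sqrt (quartic_nonneg _), mul_assoc, mul_assoc]
    have := hδ.quartic_le
    rw [mul_assoc] at this
    gcongr
  by_contra! hcon
  set G := gradEnergy (toC δ)
  set D := mass (toC δ)
  set c := 2 * p + 3
  have hG0 : 0 < G := by
    refine lt_of_le_of_lt ?_ hcon
    have := ladyConst_pos
    positivity
  have hc0 : 0 < c := by simp only [c]; linarith
  have h6 : c ^ 2 * S ^ 2 ≤ c ^ 2 * (K * ladyConst * D * G) := by gcongr
  nlinarith [sq_nonneg (G - c * S)]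

end DifferenceEstimate

/-! ### Integrable Fourier transforms from second differences. -/

section FourierIntegrability

variable {f : Plane → ℂ}

/-- A function with second differences of order `t²` in `L²` has integrable Fourier transform. -/
lemma integrable_FT_of_second_difference (hf : MemLp f 2 volume) {C : ℝ}
    (h : ∀ (i : Fin 2) (t : ℝ), mass (fun x => f (x + EuclideanSpace.single i t
      + EuclideanSpace.single i t) - f (x + EuclideanSpace.single i t)
      - (f (x + EuclideanSpace.single i t) - f x)) ≤ C * (t ^ 2) ^ 2) : Integrable (FT f) := by
  have h1 : ∀ i : Fin 2, Integrable
      (fun ξ : Plane => ((2 * Real.pi * |ξ i|) ^ 2) ^ 2 * ‖FT f ξ‖ ^ 2) := fun i => by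
    refine (integrable_of_diffSymbol_bound f i 2 (C := C) fun n => ?_).1
    have hD : MemLp (fun x => f (x + EuclideanSpace.single i (((n : ℝ) + 1)⁻¹)) - f x) 2 volume :=
      (MemLp.comp_add hf _).sub hf
    refine le_trans (le_of_eq ?_) (h i (((n : ℝ) + 1)⁻¹))
    rw [mass_translate_sub hD]
    refine integral_congr_ae ?_
    filter_upwards [FT_translate_sub hf i (((n : ℝ) + 1)⁻¹)] with ξ hξ
    rw [hξ, norm_mul]; ring
  have hsum : Integrable fun ξ : Plane => 3 * ((‖FT f ξ‖ ^ 2 +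
      ((2 * Real.pi * |ξ 0|) ^ 2) ^ 2 * ‖FT f ξ‖ ^ 2) +
      ((2 * Real.pi * |ξ 1|) ^ 2) ^ 2 * ‖FT f ξ‖ ^ 2) :=
    (((integrable_norm_sq (memLp_FT f)).add (h1 0)).add (h1 1)).const_mul 3
  have hmeas := (memLp_FT f).1
  have hA : MemLp (fun ξ : Plane => (1 + ‖ξ‖ ^ 2) * ‖FT f ξ‖) 2 volume := by
    have hm : AEStronglyMeasurable (fun ξ : Plane => (1 + ‖ξ‖ ^ 2) * ‖FT f ξ‖) volume :=
      (Continuous.aestronglyMeasurable (by fun_prop)).mul hmeas.norm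
    refine (memLp_two_iff_integrable_sq hm).2 (hsum.mono' (hm.pow 2)
      (Eventually.of_forall fun ξ => ?_))
    rw [Real.norm_of_nonneg (by positivity), EuclideanSpace.norm_sq_eq, Fin.sum_univ_two,
      Real.norm_eq_abs, Real.norm_eq_abs]
    have hpi : 1 ≤ 2 * Real.pi := by linarith [Real.pi_gt_three]
    have hle : ∀ a : ℝ, 0 ≤ a → (a ^ 2) ^ 2 ≤ ((2 * Real.pi * a) ^ 2) ^ 2 := fun a ha => by
      have : a ≤ 2 * Real.pi * a := by nlinarith
      gcongr
    have l0 := hle _ (abs_nonneg (ξ 0))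
    have l1 := hle _ (abs_nonneg (ξ 1))
    have l2 : (1 + (|ξ 0| ^ 2 + |ξ 1| ^ 2)) ^ 2 ≤
        3 * (1 + (|ξ 0| ^ 2) ^ 2 + (|ξ 1| ^ 2) ^ 2) := by
      nlinarith [sq_nonneg (|ξ 0| ^ 2 - |ξ 1| ^ 2), sq_nonneg (|ξ 0| ^ 2 - 1),
        sq_nonneg (|ξ 1| ^ 2 - 1)]
    calc _ = (1 + (|ξ 0| ^ 2 + |ξ 1| ^ 2)) ^ 2 * ‖FT f ξ‖ ^ 2 := by ring
      _ ≤ (3 * (1 + ((2 * Real.pi * |ξ 0|) ^ 2) ^ 2 + ((2 * Real.pi * |ξ 1|) ^ 2) ^ 2)) *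
          ‖FT f ξ‖ ^ 2 := by
          gcongr
          linarith
      _ = _ := by ring
  -- Square integrability of this weight is where dimension two enters; Cauchy–Schwarz against
  -- $(1+|\xi|^2)|\widehat f|\in L^2$ gives $\widehat f\in L^1$.
  have hB : MemLp (fun ξ : Plane => (1 + ‖ξ‖ ^ 2)⁻¹) 2 volume := by
    have hc : Continuous fun ξ : Plane => (1 + ‖ξ‖ ^ 2)⁻¹ :=
      Continuous.inv₀ (by fun_prop) fun ξ => by positivity
    refine (memLp_two_iff_integrable_sq hc.aestronglyMeasurable).2 ?_
    have := integrable_rpow_neg_one_add_norm_sq (E := Plane) (μ := volume) (r := 4) (by simp; norm_num)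
    refine this.congr (Eventually.of_forall fun ξ => ?_)
    have e : (-4 / 2 : ℝ) = -2 := by norm_num
    simp only [e]
    rw [Real.rpow_neg (by positivity), Real.rpow_two, inv_pow]
  refine ((hB.integrable_mul hA)).mono hmeas (Eventually.of_forall fun ξ => ?_)
  rw [Pi.mul_apply, inv_mul_cancel_left₀ (by positivity), norm_norm]

lemma exists_ae_bound_of_integrable_FT (hf : MemLp f 2 volume) (h : Integrable (FT f)) :
    ∃ B : ℝ, 0 ≤ B ∧ ∀ᵐ x, ‖f x‖ ≤ B := by
  refine ⟨∫ ξ, ‖FT f ξ‖, integral_nonneg fun ξ => norm_nonneg _, ?_⟩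
  filter_upwards [ae_eq_fourierInv_FT hf h] with x hx
  rw [hx, Real.fourierInv_eq]
  refine (norm_integral_le_integral_norm _).trans (le_of_eq ?_)
  congr 1; ext ξ
  rw [Circle.norm_smul]

/-- $E_1$ is a singular integral, so a bound on $f$ alone would not suffice. An integrable transform
does, because the symbol is bounded by $1$. -/
lemma exists_ae_bound_E1 (hf : MemLp f 2 volume) (h : Integrable (FT f)) :
    ∃ B : ℝ, 0 ≤ B ∧ ∀ᵐ x, ‖E1 f x‖ ≤ B := by
  refine exists_ae_bound_of_integrable_FT (memLp_E1 f) ?_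
  have h1 : Integrable fun ξ => (realSymbol ξ : ℂ) * FT f ξ := by
    refine h.bdd_mul (c := 1)
      (Complex.measurable_ofReal.comp measurable_realSymbol).aestronglyMeasurable
      (Eventually.of_forall fun ξ => ?_)
    rw [Complex.norm_real, Real.norm_of_nonneg (realSymbol_nonneg ξ)]
    exact realSymbol_le_one ξ
  exact h1.congr (FT_E1 hf).symm

end FourierIntegrability

/-! ### Regularity of nonnegative solutions. -/

section Regularity

variable {Q : Plane → ℝ} {p ω : ℝ}

lemma gradDot_comp_add {u v : Plane → ℂ} (hu : MemH1 u) (hv : MemH1 v) (h : Plane) :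
    gradDot (fun x => u (x + h)) (fun x => v (x + h)) = gradDot u v := by
  unfold gradDot
  refine Finset.sum_congr rfl fun i _ => ?_
  rw [dot_congr_right (weakPartial_comp_add hv h i), dot_comm,
    dot_congr_right (weakPartial_comp_add hu h i), dot_comm]
  exact integral_add_right_eq_self (fun x => (weakPartial i u x * conj (weakPartial i v x)).re) h

lemma SolvesEL.comp_add (hE : SolvesEL p ω Q) (hQ : MemH1 (toC Q)) (h : Plane) :
    SolvesEL p ω fun x => Q (x + h) := fun φ hφ => by
  set ψ : Plane → ℝ := fun x => φ (x + -h)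
  have hψ : MemH1 (toC ψ) := hφ.comp_add (-h)
  have e : φ = fun x => ψ (x + h) := by ext x; simp [ψ]
  have h0 := hE ψ hψ
  have h1 : gradDot (toC fun x => Q (x + h)) (toC fun x => ψ (x + h)) = gradDot (toC Q) (toC ψ) :=
    gradDot_comp_add hQ hψ h
  have h2 : ∫ x, Q (x + h) * ψ (x + h) = ∫ x, Q x * ψ x :=
    integral_add_right_eq_self (fun x => Q x * ψ x) h
  have h3 : ∫ x, |Q (x + h)| ^ (p - 1) * Q (x + h) * ψ (x + h) =
      ∫ x, |Q x| ^ (p - 1) * Q x * ψ x :=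
    integral_add_right_eq_self (fun x => |Q x| ^ (p - 1) * Q x * ψ x) h
  have h4 : nlForm (absSq (toC fun x => Q (x + h))) (toC fun x => Q (x + h) * ψ (x + h)) =
      nlForm (absSq (toC Q)) (toC fun x => Q x * ψ x) :=
    nlForm_comp_add hQ.memLp_absSq (memLp_toC_mul hQ hψ) h
  rw [e, h1, h2, h3, h4, h0]

lemma quartic_comp_add (u : Plane → ℂ) (h : Plane) : quartic (fun x => u (x + h)) = quartic u :=
  integral_add_right_eq_self (fun x => ‖u x‖ ^ 4) h

/-- First differences of a nonnegative solution are of order `t` in `H¹`. -/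
lemma SolvesEL.exists_difference_le (hp : 1 < p) (hp' : p < 3) (hω : 0 ≤ ω) (hQ : MemH1 (toC Q))
    (hQ0 : ∀ x, 0 ≤ Q x) (hE : SolvesEL p ω Q) :
    ∃ C : ℝ, 0 ≤ C ∧ ∀ (i : Fin 2) (t : ℝ),
      mass (toC fun x => Q (x + EuclideanSpace.single i t) - Q x) ≤ C * t ^ 2 ∧
      gradEnergy (toC fun x => Q (x + EuclideanSpace.single i t) - Q x) ≤ C * t ^ 2 := by
  set c := 2 * p + (2 * p + 3) ^ 2 * (quartic (toC Q) * ladyConst)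
  have hl := ladyConst_pos
  have hq := quartic_nonneg (toC Q)
  have hg := gradEnergy_nonneg (toC Q)
  have hc0 : 0 ≤ c := by positivity
  refine ⟨gradEnergy (toC Q) + c * gradEnergy (toC Q), by positivity, fun i t => ?_⟩
  set δ : Plane → ℝ := fun x => Q (x + EuclideanSpace.single i t) - Q x
  have hδc : toC δ = fun x => toC Q (x + EuclideanSpace.single i t) - toC Q x := by
    ext x; simp [δ]
  have hδ : MemH1 (toC δ) := by rw [hδc]; exact (hQ.comp_add _).sub hQ
  have hR : (fun x => Q x + δ x) = fun x => Q (x + EuclideanSpace.single i t) := by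
    ext x; simp [δ]
  have h1 : mass (toC δ) ≤ gradEnergy (toC Q) * t ^ 2 := by
    rw [hδc, mul_comm]
    exact (mass_translate_sub_le hQ i t).trans (by gcongr; exact mass_weakPartial_le i _)
  -- $Q$ and its translate solve the same equation and have the same quartic integral, so the
  -- constant does not depend on the step.
  have h2 := gradEnergy_le_of_solvesEL (K := quartic (toC Q)) hp hp' hω hQ hδ hQ0
    (fun x => by rw [congrFun hR x]; exact hQ0 _) hE (by rw [hR]; exact hE.comp_add hQ _) le_rfl
    (by rw [hR]; exact (quartic_comp_add (toC Q) _).le)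
  have h3 : c * mass (toC δ) ≤ c * (gradEnergy (toC Q) * t ^ 2) := by gcongr
  have h4 : 0 ≤ gradEnergy (toC Q) * t ^ 2 := by positivity
  have h5 : 0 ≤ c * (gradEnergy (toC Q) * t ^ 2) := by positivity
  constructor <;> linarith

/-- Nonnegative solutions have integrable Fourier transform, and so does their square. -/
lemma SolvesEL.integrable_FT (hp : 1 < p) (hp' : p < 3) (hω : 0 ≤ ω) (hQ : MemH1 (toC Q))
    (hQ0 : ∀ x, 0 ≤ Q x) (hE : SolvesEL p ω Q) :
    Integrable (FT (toC Q)) ∧ Integrable (FT (absSq (toC Q))) := by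
  obtain ⟨C, hC0, hC⟩ := hE.exists_difference_le hp hp' hω hQ hQ0
  have hδ : ∀ (i : Fin 2) (t : ℝ),
      MemH1 (toC fun x => Q (x + EuclideanSpace.single i t) - Q x) := fun i t => by
    have := (hQ.comp_add (EuclideanSpace.single i t)).sub hQ
    simp only [← Complex.ofReal_sub] at this
    exact this
  have hsec : ∀ (i : Fin 2) (t : ℝ), mass (toC fun x => Q (x + EuclideanSpace.single i t
      + EuclideanSpace.single i t) - Q (x + EuclideanSpace.single i t)
      - (Q (x + EuclideanSpace.single i t) - Q x)) ≤ C * (t ^ 2) ^ 2 := fun i t => by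
    -- Differencing $\delta$ once more costs another factor $t$ against $\nabla\delta$, which is
    -- already of order $t$.
    have h1 := mass_translate_sub_le (hδ i t) i t
    have h2 := (mass_weakPartial_le i _).trans (hC i t).2
    calc _ ≤ t ^ 2 * mass (weakPartial i (toC fun x => Q (x + EuclideanSpace.single i t) - Q x)) := by
          refine le_trans (le_of_eq ?_) h1
          congr 1; ext x
          simp only [toC, Complex.ofReal_sub]
      _ ≤ t ^ 2 * (C * t ^ 2) := by gcongr
      _ = _ := by ring
  have hI : Integrable (FT (toC Q)) := by
    refine integrable_FT_of_second_difference hQ.1 (C := C) fun i t => ?_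
    refine le_trans (le_of_eq ?_) (hsec i t)
    congr 1; ext x
    simp only [toC, Complex.ofReal_sub]
  refine ⟨hI, ?_⟩
  obtain ⟨B, hB0, hB⟩ := exists_ae_bound_of_integrable_FT hQ.1 hI
  refine integrable_FT_of_second_difference hQ.memLp_absSq
    (C := 3 * (4 * B ^ 2 * C + ladyConst * C * C + ladyConst * C * C)) fun i t => ?_
  set h : Plane := EuclideanSpace.single i t
  set δ : Plane → ℝ := fun x => Q (x + h) - Q x
  set D : Plane → ℝ := fun x => Q (x + h + h) - Q (x + h) - (Q (x + h) - Q x)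
  have hδi := hδ i t
  have hl := ladyConst_pos
  have hD2 : MemLp D 2 volume :=
    MemH1.memLp_toC (by
      have := (hδi.comp_add h).sub hδi
      simp only [← Complex.ofReal_sub] at this
      exact this)
  have hq : quartic (toC δ) ≤ ladyConst * C * C * (t ^ 2) ^ 2 := by
    have h1 := hδi.quartic_le
    have h2 := hC i t
    have h3 := gradEnergy_nonneg (toC δ)
    calc _ ≤ ladyConst * mass (toC δ) * gradEnergy (toC δ) := h1
      _ ≤ ladyConst * (C * t ^ 2) * (C * t ^ 2) := by
          gcongr
          exacts [h2.1, h2.2]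
      _ = _ := by ring
  have hq4 : ∀ u : Plane → ℝ, quartic (toC u) = ∫ x, u x ^ 4 := fun u => by
    unfold quartic
    congr 1; ext x
    rw [Complex.norm_real, Real.norm_eq_abs, Even.pow_abs (by decide)]
  have i4 : ∀ {u : Plane → ℝ}, MemH1 (toC u) → Integrable fun x => u x ^ 4 := fun {u} hu => by
    refine hu.integrable_quartic.congr (Eventually.of_forall fun x => ?_)
    simp only [Complex.norm_real, Real.norm_eq_abs]
    rw [Even.pow_abs (by decide)]
  have hδs : MemH1 (toC fun x => δ (x + h)) := hδi.comp_add h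
  have hq' : quartic (toC fun x => δ (x + h)) = quartic (toC δ) := quartic_comp_add (toC δ) h
  have hBs : ∀ᵐ x, |Q (x + h)| ≤ B := by
    have := (measurePreserving_add_right (volume : Measure Plane) h).quasiMeasurePreserving.ae hB
    simpa using this
  have iD := (hD2.integrable_sq.const_mul (4 * B ^ 2))
  have iA : Integrable fun x => 4 * B ^ 2 * D x ^ 2 + δ (x + h) ^ 4 := iD.add (i4 hδs)
  have iS : Integrable fun x => 3 * (4 * B ^ 2 * D x ^ 2 + δ (x + h) ^ 4 + δ x ^ 4) :=
    (iA.add (i4 hδi)).const_mul 3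
  unfold mass
  calc _ ≤ ∫ x, 3 * (4 * B ^ 2 * D x ^ 2 + δ (x + h) ^ 4 + δ x ^ 4) := by
        refine integral_mono_of_nonneg (Eventually.of_forall fun x => by positivity) iS ?_
        filter_upwards [hBs] with x hx
        -- Discrete Leibniz rule for the second difference of $Q^2$. The first term uses the bound
        -- on $Q$; by Ladyzhenskaya's inequality the squares of $\delta^2$ integrate to $O(t^4)$.
        have e : absSq (toC Q) (x + h + h) - absSq (toC Q) (x + h)
            - (absSq (toC Q) (x + h) - absSq (toC Q) x) =
            ((2 * Q (x + h) * D x + δ (x + h) ^ 2 + δ x ^ 2 : ℝ) : ℂ) := by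
          simp only [absSq, Complex.norm_real, Real.norm_eq_abs, sq_abs, ← Complex.ofReal_sub]
          congr 1
          simp only [D, δ]; ring
        rw [e, Complex.norm_real, Real.norm_eq_abs, sq_abs]
        have h1 : Q (x + h) ^ 2 ≤ B ^ 2 := by rw [← sq_abs]; gcongr
        have h2 : (2 * Q (x + h) * D x) ^ 2 ≤ 4 * B ^ 2 * D x ^ 2 := by
          calc _ = 4 * Q (x + h) ^ 2 * D x ^ 2 := by ring
            _ ≤ _ := by gcongr
        set α := 2 * Q (x + h) * D x
        set β := δ (x + h) ^ 2
        set γ := δ x ^ 2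
        have h3 : (α + β + γ) ^ 2 ≤ 3 * (α ^ 2 + β ^ 2 + γ ^ 2) := by
          nlinarith [sq_nonneg (α - β), sq_nonneg (β - γ), sq_nonneg (α - γ)]
        have h4 : β ^ 2 = δ (x + h) ^ 4 := by simp only [β]; ring
        have h5 : γ ^ 2 = δ x ^ 4 := by simp only [γ]; ring
        linarith
    _ = 3 * (4 * B ^ 2 * mass (toC D) + quartic (toC fun x => δ (x + h)) + quartic (toC δ)) := by
        rw [integral_const_mul, integral_add iA (i4 hδi), integral_add iD (i4 hδs),
          integral_const_mul, mass_toC, hq4, hq4]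
    _ ≤ 3 * (4 * B ^ 2 * (C * (t ^ 2) ^ 2) + ladyConst * C * C * (t ^ 2) ^ 2
          + ladyConst * C * C * (t ^ 2) ^ 2) := by
        have h1 : mass (toC D) ≤ C * (t ^ 2) ^ 2 := hsec i t
        rw [hq']
        gcongr
    _ = _ := by ring

end Regularity

/-! ### The heat kernel as an element of $H^1$. -/

section HeatKernel

lemma integrable_gaussian {b : ℝ} (hb : 0 < b) :
    Integrable fun v : Plane => Real.exp (-b * ‖v‖ ^ 2) := by
  have h := GaussianFourier.integrable_cexp_neg_mul_sq_norm_add (V := Plane) (b := (b : ℂ))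
    (by simpa using hb) 0 0
  have h' := h.re
  refine h'.congr (Eventually.of_forall fun v => ?_)
  simp only [zero_mul, add_zero, RCLike.re_eq_complex_re]
  rw [← Complex.ofReal_re (Real.exp _)]
  push_cast
  rfl

lemma memLp_gaussian {b : ℝ} (hb : 0 < b) :
    MemLp (fun v : Plane => Real.exp (-b * ‖v‖ ^ 2)) 2 volume := by
  have hc : Continuous fun v : Plane => Real.exp (-b * ‖v‖ ^ 2) := by fun_prop
  refine (memLp_two_iff_integrable_sq hc.aestronglyMeasurable).2 ?_
  refine (integrable_gaussian (b := 2 * b) (by linarith)).congr (Eventually.of_forall fun v => ?_)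
  simp only []
  rw [← Real.exp_nat_mul]
  congr 1; push_cast; ring

/-- The heat kernel of the plane. -/
def heat (t : ℝ) (v : Plane) : ℝ := (4 * Real.pi * t)⁻¹ * Real.exp (-(4 * t)⁻¹ * ‖v‖ ^ 2)

variable {t : ℝ}

lemma heat_pos (ht : 0 < t) (v : Plane) : 0 < heat t v := by
  unfold heat
  positivity

lemma memLp_heat (ht : 0 < t) : MemLp (toC (heat t)) 2 volume :=
  ((memLp_gaussian (b := (4 * t)⁻¹) (by positivity)).const_mul _).ofReal

lemma FT_heat (ht : 0 < t) : FT (toC (heat t)) =ᵐ[volume]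
    fun ξ => ((Real.exp (-(4 * Real.pi ^ 2 * t) * ‖ξ‖ ^ 2) : ℝ) : ℂ) := by
  have hi : Integrable (toC (heat t)) :=
    ((integrable_gaussian (b := (4 * t)⁻¹) (by positivity)).const_mul _).ofReal
  refine (FT_eq_fourier (memLp_heat ht) hi).trans (Eventually.of_forall fun ξ => ?_)
  have h := fourier_gaussian_innerProductSpace (V := Plane) (b := (((4 * t)⁻¹ : ℝ) : ℂ))
    (by rw [Complex.ofReal_re]; positivity) ξ
  have e : toC (heat t) = (((4 * Real.pi * t)⁻¹ : ℝ) : ℂ) •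
      fun v : Plane => Complex.exp (-(((4 * t)⁻¹ : ℝ) : ℂ) * ‖v‖ ^ 2) := by
    ext v
    simp only [toC, heat, Pi.smul_apply, smul_eq_mul]
    push_cast
    ring_nf
  rw [e]
  have e2 : 𝓕 ((((4 * Real.pi * t)⁻¹ : ℝ) : ℂ) •
      fun v : Plane => Complex.exp (-(((4 * t)⁻¹ : ℝ) : ℂ) * ‖v‖ ^ 2)) ξ =
      (((4 * Real.pi * t)⁻¹ : ℝ) : ℂ) *
        𝓕 (fun v : Plane => Complex.exp (-(((4 * t)⁻¹ : ℝ) : ℂ) * ‖v‖ ^ 2)) ξ := by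
    rw [Real.fourier_eq, Real.fourier_eq, ← integral_const_mul]
    congr 1; ext v
    rw [Pi.smul_apply, smul_comm, smul_eq_mul]
  rw [e2, h]
  have ht' : (t : ℂ) ≠ 0 := by exact_mod_cast ht.ne'
  have hpi : (Real.pi : ℂ) ≠ 0 := by exact_mod_cast Real.pi_ne_zero
  have e3 : (Module.finrank ℝ Plane / 2 : ℂ) = 1 := by simp
  rw [e3, Complex.cpow_one]
  push_cast
  have e4 : (4 * (Real.pi : ℂ) * t)⁻¹ * (Real.pi / (4 * (t : ℂ))⁻¹) = 1 := by field_simp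
  rw [← mul_assoc, e4, one_mul]
  congr 1
  field_simp

/-- Half of the decay absorbs the polynomial factor, so $\xi_i$ times the Gaussian is dominated by a
wider Gaussian. -/
lemma one_add_mul_exp_le {c r : ℝ} (hc : 0 < c) (hr : 0 ≤ r) :
    (1 + r) * Real.exp (-c * r) ≤ (1 + 2 / c) * Real.exp (-(c / 2) * r) := by
  have h1 : 1 + r ≤ (1 + 2 / c) * (1 + c / 2 * r) := by
    have e : (1 + 2 / c) * (1 + c / 2 * r) = 1 + r + (2 / c + c / 2 * r) := by field_simp; ring
    have : 0 ≤ 2 / c + c / 2 * r := by positivity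
    linarith
  have h2 : 1 + c / 2 * r ≤ Real.exp (c / 2 * r) := by linarith [Real.add_one_le_exp (c / 2 * r)]
  calc _ ≤ (1 + 2 / c) * Real.exp (c / 2 * r) * Real.exp (-c * r) := by
        gcongr
        exact h1.trans (by gcongr)
    _ = _ := by rw [mul_assoc, ← Real.exp_add]; ring_nf

lemma memH1_heat (ht : 0 < t) : MemH1 (toC (heat t)) := by
  refine memH1_of_FT (memLp_heat ht) fun i => ?_
  set c := 4 * Real.pi ^ 2 * t
  have hc : 0 < c := by positivity
  have h1 : MemLp (fun ξ : Plane => (ξ i : ℂ) * ((Real.exp (-c * ‖ξ‖ ^ 2) : ℝ) : ℂ)) 2 volume := by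
    have hcont : Continuous fun ξ : Plane => (ξ i : ℂ) * ((Real.exp (-c * ‖ξ‖ ^ 2) : ℝ) : ℂ) := by
      fun_prop
    refine ((memLp_gaussian (b := c / 2) (by positivity)).const_mul (1 + 2 / c)).mono
      hcont.aestronglyMeasurable (Eventually.of_forall fun ξ => ?_)
    rw [norm_mul, Complex.norm_real, Complex.norm_real, Real.norm_of_nonneg (Real.exp_pos _).le,
      Real.norm_of_nonneg (mul_nonneg (by positivity) (Real.exp_pos _).le :
        0 ≤ (1 + 2 / c) * Real.exp (-(c / 2) * ‖ξ‖ ^ 2))]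
    refine le_trans ?_ (one_add_mul_exp_le hc (sq_nonneg ‖ξ‖))
    have h2 : ‖ξ i‖ ≤ ‖ξ‖ := PiLp.norm_apply_le ξ i
    gcongr
    nlinarith [sq_nonneg (‖ξ‖ - 1)]
  refine h1.ae_eq ?_
  filter_upwards [FT_heat ht] with ξ hξ
  rw [hξ]

end HeatKernel

/-! ### Positivity by monotonicity along the heat flow. -/

section Positivity

/-- Differentiation of a superposition of decaying exponentials. -/
lemma hasDerivAt_integral_mul_exp {a l : Plane → ℝ} (ha : Integrable a) (hl : Continuous l)
    (hl0 : ∀ ξ, 0 ≤ l ξ) {t : ℝ} (ht : 0 < t) :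
    HasDerivAt (fun s => ∫ ξ, a ξ * Real.exp (-s * l ξ))
      (- ∫ ξ, a ξ * (l ξ * Real.exp (-t * l ξ))) t := by
  have hm : ∀ s : ℝ, AEStronglyMeasurable (fun ξ => a ξ * Real.exp (-s * l ξ)) volume := fun s =>
    ha.1.mul (Continuous.aestronglyMeasurable (by fun_prop))
  have h := hasDerivAt_integral_of_dominated_loc_of_deriv_le
    (F := fun s ξ => a ξ * Real.exp (-s * l ξ))
    (F' := fun s ξ => -(a ξ * (l ξ * Real.exp (-s * l ξ)))) (x₀ := t) (s := Set.Ioi (t / 2))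
    (μ := (volume : Measure Plane)) (bound := fun ξ => 2 / t * |a ξ|)
    (Ioi_mem_nhds (by linarith)) (Eventually.of_forall hm) ?_ ?_
    (Eventually.of_forall fun ξ s hs => ?_) (ha.abs.const_mul _)
    (Eventually.of_forall fun ξ s hs => ?_)
  · have := h.2
    rwa [integral_neg] at this
  · refine ha.mono (hm t) (Eventually.of_forall fun ξ => ?_)
    rw [norm_mul, Real.norm_of_nonneg (Real.exp_pos _).le]
    refine mul_le_of_le_one_right (norm_nonneg _) (Real.exp_le_one_iff.2 ?_)
    have := mul_nonneg ht.le (hl0 ξ)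
    linarith
  · exact (ha.1.mul (Continuous.aestronglyMeasurable (by fun_prop))).neg
  · rw [norm_neg, norm_mul, Real.norm_eq_abs, mul_comm]
    rw [Real.norm_of_nonneg (mul_nonneg (hl0 ξ) (Real.exp_pos _).le)]
    refine mul_le_mul_of_nonneg_right ?_ (abs_nonneg _)
    -- Gives $l\,e^{-sl}\le2/t$ uniformly for $s>t/2$, so the dominating function only needs $a\in
    -- L^1$.
    have h1 : t / 2 * l ξ ≤ Real.exp (s * l ξ) := by
      have := Real.add_one_le_exp (s * l ξ)
      have := mul_le_mul_of_nonneg_right (le_of_lt hs) (hl0 ξ)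
      linarith
    rw [neg_mul, Real.exp_neg, ← div_eq_mul_inv, div_le_iff₀ (Real.exp_pos _)]
    calc l ξ = 2 / t * (t / 2 * l ξ) := by field_simp
      _ ≤ _ := by gcongr
  · have h1 : HasDerivAt (fun s : ℝ => -s * l ξ) (-1 * l ξ) s :=
      (hasDerivAt_id s).neg.mul_const (l ξ)
    refine (h1.exp.const_mul (a ξ)).congr_deriv ?_
    ring

lemma continuousOn_integral_mul_exp {a l : Plane → ℝ} (ha : Integrable a) (hl : Continuous l)
    (hl0 : ∀ ξ, 0 ≤ l ξ) :
    ContinuousOn (fun s => ∫ ξ, a ξ * Real.exp (-s * l ξ)) (Set.Ici 0) := by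
  refine continuousOn_of_dominated (bound := fun ξ => |a ξ|) (fun s _ => ?_)
    (fun s hs => Eventually.of_forall fun ξ => ?_) ha.abs (Eventually.of_forall fun ξ => ?_)
  · exact ha.1.mul (Continuous.aestronglyMeasurable (by fun_prop))
  · rw [norm_mul, Real.norm_of_nonneg (Real.exp_pos _).le, Real.norm_eq_abs]
    refine mul_le_of_le_one_right (abs_nonneg _) (Real.exp_le_one_iff.2 ?_)
    have := mul_nonneg (Set.mem_Ici.1 hs) (hl0 ξ)
    linarith
  · exact Continuous.continuousOn (by fun_prop)

variable {Q : Plane → ℝ} {p ω : ℝ}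

lemma dot_eq_FT {f g : Plane → ℂ} (hf : MemLp f 2 volume) (hg : MemLp g 2 volume) :
    dot f g = ∫ ξ, (FT f ξ * conj (FT g ξ)).re := by
  have h := congrArg Complex.re (integral_FT_mul_conj hf hg)
  have h1 : ∫ x, (f x * conj (g x)).re = (∫ x, f x * conj (g x)).re :=
    integral_re (𝕜 := ℂ) (integrable_mul_conj hf hg)
  have h2 : ∫ ξ, (FT f ξ * conj (FT g ξ)).re = (∫ ξ, FT f ξ * conj (FT g ξ)).re :=
    integral_re (𝕜 := ℂ) (integrable_mul_conj (memLp_FT f) (memLp_FT g))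
  unfold dot
  rw [h1, h2, h]

lemma integral_mul_heat (hQ : MemH1 (toC Q)) {t : ℝ} (ht : 0 < t) :
    ∫ x, Q x * heat t x =
      ∫ ξ, (FT (toC Q) ξ).re * Real.exp (-(4 * Real.pi ^ 2 * t) * ‖ξ‖ ^ 2) := by
  rw [← dot_toC, dot_eq_FT hQ.1 (memLp_heat ht)]
  refine integral_congr_ae ?_
  filter_upwards [FT_heat ht] with ξ hξ
  rw [hξ, Complex.conj_ofReal, Complex.re_mul_ofReal]

lemma gradDot_heat (hQ : MemH1 (toC Q)) {t : ℝ} (ht : 0 < t) :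
    gradDot (toC Q) (toC (heat t)) = ∫ ξ, (FT (toC Q) ξ).re *
      (4 * Real.pi ^ 2 * ‖ξ‖ ^ 2 * Real.exp (-(4 * Real.pi ^ 2 * t) * ‖ξ‖ ^ 2)) := by
  unfold gradDot
  have h1 : ∀ i, dot (weakPartial i (toC Q)) (weakPartial i (toC (heat t))) =
      ∫ ξ, (FT (weakPartial i (toC Q)) ξ * conj (FT (weakPartial i (toC (heat t))) ξ)).re :=
    fun i => dot_eq_FT (memLp_weakPartial i _) (memLp_weakPartial i _)
  simp only [h1]
  rw [← integral_finsetSum _ fun i _ => integrable_dot (memLp_FT _) (memLp_FT _)]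
  refine integral_congr_ae ?_
  filter_upwards [FT_heat ht, hQ.FT_weakPartial 0, hQ.FT_weakPartial 1,
    (memH1_heat ht).FT_weakPartial 0, (memH1_heat ht).FT_weakPartial 1] with ξ h h2 h3 h4 h5
  rw [Fin.sum_univ_two, h2, h3, h4, h5, h, EuclideanSpace.norm_sq_eq ξ, Fin.sum_univ_two,
    Real.norm_eq_abs, Real.norm_eq_abs, sq_abs, sq_abs]
  set E := Real.exp (-(4 * Real.pi ^ 2 * t) * (ξ 0 ^ 2 + ξ 1 ^ 2))
  have e : ∀ s : ℝ, 2 * (Real.pi : ℂ) * Complex.I * (s : ℂ) * FT (toC Q) ξ *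
      conj (2 * (Real.pi : ℂ) * Complex.I * (s : ℂ) * (E : ℂ)) =
      FT (toC Q) ξ * ((4 * Real.pi ^ 2 * s ^ 2 * E : ℝ) : ℂ) := fun s => by
    simp only [map_mul, Complex.conj_ofReal, Complex.conj_I, map_ofNat]
    push_cast
    linear_combination (-4 * (Real.pi : ℂ) ^ 2 * s ^ 2 * E * FT (toC Q) ξ) * Complex.I_sq
  rw [e, e, Complex.re_mul_ofReal, Complex.re_mul_ofReal]
  ring

/-- Tests $-\Delta Q+(\omega+B)Q\ge0$ with the heat kernel. The power term is nonnegative; the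
nonlocal potential has no sign, but is at least $-B$. -/
lemma SolvesEL.heat_nonneg (hQ : MemH1 (toC Q)) (hQ0 : ∀ x, 0 ≤ Q x) (hE : SolvesEL p ω Q) {B : ℝ}
    (hB : ∀ᵐ x, ‖E1 (absSq (toC Q)) x‖ ≤ B) {t : ℝ} (ht : 0 < t) :
    0 ≤ (ω + B) * (∫ x, Q x * heat t x) + gradDot (toC Q) (toC (heat t)) := by
  have hh := memH1_heat ht
  have h1 := hE _ hh
  have hq := memLp_toC_mul hQ hh
  have h2 : 0 ≤ ∫ x, |Q x| ^ (p - 1) * Q x * heat t x := integral_nonneg fun x =>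
    mul_nonneg (mul_nonneg (by positivity) (hQ0 x)) (heat_pos ht x).le
  have i1 : Integrable fun x => Q x * heat t x := hQ.memLp_toC.integrable_mul hh.memLp_toC
  have h3 : -(B * ∫ x, Q x * heat t x) ≤
      nlForm (absSq (toC Q)) (toC fun x => Q x * heat t x) := by
    rw [← integral_E1_mul_re hQ.memLp_absSq hq (fun x => Complex.conj_ofReal _),
      ← integral_const_mul, ← integral_neg]
    refine integral_mono_ae (i1.const_mul B).neg ((memLp_E1 _).integrable_mul hq).re ?_
    filter_upwards [hB] with x hx
    have h4 := (abs_le.1 ((Complex.abs_re_le_norm (E1 (absSq (toC Q)) x)).trans hx)).1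
    have h5 := mul_nonneg (hQ0 x) (heat_pos ht x).le
    simp only [toC, Complex.re_mul_ofReal]
    nlinarith
  linarith

/-- A continuous nonnegative solution is positive at the origin. -/
lemma SolvesEL.pos_zero (hp : 1 < p) (hp' : p < 3) (hω : 0 ≤ ω) (hc : Continuous Q)
    (hQ : MemH1 (toC Q)) (hQ0 : ∀ x, 0 ≤ Q x) (hm : 0 < mass (toC Q)) (hE : SolvesEL p ω Q) :
    0 < Q 0 := by
  obtain ⟨hI, hI2⟩ := hE.integrable_FT hp hp' hω hQ hQ0
  obtain ⟨B, hB0, hB⟩ := exists_ae_bound_E1 hQ.memLp_absSq hI2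
  -- With $l=\omega+B+4\pi^2|\xi|^2$, the integral of $a\,e^{-sl}$ is the value at the origin of
  -- $e^{-s(\omega+B)}e^{s\Delta}Q$.
  set a : Plane → ℝ := fun ξ => (FT (toC Q) ξ).re
  have ha : Integrable a := hI.re
  set l : Plane → ℝ := fun ξ => (ω + B) + 4 * Real.pi ^ 2 * ‖ξ‖ ^ 2
  have hl : Continuous l := by fun_prop
  have hl0 : ∀ ξ, 0 ≤ l ξ := fun ξ => by positivity
  have hexp : ∀ t ξ, Real.exp (-t * l ξ) =
      Real.exp (-t * (ω + B)) * Real.exp (-(4 * Real.pi ^ 2 * t) * ‖ξ‖ ^ 2) := fun t ξ => by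
    rw [← Real.exp_add]; congr 1; simp only [l]; ring
  have hderiv : ∀ t : ℝ, 0 < t → 0 ≤ ∫ ξ, a ξ * (l ξ * Real.exp (-t * l ξ)) := fun t ht => by
    have h1 := hE.heat_nonneg hQ hQ0 hB ht
    rw [integral_mul_heat hQ ht, gradDot_heat hQ ht, ← integral_const_mul] at h1
    have b1 : Integrable fun ξ => (ω + B) * (a ξ * Real.exp (-(4 * Real.pi ^ 2 * t) * ‖ξ‖ ^ 2)) := by
      refine Integrable.const_mul (ha.mul_bdd (c := 1)
        (Continuous.aestronglyMeasurable (by fun_prop)) (Eventually.of_forall fun ξ => ?_)) _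
      rw [Real.norm_of_nonneg (Real.exp_pos _).le, Real.exp_le_one_iff]
      have : 0 ≤ 4 * Real.pi ^ 2 * t * ‖ξ‖ ^ 2 := by positivity
      linarith
    have b2 : Integrable fun ξ => a ξ * (4 * Real.pi ^ 2 * ‖ξ‖ ^ 2 *
        Real.exp (-(4 * Real.pi ^ 2 * t) * ‖ξ‖ ^ 2)) := by
      refine ha.mul_bdd (c := t⁻¹)
        (Continuous.aestronglyMeasurable (by fun_prop)) (Eventually.of_forall fun ξ => ?_)
      rw [Real.norm_of_nonneg (by positivity), neg_mul, Real.exp_neg, ← div_eq_mul_inv,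
        div_le_iff₀ (Real.exp_pos _)]
      have := Real.add_one_le_exp (4 * Real.pi ^ 2 * t * ‖ξ‖ ^ 2)
      calc 4 * Real.pi ^ 2 * ‖ξ‖ ^ 2 = t⁻¹ * (4 * Real.pi ^ 2 * t * ‖ξ‖ ^ 2) := by field_simp
        _ ≤ _ := by gcongr; linarith
    rw [← integral_add b1 b2] at h1
    have e : ∫ ξ, a ξ * (l ξ * Real.exp (-t * l ξ)) = Real.exp (-t * (ω + B)) *
        ∫ ξ, ((ω + B) * (a ξ * Real.exp (-(4 * Real.pi ^ 2 * t) * ‖ξ‖ ^ 2)) +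
          a ξ * (4 * Real.pi ^ 2 * ‖ξ‖ ^ 2 * Real.exp (-(4 * Real.pi ^ 2 * t) * ‖ξ‖ ^ 2))) := by
      rw [← integral_const_mul]
      congr 1; ext ξ
      rw [hexp]; simp only [l]; ring
    rw [e]
    exact mul_nonneg (Real.exp_pos _).le h1
  have hanti : AntitoneOn (fun s => ∫ ξ, a ξ * Real.exp (-s * l ξ)) (Set.Ici 0) := by
    refine antitoneOn_of_deriv_nonpos (convex_Ici 0) (continuousOn_integral_mul_exp ha hl hl0)
      (fun t ht => ?_) (fun t ht => ?_)
    · rw [interior_Ici] at ht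
      exact (hasDerivAt_integral_mul_exp ha hl hl0 ht).differentiableAt.differentiableWithinAt
    · rw [interior_Ici] at ht
      rw [(hasDerivAt_integral_mul_exp ha hl hl0 ht).deriv]
      linarith [hderiv t ht]
  have h01 := hanti (Set.mem_Ici.2 le_rfl) (Set.mem_Ici.2 zero_le_one) zero_le_one
  simp only [neg_zero, zero_mul, Real.exp_zero, mul_one] at h01
  -- Fourier inversion holds a priori almost everywhere; continuity of both sides makes it valid at
  -- the origin.
  have hzero : ∫ ξ, a ξ = Q 0 := by
    have h1 := ae_eq_fourierInv_FT hQ.1 hI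
    have hcont := continuous_fourierInv hI
    have h2 := (Continuous.ae_eq_iff_eq volume (Complex.continuous_ofReal.comp hc) hcont).1 h1
    have h3 := congrFun h2 0
    rw [Real.fourierInv_eq] at h3
    simp only [inner_zero_right, AddChar.map_zero_eq_one, one_smul, Function.comp] at h3
    have h4 : ∫ ξ, a ξ = (∫ ξ, FT (toC Q) ξ).re := integral_re (𝕜 := ℂ) hI
    rw [h4, ← h3, Complex.ofReal_re]
  have hone : 0 < ∫ ξ, a ξ * Real.exp (-1 * l ξ) := by
    have e : ∫ ξ, a ξ * Real.exp (-1 * l ξ) = Real.exp (-1 * (ω + B)) * ∫ x, Q x * heat 1 x := by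
      rw [integral_mul_heat hQ one_pos, ← integral_const_mul]
      congr 1; ext ξ
      rw [hexp]; ring
    rw [e]
    refine mul_pos (Real.exp_pos _) ?_
    have i1 : Integrable fun x => Q x * heat 1 x :=
      hQ.memLp_toC.integrable_mul (memH1_heat one_pos).memLp_toC
    have hnn : ∀ x, 0 ≤ Q x * heat 1 x := fun x => mul_nonneg (hQ0 x) (heat_pos one_pos x).le
    refine (integral_nonneg hnn).lt_of_ne fun h0 => hm.ne' ?_
    rw [mass_eq_zero_iff hQ.1]
    have h1 := (integral_eq_zero_iff_of_nonneg hnn i1).1 h0.symm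
    filter_upwards [h1] with x hx
    rcases mul_eq_zero.1 hx with h | h
    · simp [h]
    · exact absurd h (heat_pos one_pos x).ne'
  rw [hzero] at h01
  linarith

lemma SolvesEL.pos (hp : 1 < p) (hp' : p < 3) (hω : 0 ≤ ω) (hc : Continuous Q)
    (hQ : MemH1 (toC Q)) (hQ0 : ∀ x, 0 ≤ Q x) (hm : 0 < mass (toC Q)) (hE : SolvesEL p ω Q)
    (x : Plane) : 0 < Q x := by
  have h := (hE.comp_add hQ x).pos_zero hp hp' hω (hc.comp (continuous_add_const x))
    (hQ.comp_add x) (fun y => hQ0 _) (hm.trans_eq (mass_comp_add (toC Q) x).symm)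
  simpa using h

/-- A nonnegative function with integrable Fourier transform has a continuous nonnegative
representative. -/
lemma exists_continuous_representative (hQ : MemLp (toC Q) 2 volume) (hQ0 : ∀ x, 0 ≤ Q x)
    (hI : Integrable (FT (toC Q))) :
    ∃ R : Plane → ℝ, Continuous R ∧ (∀ x, 0 ≤ R x) ∧ toC Q =ᵐ[volume] toC R := by
  have hcont := continuous_fourierInv hI
  -- Taking the absolute value makes the representative nonnegative everywhere without changing it
  -- almost everywhere.
  refine ⟨fun x => |(𝓕⁻ (FT (toC Q)) x).re|, (Complex.continuous_re.comp hcont).abs,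
    fun x => abs_nonneg _, ?_⟩
  filter_upwards [ae_eq_fourierInv_FT hQ hI] with x hx
  simp only [toC]
  rw [← hx, Complex.ofReal_re, abs_of_nonneg (hQ0 x)]

end Positivity

/-! ### Assembly. -/

section Main

variable {p m d : ℝ}

/-- A nonnegative minimizer is replaced by its continuous representative, which is again a
minimizer. The Euler–Lagrange equation is derived anew for it, so that positivity holds at every
point. -/
lemma exists_positive_minimizer (hp : 1 < p) (hp' : p < 3) (hm : 0 < m) (hm' : m < 2 * dJ)
    (hdm : dm p m = d) (hd0 : d < 0) (hd : ∀ u ∈ constraintSet m, d ≤ energy p u)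
    (happ : ∀ ε > 0, ∃ u ∈ constraintSet m, energy p u < d + ε) :
    ∃ Q : Plane → ℝ, IsPositiveMinimizer p m Q := by
  obtain ⟨Q, hQ0, hQ, hE⟩ := exists_nonneg_minimizer hp hp' hm hm' hd0 hd happ
  have hsol : ∀ {R : Plane → ℝ}, toC R ∈ constraintSet m → energy p (toC R) = d →
      SolvesEL p (multiplier p m (toC R)) R ∧ 0 ≤ multiplier p m (toC R) := fun {R} hR hER =>
    ⟨fun φ hφ => euler_lagrange hp hp' hm hd hR hER hφ,
      (multiplier_pos hp hm hR.1 (hER.trans_lt hd0)).le⟩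
  obtain ⟨hEL, hω⟩ := hsol hQ hE
  obtain ⟨R, hRc, hR0, hQR⟩ := exists_continuous_representative hQ.1.1 hQ0
    (hEL.integrable_FT hp hp' hω hQ.1 hQ0).1
  have hR : toC R ∈ constraintSet m := ⟨hQ.1.congr hQR, (mass_congr hQR).symm.trans hQ.2⟩
  have hER : energy p (toC R) = d := (energy_congr hQR hQ.1).symm.trans hE
  obtain ⟨hELR, hωR⟩ := hsol hR hER
  refine ⟨R, hRc, hELR.pos hp hp' hωR hRc hR.1 hR0 (hm.trans_eq hR.2.symm), hR, ?_⟩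
  rw [hdm]
  exact congrArg _ hER

end Main

end DaveyStewartson

end

theorem theorem3p3 (p m : ℝ) (hp : 1 < p) (hp' : p < 3) (hm : 0 < m)
    (hm' : m < 2 * DaveyStewartson.dJ) :
    (⊥ < DaveyStewartson.dm p m ∧ DaveyStewartson.dm p m < 0) ∧
    (∃ Q : DaveyStewartson.Plane → ℝ, DaveyStewartson.IsPositiveMinimizer p m Q) ∧
    ∀ Q : DaveyStewartson.Plane → ℝ, DaveyStewartson.IsPositiveMinimizer p m Q →
      ∃ ω : ℝ, 0 < ω ∧ DaveyStewartson.IsSolution p ω (fun x => (Q x : ℂ)) ∧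
        ∀ ω' : ℝ, DaveyStewartson.IsSolution p ω' (fun x => (Q x : ℂ)) → ω' = ω := by
  obtain ⟨d, hdm, hd0, hd, happ⟩ := DaveyStewartson.exists_dm_eq hp hp' hm hm'
  refine ⟨⟨?_, ?_⟩, DaveyStewartson.exists_positive_minimizer hp hp' hm hm' hdm hd0 hd happ,
    fun Q hQ => ?_⟩
  · rw [hdm]; exact EReal.bot_lt_coe d
  · rw [hdm]; exact_mod_cast hd0
  · have hE : DaveyStewartson.energy p (DaveyStewartson.toC Q) = d := by
      have h := hQ.energy_eq
      rw [hdm] at h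
      exact_mod_cast h
    have hsol := DaveyStewartson.isSolution_multiplier hp hp' hm hd hQ.mem hE
    exact ⟨_, DaveyStewartson.multiplier_pos hp hm hQ.mem.1 (hE.trans_lt hd0), hsol,
      fun ω' h' => hsol.unique hp hp' hQ.continuous hQ.pos h'⟩
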